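/- Let $a,b,\varepsilon>0$ and $\theta\in(0,\pi/2)$. **Blocks.** Given $\alpha,\beta,\delta>0$, put $d=\delta/(2\sin\theta)$ and suppose $d\cos\theta<\beta$. Let $H\subset\mathbb R^2$ be the hexagon $\{0\le x\le\beta,\ 0\le y\le h(x)\}$, where $h=\alpha/2$ for $x\le\ell:=(\beta-d\cos\theta)/2$, $h$ rises with slope $\tan\theta$ on $[\ell,\ell+d\cos\theta]$ (the dislocation line, of length $d$), and $h=(\alpha+\delta)/2$ for $x\ge\ell+d\cos\theta$. The block $\tilde R(\alpha,\beta,\theta,\delta)$ is obtained by gluing $H$ (lower half), with its intrinsic length metric, to its mirror image (upper half) along the broken line $y=h(x)$. It is a "rectangle" with right angles at its four corners and with left side of length $\alpha$, right side of length $\alpha+\delta$, and bottom and top sides of length $\beta$. **The spaces $\tilde{\mathcal M}_n$.** For $n\ge1$ with $\frac{\varepsilon}{2n^2\sin\theta}\cos\theta<\frac bn$ (this holds for all large $n$), $\tilde{\mathcal M}_n$ is obtained from the $n^2$ blocks $$\tilde{\mathcal M}_n(i,j)=\tilde R\big(a_{n,i},\ b/n,\ \theta,\ \varepsilon/n^2\big),\qquad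 a_{n,i}=\frac{a+(i-1)\varepsilon/n}{n},\qquad 1\le i,j\le n,$$ by gluing, by arclength, the right side of block $(i,j)$ to the left side of block $(i+1,j)$, and the top side of block $(i,j)$ to the bottom side of block $(i,j+1)$; $d_n$ is the resulting gluing (quotient) metric. **The sector $\mathcal N=\mathcal N(a,b,\varepsilon)$.** This is $[R_0,R_0+b]\times[0,\varepsilon/b]$ with $R_0=ab/\varepsilon$, in polar coordinates $(r,\varphi)$, with the intrinsic distance $d_{\mathcal N}$ of the Euclidean metric $dr^2+r^2d\varphi^2$. (If $\varepsilon/b\ge2\pi$ it is not regarded as a subset of the plane.) Put $r_i=R_0+(i-1)b/n$ and $\varphi_j=(j-1)\varepsilon/(bn)$ for $1\le i,j\le n+1$. **Theorem.** The spaces $\tilde{\mathcal M}_n$ and $\mathcal N$ are compact metric spaces, and $\tilde{\mathcal M}_n\to\mathcal N$ in the Gromov–Hausdorff sense as $n\to\infty$. More precisely, let $Y_n\subset\mathcal N$ be the union of the boundaries of the sub-sectors $[r_i,r_{i+1}]\times[\varphi_j,\varphi_{j+1}]$, $1\le i,j\le n$, and let $X_n\subset\tilde{\mathcal M}_n$ be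 the union of the boundaries of the blocks. There is a constant $C$, depending only on $a,b,\theta,\varepsilon$, such that for every $n$ as above: 1. $d_{GH}(\tilde{\mathcal M}_n,\mathcal N)\le C/n$. 2. The map $T_n:Y_n\to X_n$ that sends each side of the $(i,j)$-th sub-sector to the corresponding side of the $(i,j)$-th block by arclength ($r=r_i$ to the left side, $r=r_{i+1}$ to the right side, $\varphi=\varphi_j$ to the bottom side, $\varphi=\varphi_{j+1}$ to the top side) is well defined and bijective. It restricts to a bijection between the vertices of $Y_n$ and those of $X_n$. 3. The vertices of $Y_n$ and of $X_n$ are finite $C/n$-nets of $\mathcal N$ and of $\tilde{\mathcal M}_n$, respectively. 4. The distortion of $T_n$ is at most $C/n$, that is, $|d_{\mathcal N}(y,y')-d_n(T_n y,T_n y')|\le C/n$ for all $y,y'\in Y_n$. -/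

import Mathlib

open Set Filter Topology
open scoped ENNReal

noncomputable section

/-! ### Distance functions: curve length, disjoint unions, gluing -/

/-- `d` is a pseudo-distance with values in `[0, ∞]`. -/
structure IsPseudoEDist {X : Type*} (d : X → X → ℝ≥0∞) : Prop where
  self : ∀ x, d x x = 0
  symm : ∀ x y, d x y = d y x
  tri : ∀ x y z, d x z ≤ d x y + d y z

/-- The intrinsic (length) distance on a space `X` that is immersed in the Euclidean plane
by `Φ`: the infimum of the Euclidean lengths of `Φ ∘ γ` over the continuous curves `γ` in `X`
that connect the two points. -/
def pathEDist {X : Type*} [TopologicalSpace X] (Φ : X → EuclideanSpace ℝ (Fin 2))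
    (p q : X) : ℝ≥0∞ :=
  ⨅ γ : Path p q, eVariationOn (fun t => Φ (γ t)) univ

/-- The distance on a disjoint union: points of different pieces are at distance `∞`. -/
def sigmaEDist {ι : Type*} [DecidableEq ι] {X : ι → Type*} (d : ∀ i, X i → X i → ℝ≥0∞)
    (p q : Σ i, X i) : ℝ≥0∞ :=
  if h : p.1 = q.1 then d q.1 (h ▸ p.2) q.2 else ⊤

/-- The values `d(p₀,q₀) + ⋯ + d(pₖ,qₖ)` over all chains with `p₀ = x`, `qₖ = y` in which each
`qᵢ` is identified with `pᵢ₊₁` by the equivalence relation generated by `R`. -/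
inductive ChainLength {X : Type*} (d : X → X → ℝ≥0∞) (R : X → X → Prop) :
    X → X → ℝ≥0∞ → Prop
  | single (x y : X) : ChainLength d R x y (d x y)
  | cons (x y z w : X) (c : ℝ≥0∞) :
      Relation.EqvGen R y z → ChainLength d R z w c → ChainLength d R x w (d x y + c)

/-- The distance on the space obtained by gluing a space with distance `d` along the
identifications `R` (the standard quotient pseudo-metric). -/
def glueEDist {X : Type*} (d : X → X → ℝ≥0∞) (R : X → X → Prop) (x y : X) : ℝ≥0∞ :=
  sInf {c | ChainLength d R x y c}

theorem pathEDist_isPseudoEDist {X : Type*} [TopologicalSpace X]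
    (Φ : X → EuclideanSpace ℝ (Fin 2)) : IsPseudoEDist (pathEDist Φ) := by
  have hs : ∀ x y, pathEDist Φ x y ≤ pathEDist Φ y x := by
    intro x y
    refine le_iInf fun γ => (iInf_le _ γ.symm).trans ?_
    refine eVariationOn.comp_le_of_antitoneOn (fun t => Φ (γ t)) (φ := unitInterval.symm) (t := univ)
      ?_ (fun _ _ => mem_univ _)
    intro s _ t _ hst
    simpa using hst
  refine ⟨fun x => ?_, fun x y => le_antisymm (hs x y) (hs y x), fun x y z => ?_⟩
  · refine le_antisymm ((iInf_le _ (Path.refl x)).trans ?_) bot_le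
    have h : (fun t => Φ (Path.refl x t)) = fun _ => Φ x := rfl
    rw [h]
    refine (eVariationOn.eq_zero_iff _).2 ?_ |>.le
    simp
  · unfold pathEDist
    refine ENNReal.le_iInf_add_iInf fun γ γ' => (iInf_le _ (γ.trans γ')).trans ?_
    let m : unitInterval := ⟨1 / 2, by norm_num, by norm_num⟩
    have hu : (univ : Set unitInterval) = Iic m ∪ Ici m := by simp
    rw [show eVariationOn (fun t => Φ ((γ.trans γ') t)) univ = _ from by
      rw [hu, eVariationOn.union _ (x := m) isGreatest_Iic isLeast_Ici]]
    refine add_le_add ?_ ?_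
    · have h1 : EqOn (fun t => Φ ((γ.trans γ') t))
          ((fun t => Φ (γ t)) ∘ fun t : unitInterval => projIcc 0 1 zero_le_one (2 * (t : ℝ)))
          (Iic m) := by
        intro t ht
        have ht' : (t : ℝ) ≤ 1 / 2 := ht
        have h0 := t.2.1
        simp only [Function.comp, Path.trans_apply, dif_pos ht']
        rw [projIcc_of_mem zero_le_one (x := 2 * (t : ℝ)) ⟨by linarith, by linarith⟩]
      rw [eVariationOn.congr h1]
      refine eVariationOn.comp_le_of_monotoneOn _ _ ?_ (fun _ _ => mem_univ _)
      intro s _ t _ hst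
      exact monotone_projIcc _ (by have : (s : ℝ) ≤ t := hst
                                   linarith)
    · have h1 : EqOn (fun t => Φ ((γ.trans γ') t))
          ((fun t => Φ (γ' t)) ∘ fun t : unitInterval =>
            projIcc 0 1 zero_le_one (2 * (t : ℝ) - 1)) (Ici m) := by
        intro t ht
        have ht' : 1 / 2 ≤ (t : ℝ) := ht
        have h0 := t.2.2
        have hp := projIcc_of_mem zero_le_one (x := 2 * (t : ℝ) - 1) ⟨by linarith, by linarith⟩
        simp only [Function.comp, Path.trans_apply]
        split_ifs with h
        · have : (t : ℝ) = 1 / 2 := le_antisymm h ht'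
          have e1 : (⟨2 * (t : ℝ), by constructor <;> linarith⟩ : unitInterval) = 1 :=
            Subtype.ext (by simp [this])
          have e2 : projIcc (0 : ℝ) 1 zero_le_one (2 * (t : ℝ) - 1) = 0 :=
            hp.trans (Subtype.ext (by simp [this]))
          rw [e2, e1]
          simp
        · rw [hp]
      rw [eVariationOn.congr h1]
      refine eVariationOn.comp_le_of_monotoneOn _ _ ?_ (fun _ _ => mem_univ _)
      intro s _ t _ hst
      exact monotone_projIcc _ (by have : (s : ℝ) ≤ t := hst
                                   linarith)

/-- A `K`-Lipschitz curve bounds the intrinsic distance by `K`. -/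
theorem pathEDist_le_of_lipschitz {X : Type*} [TopologicalSpace X]
    (Φ : X → EuclideanSpace ℝ (Fin 2)) {p q : X} (γ : Path p q) (K : NNReal)
    (h : ∀ s t : unitInterval, dist (Φ (γ s)) (Φ (γ t)) ≤ K * |(s : ℝ) - t|) :
    pathEDist Φ p q ≤ K := by
  refine (iInf_le _ γ).trans (iSup_le fun u => ?_)
  have hm := u.2.2.1
  calc ∑ i ∈ Finset.range u.1, edist (Φ (γ (u.2.1 (i + 1)))) (Φ (γ (u.2.1 i)))
      ≤ ∑ i ∈ Finset.range u.1, ENNReal.ofReal (K * ((u.2.1 (i + 1) : ℝ) - u.2.1 i)) := by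
        refine Finset.sum_le_sum fun i _ => ?_
        rw [edist_dist]
        refine ENNReal.ofReal_le_ofReal ((h _ _).trans_eq ?_)
        have : ((u.2.1 i : unitInterval) : ℝ) ≤ u.2.1 (i + 1) := hm (Nat.le_succ i)
        rw [abs_of_nonneg (sub_nonneg.2 this)]
    _ = ENNReal.ofReal (∑ i ∈ Finset.range u.1, K * ((u.2.1 (i + 1) : ℝ) - u.2.1 i)) := by
        rw [ENNReal.ofReal_sum_of_nonneg]
        intro i _
        have : ((u.2.1 i : unitInterval) : ℝ) ≤ u.2.1 (i + 1) := hm (Nat.le_succ i)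
        exact mul_nonneg K.2 (sub_nonneg.2 this)
    _ ≤ ENNReal.ofReal K := by
        refine ENNReal.ofReal_le_ofReal ?_
        rw [← Finset.mul_sum, Finset.sum_range_sub (fun i => (u.2.1 i : ℝ))]
        have h1 := (u.2.1 u.1).2.2
        have h0 := (u.2.1 0).2.1
        have hK : (0 : ℝ) ≤ K := K.2
        nlinarith
    _ = K := by simp

theorem sigmaEDist_isPseudoEDist {ι : Type*} [DecidableEq ι] {X : ι → Type*}
    {d : ∀ i, X i → X i → ℝ≥0∞} (hd : ∀ i, IsPseudoEDist (d i)) :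
    IsPseudoEDist (sigmaEDist d) := by
  refine ⟨?_, ?_, ?_⟩
  · rintro ⟨i, x⟩
    simp [sigmaEDist, (hd i).self]
  · rintro ⟨i, x⟩ ⟨j, y⟩
    by_cases h : i = j
    · subst h
      simp [sigmaEDist, (hd i).symm x y]
    · simp [sigmaEDist, h, Ne.symm h]
  · rintro ⟨i, x⟩ ⟨j, y⟩ ⟨k, z⟩
    by_cases h : i = j
    · subst h
      by_cases h' : i = k
      · subst h'
        simpa [sigmaEDist] using (hd i).tri x y z
      · simp [sigmaEDist, h']
    · simp [sigmaEDist, h]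

theorem sigmaEDist_same {ι : Type*} [DecidableEq ι] {X : ι → Type*}
    (d : ∀ i, X i → X i → ℝ≥0∞) (i : ι) (x y : X i) :
    sigmaEDist d ⟨i, x⟩ ⟨i, y⟩ = d i x y := by
  simp [sigmaEDist]

theorem glueEDist_le {X : Type*} (d : X → X → ℝ≥0∞) (R : X → X → Prop) (x y : X) :
    glueEDist d R x y ≤ d x y :=
  sInf_le (ChainLength.single x y)

theorem glueEDist_eq_zero_of_rel {X : Type*} {d : X → X → ℝ≥0∞} (hd : IsPseudoEDist d)
    {R : X → X → Prop} {x y : X} (h : R x y) : glueEDist d R x y = 0 := by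
  refine le_antisymm (sInf_le ?_) bot_le
  have := ChainLength.cons (d := d) (R := R) x x y y _ (Relation.EqvGen.rel _ _ h)
    (ChainLength.single y y)
  simpa [hd.self] using this

theorem glueEDist_isPseudoEDist {X : Type*} {d : X → X → ℝ≥0∞} (hd : IsPseudoEDist d)
    (R : X → X → Prop) : IsPseudoEDist (glueEDist d R) := by
  have htrans : ∀ x y c, ChainLength d R x y c → ∀ z c', ChainLength d R y z c' →
      ChainLength d R x z (c + c') := by
    intro x y c h
    induction h with
    | single x y => exact fun z c' h' => ChainLength.cons x y y z c' (Relation.EqvGen.refl y) h'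
    | cons x y z w c hR _ ih =>
      intro v c' h'
      rw [add_assoc]
      exact ChainLength.cons x y z v _ hR (ih v c' h')
  have hsymm : ∀ x y c, ChainLength d R x y c → ChainLength d R y x c := by
    intro x y c h
    induction h with
    | single x y =>
      rw [hd.symm]
      exact ChainLength.single y x
    | cons x y z w c hR _ ih =>
      have h1 : ChainLength d R z x (0 + d x y) := by
        rw [hd.symm x y, ← hd.self z]
        exact ChainLength.cons z z y x _ (Relation.EqvGen.symm _ _ hR) (ChainLength.single y x)
      have := htrans _ _ _ ih _ _ h1
      rwa [zero_add, add_comm] at this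
  refine ⟨fun x => le_antisymm ((glueEDist_le d R x x).trans (hd.self x).le) bot_le, ?_, ?_⟩
  · intro x y
    exact congrArg sInf (Set.ext fun c => ⟨hsymm x y c, hsymm y x c⟩)
  · intro x y z
    simp only [glueEDist]
    rw [sInf_eq_iInf' {c | ChainLength d R x y c}, sInf_eq_iInf' {c | ChainLength d R y z c}]
    exact ENNReal.le_iInf_add_iInf fun c c' => sInf_le (htrans _ _ _ c.2 _ _ c'.2)

/-! ### The building block -/

/-- The four positive parameters `a, b, θ, ε`, with `2θ < π`. -/
structure DislocationParams where
  a : ℝ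
  b : ℝ
  θ : ℝ
  ε : ℝ
  a_pos : 0 < a
  b_pos : 0 < b
  θ_pos : 0 < θ
  θ_lt : θ < Real.pi / 2
  ε_pos : 0 < ε

namespace DislocationParams

variable (P : DislocationParams)

/-- The distance `d` between the singular points `p₋` and `p₊`, so that `ε = 2 d sin θ`. -/
def lineLength : ℝ := P.ε / (2 * Real.sin P.θ)

/-- The block with these parameters exists: the symmetrically placed broken line
`E p₋ p₊ F`, with `|E p₋| = |p₊ F| = (b - d cos θ) / 2`, has outer parts of positive length. -/
def BlockExists : Prop := P.lineLength * Real.cos P.θ < P.b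

/-- The broken line `E p₋ p₊ F` as a graph over the side `BC`: it has height `a / 2` up to `p₋`,
then rises at angle `θ` along the dislocation line `[p₋, p₊]`, and has height
`a / 2 + d sin θ = (a + ε) / 2` from `p₊` on. -/
def height (x : ℝ) : ℝ :=
  P.a / 2 + Real.tan P.θ *
    max 0 (min (x - (P.b - P.lineLength * Real.cos P.θ) / 2) (P.lineLength * Real.cos P.θ))

/-- The Euclidean hexagon `B C F p₊ p₋ E`, with `B` at the origin and `C` at `(b, 0)`.
The hexagon `A D F p₊ p₋ E` is its mirror image; it is described by the same set, with `A` at the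
origin and `D` at `(b, 0)`. -/
def hexagon : Set (EuclideanSpace ℝ (Fin 2)) :=
  {v | v 0 ∈ Icc 0 P.b ∧ v 1 ∈ Icc 0 (P.height (v 0))}

/-- The disjoint union of the two hexagons: the lower one, `B C F p₊ p₋ E`, has index `false`,
and the upper one, `A D F p₊ p₋ E`, has index `true`. -/
abbrev PreBlock : Type := Σ _ : Bool, P.hexagon

/-- The two hexagons are identified along the broken line `E p₋ p₊ F`. -/
def BlockGlue (p q : P.PreBlock) : Prop :=
  p.1 = false ∧ q.1 = true ∧ p.2 = q.2 ∧ p.2.1 1 = P.height (p.2.1 0)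

/-- The distance of the block `R̃(a, b, θ, ε)`: the two hexagons, each with its intrinsic distance,
are glued along `E p₋ p₊ F`. -/
def blockEDist : P.PreBlock → P.PreBlock → ℝ≥0∞ :=
  glueEDist (sigmaEDist fun _ => pathEDist (Subtype.val : P.hexagon → _)) P.BlockGlue

/-- `p` is the point of the side `BA` at distance `s` from `B`. -/
def IsLeft (p : P.PreBlock) (s : ℝ) : Prop :=
  p.2.1 0 = 0 ∧ s = if p.1 then P.a - p.2.1 1 else p.2.1 1

/-- `p` is the point of the side `CD` at distance `s` from `C`. -/
def IsRight (p : P.PreBlock) (s : ℝ) : Prop :=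
  p.2.1 0 = P.b ∧ s = if p.1 then P.a + P.ε - p.2.1 1 else p.2.1 1

/-- `p` is the point of the side `BC` at distance `t` from `B`. -/
def IsBottom (p : P.PreBlock) (t : ℝ) : Prop :=
  p.1 = false ∧ p.2.1 1 = 0 ∧ p.2.1 0 = t

/-- `p` is the point of the side `AD` at distance `t` from `A`. -/
def IsTop (p : P.PreBlock) (t : ℝ) : Prop :=
  p.1 = true ∧ p.2.1 1 = 0 ∧ p.2.1 0 = t

/-! ### The glued surface `M̃ₙ` -/

/-- The parameters `aₙ,ᵢ = (a + (i - 1) ε / n) / n`, `b / n`, `θ`, `ε / n²` of the blocks of the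
`i`-th column; columns and rows are numbered from `0` here. -/
def cell (n : ℕ) (i : Fin n) : DislocationParams where
  a := (P.a + i * P.ε / n) / n
  b := P.b / n
  θ := P.θ
  ε := P.ε / n ^ 2
  a_pos := by
    have hn : (0 : ℝ) < n := Nat.cast_pos.2 i.pos
    have := P.a_pos
    have := P.ε_pos
    positivity
  b_pos := div_pos P.b_pos (Nat.cast_pos.2 i.pos)
  θ_pos := P.θ_pos
  θ_lt := P.θ_lt
  ε_pos := div_pos P.ε_pos (pow_pos (Nat.cast_pos.2 i.pos) 2)

/-- The disjoint union of the `n²` blocks; `(i, j)` is the block in column `i` and row `j`. -/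
def PreGlued (n : ℕ) : Type := Σ ij : Fin n × Fin n, (P.cell n ij.1).PreBlock

/-- Adjacent blocks are identified along their common side: the right side of block `(i, j)` with
the left side of block `(i + 1, j)`, and the top side of block `(i, j)` with the bottom side of
block `(i, j + 1)`. -/
def CellGlue (n : ℕ) (p q : P.PreGlued n) : Prop :=
  ((q.1.1 : ℕ) = p.1.1 + 1 ∧ q.1.2 = p.1.2 ∧
    ∃ s, (P.cell n p.1.1).IsRight p.2 s ∧ (P.cell n q.1.1).IsLeft q.2 s) ∨
  (q.1.1 = p.1.1 ∧ (q.1.2 : ℕ) = p.1.2 + 1 ∧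
    ∃ t, (P.cell n p.1.1).IsTop p.2 t ∧ (P.cell n q.1.1).IsBottom q.2 t)

/-- The distance on the disjoint union of the blocks. -/
def preGluedEDist (n : ℕ) : P.PreGlued n → P.PreGlued n → ℝ≥0∞ :=
  sigmaEDist (X := fun ij : Fin n × Fin n => (P.cell n ij.1).PreBlock)
    fun ij => (P.cell n ij.1).blockEDist

/-- The distance `dₙ`: the `n²` blocks, each with its own distance, are glued along their
sides. -/
def gluedEDist (n : ℕ) : P.PreGlued n → P.PreGlued n → ℝ≥0∞ :=
  glueEDist (P.preGluedEDist n) (P.CellGlue n)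

/-! ### The annular sector `N(a, b, ε)` -/

/-- The inner radius `ab / ε`. -/
def innerRadius : ℝ := P.a * P.b / P.ε

/-- The sector in polar coordinates `(r, φ) ∈ [R₀, R₀ + b] × [0, ε / b]`. It is not assumed that
`ε / b < 2π`. -/
def sectorSet : Set (ℝ × ℝ) :=
  Icc P.innerRadius (P.innerRadius + P.b) ×ˢ Icc 0 (P.ε / P.b)

/-- The passage from polar to Cartesian coordinates. -/
def polar (p : ℝ × ℝ) : EuclideanSpace ℝ (Fin 2) :=
  !₂[p.1 * Real.cos p.2, p.1 * Real.sin p.2]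

/-- The annular sector; its distance is defined below. -/
def Sector : Type := P.sectorSet

/-- The intrinsic Euclidean distance of the sector (the Riemannian distance of
`dr² + r² dφ²`). -/
def sectorEDist : P.Sector → P.Sector → ℝ≥0∞ :=
  pathEDist (X := P.sectorSet) (fun p => polar p.1)

/-! ### Finiteness and compactness -/

theorem height_pos (x : ℝ) : 0 < P.height x := by
  have h1 := P.a_pos
  have h2 : 0 < Real.tan P.θ := Real.tan_pos_of_pos_of_lt_pi_div_two P.θ_pos P.θ_lt
  have h3 : 0 ≤ max 0 (min (x - (P.b - P.lineLength * Real.cos P.θ) / 2)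
    (P.lineLength * Real.cos P.θ)) := le_max_left _ _
  unfold height
  positivity

theorem continuous_height : Continuous P.height := by
  unfold height
  fun_prop

theorem height_lipschitz (x y : ℝ) :
    |P.height x - P.height y| ≤ Real.tan P.θ * |x - y| := by
  have h2 : 0 < Real.tan P.θ := Real.tan_pos_of_pos_of_lt_pi_div_two P.θ_pos P.θ_lt
  unfold height
  rw [add_sub_add_left_eq_sub, ← mul_sub, abs_mul, abs_of_pos h2]
  refine mul_le_mul_of_nonneg_left ?_ h2.le
  refine (abs_max_sub_max_le_max _ _ _ _).trans ?_
  refine max_le (by simp) ((abs_min_sub_min_le_max _ _ _ _).trans ?_)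
  exact max_le (by simp) (by simp)

theorem euclid_dist_le (v w : EuclideanSpace ℝ (Fin 2)) :
    dist v w ≤ |v 0 - w 0| + |v 1 - w 1| := by
  rw [EuclideanSpace.dist_eq, Fin.sum_univ_two, Real.dist_eq, Real.dist_eq]
  refine Real.sqrt_le_iff.2 ⟨by positivity, ?_⟩
  nlinarith [abs_nonneg (v 0 - w 0), abs_nonneg (v 1 - w 1)]

theorem euclid_coord_le (v w : EuclideanSpace ℝ (Fin 2)) (i : Fin 2) :
    |v i - w i| ≤ dist v w := by
  rw [← Real.dist_eq, dist_eq_norm, dist_eq_norm]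
  exact PiLp.norm_apply_le (v - w) i

theorem hexagon_pathEDist_le (v w : P.hexagon) :
    pathEDist (Subtype.val : P.hexagon → _) v w ≤
      ENNReal.ofReal (2 + Real.tan P.θ) * edist v w := by
  have hT : 0 < Real.tan P.θ := Real.tan_pos_of_pos_of_lt_pi_div_two P.θ_pos P.θ_lt
  obtain ⟨v, hv⟩ := v
  obtain ⟨w, hw⟩ := w
  set x : unitInterval → ℝ := fun t => v 0 + t * (w 0 - v 0) with hx
  set y : unitInterval → ℝ := fun t => min (v 1 + t * (w 1 - v 1)) (P.height (x t)) with hy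
  have cx : Continuous x := by fun_prop
  have cy : Continuous y := by
    have := P.continuous_height.comp cx
    exact Continuous.min (by fun_prop) this
  have hmem : ∀ t, (!₂[x t, y t] : EuclideanSpace ℝ (Fin 2)) ∈ P.hexagon := by
    intro t
    have t0 := t.2.1
    have t1 := t.2.2
    obtain ⟨⟨a1, a2⟩, a3, -⟩ := hv
    obtain ⟨⟨b1, b2⟩, b3, -⟩ := hw
    refine ⟨⟨?_, ?_⟩, ?_, ?_⟩
    · change 0 ≤ v 0 + t * (w 0 - v 0)
      nlinarith
    · change v 0 + t * (w 0 - v 0) ≤ P.b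
      nlinarith
    · change 0 ≤ y t
      refine le_min ?_ (P.height_pos _).le
      nlinarith
    · exact min_le_right _ _
  let γ : Path (⟨v, hv⟩ : P.hexagon) ⟨w, hw⟩ :=
    { toFun := fun t => ⟨!₂[x t, y t], hmem t⟩
      continuous_toFun := by
        refine Continuous.subtype_mk ?_ _
        refine (PiLp.continuous_toLp 2 _).comp (continuous_pi fun i => ?_)
        fin_cases i
        · exact cx
        · exact cy
      source' := by
        refine Subtype.ext (PiLp.ext fun i => ?_)
        fin_cases i
        · simp [hx]
        · simpa [hx, hy] using hv.2.2
      target' := by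
        refine Subtype.ext (PiLp.ext fun i => ?_)
        fin_cases i
        · simp [hx]
        · simpa [hx, hy] using hw.2.2 }
  have hK : 0 ≤ (2 + Real.tan P.θ) * dist v w := by positivity
  have main := pathEDist_le_of_lipschitz (Subtype.val : P.hexagon → _) γ
    ⟨(2 + Real.tan P.θ) * dist v w, hK⟩ ?_
  · refine main.trans_eq ?_
    rw [Subtype.edist_eq, edist_dist, ← ENNReal.ofReal_mul (by positivity)]
    exact (ENNReal.ofReal_eq_coe_nnreal hK).symm
  · intro s t
    refine (euclid_dist_le _ _).trans ?_
    change |x s - x t| + |y s - y t| ≤ (2 + Real.tan P.θ) * dist v w * |(s : ℝ) - t|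
    have e0 : |x s - x t| ≤ dist v w * |(s : ℝ) - t| := by
      have : x s - x t = (w 0 - v 0) * ((s : ℝ) - t) := by
        simp only [hx]
        ring
      rw [this, abs_mul, dist_comm]
      exact mul_le_mul_of_nonneg_right (euclid_coord_le w v 0) (abs_nonneg _)
    have e1 : |y s - y t| ≤ (1 + Real.tan P.θ) * dist v w * |(s : ℝ) - t| := by
      refine (abs_min_sub_min_le_max _ _ _ _).trans (max_le ?_ ?_)
      · have : v 1 + s * (w 1 - v 1) - (v 1 + t * (w 1 - v 1)) =
            (w 1 - v 1) * ((s : ℝ) - t) := by ring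
        rw [this, abs_mul]
        refine mul_le_mul_of_nonneg_right ?_ (abs_nonneg _)
        have h1 := euclid_coord_le w v 1
        rw [dist_comm] at h1
        have : 0 ≤ Real.tan P.θ * dist v w := by positivity
        linarith
      · refine (P.height_lipschitz _ _).trans ?_
        have := mul_le_mul_of_nonneg_left e0 hT.le
        have h3 : 0 ≤ dist v w * |(s : ℝ) - t| := by positivity
        nlinarith
    linarith

theorem blockEDist_isPseudoEDist : IsPseudoEDist P.blockEDist :=
  glueEDist_isPseudoEDist (sigmaEDist_isPseudoEDist fun _ => pathEDist_isPseudoEDist _) _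

theorem preGluedEDist_isPseudoEDist (n : ℕ) : IsPseudoEDist (P.preGluedEDist n) :=
  sigmaEDist_isPseudoEDist (X := fun ij : Fin n × Fin n => (P.cell n ij.1).PreBlock)
    (d := fun ij => (P.cell n ij.1).blockEDist)
    fun ij => (P.cell n ij.1).blockEDist_isPseudoEDist

theorem gluedEDist_isPseudoEDist (n : ℕ) : IsPseudoEDist (P.gluedEDist n) :=
  glueEDist_isPseudoEDist (P.preGluedEDist_isPseudoEDist n) _

theorem blockEDist_le (s : Bool) (v w : P.hexagon) :
    P.blockEDist ⟨s, v⟩ ⟨s, w⟩ ≤ ENNReal.ofReal (2 + Real.tan P.θ) * edist v w := by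
  refine (glueEDist_le _ _ _ _).trans ?_
  rw [sigmaEDist_same (fun _ : Bool => pathEDist (Subtype.val : P.hexagon → _))]
  exact P.hexagon_pathEDist_le v w

theorem blockEDist_ne_top (p q : P.PreBlock) : P.blockEDist p q ≠ ⊤ := by
  have same : ∀ s v w, P.blockEDist ⟨s, v⟩ ⟨s, w⟩ ≠ ⊤ := fun s v w =>
    ne_top_of_le_ne_top (ENNReal.mul_ne_top ENNReal.ofReal_ne_top (edist_ne_top _ _))
      (P.blockEDist_le s v w)
  have hm : (!₂[0, P.height 0] : EuclideanSpace ℝ (Fin 2)) ∈ P.hexagon := by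
    refine ⟨⟨le_refl _, P.b_pos.le⟩, (P.height_pos 0).le, le_refl _⟩
  have hE : P.blockEDist ⟨false, ⟨_, hm⟩⟩ ⟨true, ⟨_, hm⟩⟩ ≠ ⊤ := by
    refine ne_of_eq_of_ne (glueEDist_eq_zero_of_rel
      (sigmaEDist_isPseudoEDist fun _ => pathEDist_isPseudoEDist _) ?_) ENNReal.zero_ne_top
    exact ⟨rfl, rfl, rfl, rfl⟩
  have key : ∀ p, P.blockEDist p ⟨true, ⟨_, hm⟩⟩ ≠ ⊤ := by
    rintro ⟨s, v⟩
    cases s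
    · exact ne_top_of_le_ne_top (ENNReal.add_ne_top.2 ⟨same false v ⟨_, hm⟩, hE⟩)
        (P.blockEDist_isPseudoEDist.tri _ _ _)
    · exact same _ _ _
  refine ne_top_of_le_ne_top (ENNReal.add_ne_top.2 ⟨key p, key q⟩) ?_
  rw [P.blockEDist_isPseudoEDist.symm q]
  exact P.blockEDist_isPseudoEDist.tri _ _ _

theorem gluedEDist_same_le (n : ℕ) (ij : Fin n × Fin n) (p q : (P.cell n ij.1).PreBlock) :
    P.gluedEDist n ⟨ij, p⟩ ⟨ij, q⟩ ≤ (P.cell n ij.1).blockEDist p q := by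
  refine (glueEDist_le _ _ _ _).trans_eq ?_
  exact sigmaEDist_same (X := fun ij : Fin n × Fin n => (P.cell n ij.1).PreBlock)
    (fun ij => (P.cell n ij.1).blockEDist) ij p q

theorem gluedEDist_ne_top (n : ℕ) (p q : P.PreGlued n) : P.gluedEDist n p q ≠ ⊤ := by
  have hD := P.gluedEDist_isPseudoEDist n
  have same : ∀ (ij : Fin n × Fin n) (p q : (P.cell n ij.1).PreBlock),
      P.gluedEDist n ⟨ij, p⟩ ⟨ij, q⟩ ≠ ⊤ :=
    fun ij p q => ne_top_of_le_ne_top ((P.cell n ij.1).blockEDist_ne_top p q)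
      (P.gluedEDist_same_le n ij p q)
  have hzero : ∀ p q, P.CellGlue n p q → P.gluedEDist n p q ≠ ⊤ := fun p q h =>
    ne_of_eq_of_ne (glueEDist_eq_zero_of_rel (P.preGluedEDist_isPseudoEDist n) h)
      ENNReal.zero_ne_top
  have trans : ∀ {p q r}, P.gluedEDist n p q ≠ ⊤ → P.gluedEDist n q r ≠ ⊤ →
      P.gluedEDist n p r ≠ ⊤ := fun h h' =>
    ne_top_of_le_ne_top (ENNReal.add_ne_top.2 ⟨h, h'⟩) (hD.tri _ _ _)
  have symm : ∀ {p q}, P.gluedEDist n p q ≠ ⊤ → P.gluedEDist n q p ≠ ⊤ := by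
    intro p q h
    rwa [hD.symm]
  have m0 : ∀ Q : DislocationParams,
      (!₂[0, 0] : EuclideanSpace ℝ (Fin 2)) ∈ Q.hexagon := fun Q =>
    ⟨⟨le_refl _, Q.b_pos.le⟩, le_refl _, (Q.height_pos _).le⟩
  have m1 : ∀ Q : DislocationParams,
      (!₂[Q.b, 0] : EuclideanSpace ℝ (Fin 2)) ∈ Q.hexagon := fun Q =>
    ⟨⟨Q.b_pos.le, le_refl _⟩, le_refl _, (Q.height_pos _).le⟩
  have cl : ∀ Q : DislocationParams, Q.IsLeft ⟨false, ⟨_, m0 Q⟩⟩ 0 := fun Q => ⟨rfl, rfl⟩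
  have cr : ∀ Q : DislocationParams, Q.IsRight ⟨false, ⟨_, m1 Q⟩⟩ 0 := fun Q => ⟨rfl, rfl⟩
  have ct : ∀ Q : DislocationParams, Q.IsTop ⟨true, ⟨_, m0 Q⟩⟩ 0 := fun Q => ⟨rfl, rfl, rfl⟩
  have cb : ∀ Q : DislocationParams, Q.IsBottom ⟨false, ⟨_, m0 Q⟩⟩ 0 := fun Q => ⟨rfl, rfl, rfl⟩
  -- the corners `B` of the blocks are at finite distance from each other
  obtain ⟨B, hB, hright, hup⟩ : ∃ B : Fin n × Fin n → P.PreGlued n,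
      (∀ (ij : Fin n × Fin n) (p : (P.cell n ij.1).PreBlock), P.gluedEDist n ⟨ij, p⟩ (B ij) ≠ ⊤) ∧
      (∀ i i' j : Fin n, (i' : ℕ) = i + 1 → P.gluedEDist n (B (i', j)) (B (i, j)) ≠ ⊤) ∧
      (∀ i j j' : Fin n, (j' : ℕ) = j + 1 → P.gluedEDist n (B (i, j')) (B (i, j)) ≠ ⊤) := by
    refine ⟨fun ij => ⟨ij, ⟨false, ⟨_, m0 (P.cell n ij.1)⟩⟩⟩, fun ij p => same ij p _, ?_, ?_⟩
    · intro i i' j h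
      refine trans (q := ⟨(i, j), ⟨false, ⟨_, m1 (P.cell n i)⟩⟩⟩) (symm (hzero _ _ ?_))
        (same (i, j) _ _)
      exact Or.inl ⟨h, rfl, 0, cr _, cl _⟩
    · intro i j j' h
      refine trans (q := ⟨(i, j), ⟨true, ⟨_, m0 (P.cell n i)⟩⟩⟩) (symm (hzero _ _ ?_))
        (same (i, j) _ _)
      exact Or.inr ⟨rfl, h, 0, ct _, cb _⟩
  have hn : 0 < n := p.1.1.pos
  have right : ∀ k (hk : k < n) (j : Fin n),
      P.gluedEDist n (B (⟨k, hk⟩, j)) (B (⟨0, hn⟩, j)) ≠ ⊤ := by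
    intro k
    induction k with
    | zero => exact fun hk j => ne_of_eq_of_ne (hD.self _) ENNReal.zero_ne_top
    | succ k ih =>
      intro hk j
      have hk' : k < n := by omega
      exact trans (hright ⟨k, hk'⟩ ⟨k + 1, hk⟩ j rfl) (ih hk' j)
  have up : ∀ k (hk : k < n),
      P.gluedEDist n (B (⟨0, hn⟩, ⟨k, hk⟩)) (B (⟨0, hn⟩, ⟨0, hn⟩)) ≠ ⊤ := by
    intro k
    induction k with
    | zero => exact fun hk => ne_of_eq_of_ne (hD.self _) ENNReal.zero_ne_top
    | succ k ih =>
      intro hk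
      have hk' : k < n := by omega
      exact trans (hup ⟨0, hn⟩ ⟨k, hk'⟩ ⟨k + 1, hk⟩ rfl) (ih hk')
  have key : ∀ p, P.gluedEDist n p (B (⟨0, hn⟩, ⟨0, hn⟩)) ≠ ⊤ := by
    rintro ⟨⟨⟨i, hi⟩, ⟨j, hj⟩⟩, p⟩
    exact trans (hB _ _) (trans (right i hi ⟨j, hj⟩) (up j hj))
  exact trans (key p) (symm (key q))

instance (n : ℕ) : PseudoEMetricSpace (P.PreGlued n) where
  edist := P.gluedEDist n
  edist_self := (P.gluedEDist_isPseudoEDist n).self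
  edist_comm := (P.gluedEDist_isPseudoEDist n).symm
  edist_triangle := (P.gluedEDist_isPseudoEDist n).tri

instance (n : ℕ) : PseudoMetricSpace (P.PreGlued n) :=
  PseudoEMetricSpace.toPseudoMetricSpace (P.gluedEDist_ne_top n)

/-- The space `M̃ₙ`: the disjoint union of the blocks with the gluing distance, points at distance
`0` being identified. -/
def Glued (n : ℕ) : Type := SeparationQuotient (P.PreGlued n)

instance (n : ℕ) : MetricSpace (P.Glued n) :=
  inferInstanceAs (MetricSpace (SeparationQuotient (P.PreGlued n)))

/-- The point of `M̃ₙ` represented by the point `p` of block `(i, j)`. -/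
def toGlued (n : ℕ) (i j : Fin n) (p : (P.cell n i).PreBlock) : P.Glued n :=
  SeparationQuotient.mk (⟨(i, j), p⟩ : P.PreGlued n)

theorem isCompact_hexagon : IsCompact P.hexagon := by
  have hT : 0 < Real.tan P.θ := Real.tan_pos_of_pos_of_lt_pi_div_two P.θ_pos P.θ_lt
  refine Metric.isCompact_of_isClosed_isBounded ?_ ?_
  · have c0 : Continuous fun v : EuclideanSpace ℝ (Fin 2) => v 0 := by fun_prop
    have c1 : Continuous fun v : EuclideanSpace ℝ (Fin 2) => v 1 := by fun_prop
    have c2 := P.continuous_height.comp c0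
    have : P.hexagon = {v | 0 ≤ v 0} ∩ {v | v 0 ≤ P.b} ∩ ({v | 0 ≤ v 1} ∩
        {v | v 1 ≤ (P.height ∘ fun v : EuclideanSpace ℝ (Fin 2) => v 0) v}) := by
      ext v
      simp [hexagon, and_assoc]
    rw [this]
    exact ((isClosed_le continuous_const c0).inter (isClosed_le c0 continuous_const)).inter
      ((isClosed_le continuous_const c1).inter (isClosed_le c1 c2))
  · refine (Metric.isBounded_iff_subset_closedBall 0).2
      ⟨P.b + (P.height 0 + Real.tan P.θ * P.b), fun v hv => ?_⟩
    obtain ⟨⟨h1, h2⟩, h3, h4⟩ := hv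
    refine Metric.mem_closedBall.2 ((euclid_dist_le v 0).trans ?_)
    have h5 := P.height_lipschitz (v 0) 0
    rw [sub_zero, abs_of_nonneg h1] at h5
    have h6 := le_abs_self (P.height (v 0) - P.height 0)
    have h7 := mul_le_mul_of_nonneg_left h2 hT.le
    simp only [PiLp.zero_apply, sub_zero]
    rw [abs_of_nonneg h1, abs_of_nonneg h3]
    linarith

instance (n : ℕ) : CompactSpace (P.Glued n) := by
  have hc : ∀ (ij : Fin n × Fin n) (s : Bool), Continuous
      (fun v : (P.cell n ij.1).hexagon => P.toGlued n ij.1 ij.2 ⟨s, v⟩) := by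
    intro ij s
    refine SeparationQuotient.continuous_mk.comp ?_
    refine LipschitzWith.continuous (K := Real.toNNReal (2 + Real.tan (P.cell n ij.1).θ)) ?_
    intro v w
    exact (P.gluedEDist_same_le n ij _ _).trans ((P.cell n ij.1).blockEDist_le s v w)
  refine ⟨?_⟩
  have : (univ : Set (P.Glued n)) = ⋃ k : (Fin n × Fin n) × Bool,
      range (fun v : (P.cell n k.1.1).hexagon => P.toGlued n k.1.1 k.1.2 ⟨k.2, v⟩) := by
    refine (eq_univ_of_forall fun x => ?_).symm
    obtain ⟨⟨ij, s, v⟩, rfl⟩ := SeparationQuotient.surjective_mk x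
    exact mem_iUnion.2 ⟨(ij, s), v, rfl⟩
  rw [this]
  refine isCompact_iUnion fun k => ?_
  have := isCompact_iff_compactSpace.1 (P.cell n k.1.1).isCompact_hexagon
  exact isCompact_range (hc k.1 k.2)

instance (n : ℕ+) : Nonempty (P.Glued n) := by
  let i : Fin n := ⟨0, n.pos⟩
  refine ⟨P.toGlued n i i ⟨false, ⟨!₂[0, 0], ?_⟩⟩⟩
  exact ⟨⟨le_refl _, (P.cell n i).b_pos.le⟩, le_refl _, ((P.cell n i).height_pos _).le⟩

theorem innerRadius_pos : 0 < P.innerRadius :=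
  div_pos (mul_pos P.a_pos P.b_pos) P.ε_pos

theorem polar_dist_le (p q : ℝ × ℝ) :
    dist (polar p) (polar q) ≤ 2 * (|p.1 - q.1| + |q.1| * |p.2 - q.2|) := by
  refine (euclid_dist_le _ _).trans ?_
  change |p.1 * Real.cos p.2 - q.1 * Real.cos q.2| +
    |p.1 * Real.sin p.2 - q.1 * Real.sin q.2| ≤ _
  have gen : ∀ u v : ℝ, |u| ≤ 1 → |u - v| ≤ |p.2 - q.2| →
      |p.1 * u - q.1 * v| ≤ |p.1 - q.1| + |q.1| * |p.2 - q.2| := by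
    intro u v hu huv
    have : p.1 * u - q.1 * v = (p.1 - q.1) * u + q.1 * (u - v) := by ring
    rw [this]
    refine (abs_add_le _ _).trans ?_
    rw [abs_mul, abs_mul]
    refine add_le_add ?_ (mul_le_mul_of_nonneg_left huv (abs_nonneg _))
    exact mul_le_of_le_one_right (abs_nonneg _) hu
  have lc : |Real.cos p.2 - Real.cos q.2| ≤ |p.2 - q.2| := by
    simpa [Real.dist_eq] using Real.lipschitzWith_cos.dist_le_mul p.2 q.2
  have ls : |Real.sin p.2 - Real.sin q.2| ≤ |p.2 - q.2| := by
    simpa [Real.dist_eq] using Real.lipschitzWith_sin.dist_le_mul p.2 q.2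
  have h1 := gen _ _ (Real.abs_cos_le_one p.2) lc
  have h2 := gen _ _ (Real.abs_sin_le_one p.2) ls
  linarith

theorem sectorEDist_le (p q : P.sectorSet) :
    P.sectorEDist p q ≤ ENNReal.ofReal (2 * (1 + (P.innerRadius + P.b))) * edist p q := by
  have hR := P.innerRadius_pos
  have hb := P.b_pos
  obtain ⟨p, hp⟩ := p
  obtain ⟨q, hq⟩ := q
  have hconv : Convex ℝ P.sectorSet := (convex_Icc _ _).prod (convex_Icc _ _)
  have hmem : ∀ t : unitInterval, p + (t : ℝ) • (q - p) ∈ P.sectorSet := fun t =>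
    hconv.add_smul_sub_mem hp hq t.2
  let γ : Path (⟨p, hp⟩ : P.sectorSet) ⟨q, hq⟩ :=
    { toFun := fun t => ⟨p + (t : ℝ) • (q - p), hmem t⟩
      continuous_toFun := by fun_prop
      source' := by simp
      target' := by simp }
  have hK : 0 ≤ 2 * (1 + (P.innerRadius + P.b)) * dist p q := by positivity
  refine (pathEDist_le_of_lipschitz (fun p : P.sectorSet => polar p.1) γ
    ⟨2 * (1 + (P.innerRadius + P.b)) * dist p q, hK⟩ ?_).trans_eq ?_
  · intro s t
    refine (polar_dist_le _ _).trans ?_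
    have d1 : |p.1 - q.1| ≤ dist p q := le_max_left _ _
    have d2 : |p.2 - q.2| ≤ dist p q := le_max_right _ _
    have e1 : |(p + (s : ℝ) • (q - p)).1 - (p + (t : ℝ) • (q - p)).1| ≤
        dist p q * |(s : ℝ) - t| := by
      have : (p + (s : ℝ) • (q - p)).1 - (p + (t : ℝ) • (q - p)).1 =
          (q.1 - p.1) * ((s : ℝ) - t) := by
        simp
        ring
      rw [this, abs_mul, abs_sub_comm q.1]
      exact mul_le_mul_of_nonneg_right d1 (abs_nonneg _)
    have e2 : |(p + (s : ℝ) • (q - p)).2 - (p + (t : ℝ) • (q - p)).2| ≤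
        dist p q * |(s : ℝ) - t| := by
      have : (p + (s : ℝ) • (q - p)).2 - (p + (t : ℝ) • (q - p)).2 =
          (q.2 - p.2) * ((s : ℝ) - t) := by
        simp
        ring
      rw [this, abs_mul, abs_sub_comm q.2]
      exact mul_le_mul_of_nonneg_right d2 (abs_nonneg _)
    have e3 : |(p + (t : ℝ) • (q - p)).1| ≤ P.innerRadius + P.b := by
      obtain ⟨⟨h1, h2⟩, -⟩ := hmem t
      rw [abs_of_nonneg (hR.le.trans h1)]
      exact h2
    have e4 := mul_le_mul e3 e2 (abs_nonneg _) (by positivity)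
    change 2 * (|(p + (s : ℝ) • (q - p)).1 - (p + (t : ℝ) • (q - p)).1| +
      |(p + (t : ℝ) • (q - p)).1| *
        |(p + (s : ℝ) • (q - p)).2 - (p + (t : ℝ) • (q - p)).2|) ≤
      2 * (1 + (P.innerRadius + P.b)) * dist p q * |(s : ℝ) - t|
    linarith
  · rw [Subtype.edist_eq, edist_dist, ← ENNReal.ofReal_mul (by positivity)]
    exact (ENNReal.ofReal_eq_coe_nnreal hK).symm

theorem sectorEDist_isPseudoEDist : IsPseudoEDist P.sectorEDist :=
  pathEDist_isPseudoEDist (X := P.sectorSet) _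

theorem polar_norm_sq (p : ℝ × ℝ) : ‖polar p‖ ^ 2 = p.1 ^ 2 := by
  rw [EuclideanSpace.norm_sq_eq, Fin.sum_univ_two]
  simp only [polar, Real.norm_eq_abs, sq_abs]
  change (p.1 * Real.cos p.2) ^ 2 + (p.1 * Real.sin p.2) ^ 2 = p.1 ^ 2
  nlinarith [Real.sin_sq_add_cos_sq p.2]

/-- `polar` separates points of positive radius whose angles differ by less than `2π`. -/
theorem polar_inj {p q : ℝ × ℝ} (hp : 0 < p.1) (hq : 0 < q.1) (h : polar p = polar q)
    (hφ : |p.2 - q.2| < 2 * Real.pi) : p = q := by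
  have h1 : p.1 = q.1 := by
    have : p.1 ^ 2 = q.1 ^ 2 := by rw [← polar_norm_sq, ← polar_norm_sq, h]
    exact (pow_left_inj₀ hp.le hq.le two_ne_zero).1 this
  have hc : p.1 * Real.cos p.2 = q.1 * Real.cos q.2 := congrFun (congrArg WithLp.ofLp h) 0
  have hs : p.1 * Real.sin p.2 = q.1 * Real.sin q.2 := congrFun (congrArg WithLp.ofLp h) 1
  rw [h1] at hc hs
  have hc' := mul_left_cancel₀ hq.ne' hc
  have hs' := mul_left_cancel₀ hq.ne' hs
  have hd : Real.cos (p.2 - q.2) = 1 := by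
    rw [Real.cos_sub, hc', hs']
    nlinarith [Real.sin_sq_add_cos_sq q.2]
  have := abs_lt.1 hφ
  have := (Real.cos_eq_one_iff_of_lt_of_lt (by linarith) (by linarith)).1 hd
  exact Prod.ext h1 (by linarith)

theorem eq_of_sectorEDist_eq_zero {p q : P.sectorSet} (h : P.sectorEDist p q = 0) : p = q := by
  have hR := P.innerRadius_pos
  have pos : ∀ x : P.sectorSet, 0 < x.1.1 := fun x => hR.trans_le x.2.1.1
  have hlen : ∀ x y : P.sectorSet, ∀ γ : Path x y, ∀ t : unitInterval,
      edist (polar x.1) (polar (γ t).1) ≤ eVariationOn (fun t => polar (γ t).1) univ := by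
    intro x y γ t
    have := eVariationOn.edist_le (fun t => polar (γ t).1) (mem_univ (0 : unitInterval))
      (mem_univ t)
    simpa using this
  by_contra hne
  by_cases hφ : |p.1.2 - q.1.2| < 2 * Real.pi
  · have h0 : edist (polar p.1) (polar q.1) ≤ P.sectorEDist p q := by
      refine le_iInf fun γ => ?_
      have := hlen p q γ 1
      simpa using this
    rw [h, nonpos_iff_eq_zero, edist_eq_zero] at h0
    exact hne (Subtype.ext (polar_inj (pos p) (pos q) h0 hφ))
  · -- a curve between `p` and `q` passes through an angle at distance `π / 2` from that of `p`
    have hpi := Real.pi_pos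
    have key : P.innerRadius ≤ (P.sectorEDist p q).toReal ∨ P.sectorEDist p q = ⊤ := by
      by_cases ht : P.sectorEDist p q = ⊤
      · exact Or.inr ht
      refine Or.inl ((ENNReal.ofReal_le_iff_le_toReal ht).1 (le_iInf fun γ => ?_))
      have hcont : Continuous fun t : unitInterval => |(γ t).1.2 - p.1.2| := by fun_prop
      have hiv := intermediate_value_univ (0 : unitInterval) 1 hcont
      have hin : Real.pi / 2 ∈ Icc |(γ 0).1.2 - p.1.2| |(γ 1).1.2 - p.1.2| := by
        simp only [γ.source, γ.target, sub_self, abs_zero]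
        rw [abs_sub_comm]
        exact ⟨by positivity, by linarith [not_lt.1 hφ]⟩
      obtain ⟨t, ht'⟩ := hiv hin
      refine le_trans ?_ (hlen p q γ t)
      rw [edist_dist]
      refine ENNReal.ofReal_le_ofReal ?_
      set x := (γ t) with hxdef
      have hcos : Real.cos (x.1.2 - p.1.2) = 0 := by
        have h2 : |x.1.2 - p.1.2| = Real.pi / 2 := ht'
        rw [← Real.cos_abs, h2, Real.cos_pi_div_two]
      have hxp := x.2.1.1
      have hpp := p.2.1.1
      rw [EuclideanSpace.dist_eq, Fin.sum_univ_two, Real.dist_eq, Real.dist_eq, sq_abs, sq_abs]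
      refine Real.le_sqrt_of_sq_le ?_
      change P.innerRadius ^ 2 ≤ (p.1.1 * Real.cos p.1.2 - x.1.1 * Real.cos x.1.2) ^ 2 +
        (p.1.1 * Real.sin p.1.2 - x.1.1 * Real.sin x.1.2) ^ 2
      have e : (p.1.1 * Real.cos p.1.2 - x.1.1 * Real.cos x.1.2) ^ 2 +
          (p.1.1 * Real.sin p.1.2 - x.1.1 * Real.sin x.1.2) ^ 2 =
          p.1.1 ^ 2 + x.1.1 ^ 2 := by
        rw [Real.cos_sub] at hcos
        linear_combination p.1.1 ^ 2 * Real.sin_sq_add_cos_sq p.1.2 +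
          x.1.1 ^ 2 * Real.sin_sq_add_cos_sq x.1.2 - 2 * p.1.1 * x.1.1 * hcos
      rw [e]
      nlinarith [pos x, pos p]
    rcases key with key | key
    · rw [h] at key
      simp only [ENNReal.toReal_zero] at key
      linarith
    · rw [h] at key
      exact ENNReal.zero_ne_top key

instance : PseudoEMetricSpace P.Sector where
  edist := P.sectorEDist
  edist_self := P.sectorEDist_isPseudoEDist.self
  edist_comm := P.sectorEDist_isPseudoEDist.symm
  edist_triangle := P.sectorEDist_isPseudoEDist.tri

instance : PseudoMetricSpace P.Sector :=
  PseudoEMetricSpace.toPseudoMetricSpace fun p q =>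
    ne_top_of_le_ne_top (ENNReal.mul_ne_top ENNReal.ofReal_ne_top
      (edist_ne_top (α := P.sectorSet) p q)) (P.sectorEDist_le p q)

instance : MetricSpace P.Sector where
  eq_of_dist_eq_zero {p q} h := by
    refine P.eq_of_sectorEDist_eq_zero (p := p) (q := q) ?_
    have : edist p q = 0 := by rw [edist_dist, h, ENNReal.ofReal_zero]
    exact this

instance : CompactSpace P.Sector := by
  have hc : CompactSpace P.sectorSet :=
    isCompact_iff_compactSpace.1 (isCompact_Icc.prod isCompact_Icc)
  let f : P.sectorSet → P.Sector := fun p => p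
  have hcont : Continuous f :=
    LipschitzWith.continuous (K := Real.toNNReal (2 * (1 + (P.innerRadius + P.b))))
      fun p q => P.sectorEDist_le p q
  have := isCompact_range hcont
  rw [Function.Surjective.range_eq (f := f) (fun x => ⟨x, rfl⟩)] at this
  exact ⟨this⟩

instance : Nonempty P.Sector :=
  ⟨⟨(P.innerRadius, 0), ⟨le_refl _, by linarith [P.b_pos]⟩,
    ⟨le_refl _, (div_pos P.ε_pos P.b_pos).le⟩⟩⟩

/-! ### The two grids and the natural map between them -/

/-- The radii of the partition of the sector into `n²` sub-sectors, with `R₀` for `i = 0` and `R₁`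
for `i = n`. -/
def gridRadius (n i : ℕ) : ℝ := P.innerRadius + i * (P.b / n)

/-- The angles of the partition of the sector into `n²` sub-sectors. -/
def gridAngle (n j : ℕ) : ℝ := j * (P.ε / P.b / n)

/-- The point `y` on the boundary of the `(i, j)`-th sub-sector and the point `p` on the boundary of
the `(i, j)`-th block lie at the same position, measured by arclength along corresponding
sides. -/
def SideCorr (n : ℕ) (i j : Fin n) (y : P.Sector) (p : (P.cell n i).PreBlock) : Prop :=
  (y.1.1 = P.gridRadius n i ∧
    (P.cell n i).IsLeft p (P.gridRadius n i * (y.1.2 - P.gridAngle n j))) ∨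
  (y.1.1 = P.gridRadius n (i + 1) ∧
    (P.cell n i).IsRight p (P.gridRadius n (i + 1) * (y.1.2 - P.gridAngle n j))) ∨
  (y.1.2 = P.gridAngle n j ∧ (P.cell n i).IsBottom p (y.1.1 - P.gridRadius n i)) ∨
  (y.1.2 = P.gridAngle n (j + 1) ∧ (P.cell n i).IsTop p (y.1.1 - P.gridRadius n i))

/-- `Yₙ`: the union of the boundaries of the sub-sectors. -/
def sectorGrid (n : ℕ) : Set P.Sector :=
  {y | (∃ i ≤ n, y.1.1 = P.gridRadius n i) ∨ (∃ j ≤ n, y.1.2 = P.gridAngle n j)}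

/-- The vertices of `Yₙ`. -/
def sectorVertices (n : ℕ) : Set P.Sector :=
  {y | (∃ i ≤ n, y.1.1 = P.gridRadius n i) ∧ (∃ j ≤ n, y.1.2 = P.gridAngle n j)}

/-- `p` lies on one of the sides `AB`, `CD` of the block. -/
def OnVerticalSide (p : P.PreBlock) : Prop := (∃ s, P.IsLeft p s) ∨ ∃ s, P.IsRight p s

/-- `p` lies on one of the sides `BC`, `AD` of the block. -/
def OnHorizontalSide (p : P.PreBlock) : Prop := (∃ t, P.IsBottom p t) ∨ ∃ t, P.IsTop p t

/-- `Xₙ`: the union of the boundaries of the blocks. -/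
def gluedGrid (n : ℕ) : Set (P.Glued n) :=
  {x | ∃ i j p, x = P.toGlued n i j p ∧
    ((P.cell n i).OnVerticalSide p ∨ (P.cell n i).OnHorizontalSide p)}

/-- The vertices of `Xₙ`: the corners of the blocks. -/
def gluedVertices (n : ℕ) : Set (P.Glued n) :=
  {x | ∃ i j p, x = P.toGlued n i j p ∧
    (P.cell n i).OnVerticalSide p ∧ (P.cell n i).OnHorizontalSide p}

end DislocationParams

end

noncomputable section

/-! ### Lower bounds for path and gluing distances -/

/-! Each block is mapped onto the rectangle `[0, b] × [0, a]` of its own parameters, affinely on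
every vertical fibre (`flat`). Reading the rectangle as polar coordinates maps block `(i, j)` onto
sub-sector `(i, j)` (`cellProj`). Because `R₀ = ab / ε`, the sides of the sub-sector have exactly
the lengths of the sides of the block, so these maps preserve arclength on sides and are compatible
with the gluing. Together they define `proj`. Two points with equal image under `proj` are at gluing
distance `0`, so `Tₙ` is the inverse of `proj` on the grids.

The metric core is local: on the boundary of a single block, block distance and rectangle distance
agree up to factors `1 + O(1/n)` (`exists_blockDist_bounds`). The defect of a block is `ε/n²`, and
everywhere the two distances differ by at most a multiple of it. For points at distance at least
`c/n` this is already a relative error `O(1/n)`. Boundary points closer than that lie on one side or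
near one corner. There explicit segments bound the block distance from above, and suitable
`1`-Lipschitz functions on the block bound it from below. The rectangle is the sub-sector with its
metric frozen at the inner radius, which costs another factor `1 + O(1/n)`.

Only boundary estimates are available, so the passage from local to global has to stay on the grid.
A gluing chain changes block only at grid points; its steps inside one block are merged by the
triangle inequality (`edist_proj_le_mul_gluedEDist`). A curve in the sector between grid points is
cut at the last time at which it leaves each sub-sector; the pieces are bounded below by their
chords and replaced by steps inside single blocks (`gluedEDist_le_mul_eVariationOn`).

Hence distances on the grids agree up to factors `1 + O(1/n)`, and by boundedness up to `O(1/n)`.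
The vertices are `O(1/n)`-nets in both spaces, which gives the Gromov–Hausdorff estimate. -/

theorem edist_le_pathEDist {X : Type*} [TopologicalSpace X] (Φ : X → EuclideanSpace ℝ (Fin 2))
    (x y : X) : edist (Φ x) (Φ y) ≤ pathEDist Φ x y := by
  refine le_iInf fun γ => ?_
  have := eVariationOn.edist_le (fun t => Φ (γ t)) (mem_univ (0 : unitInterval))
    (mem_univ (1 : unitInterval))
  simpa using this

/-- A map which is `K`-Lipschitz before gluing and compatible with the gluing is `K`-Lipschitz
for the gluing distance. -/
theorem edist_le_mul_glueEDist {X E : Type*} [PseudoEMetricSpace E] {d : X → X → ℝ≥0∞}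
    {R : X → X → Prop} (ψ : X → E) {K : NNReal} (hK : K ≠ 0)
    (hd : ∀ x y, edist (ψ x) (ψ y) ≤ K * d x y) (hR : ∀ x y, R x y → ψ x = ψ y) (x y : X) :
    edist (ψ x) (ψ y) ≤ K * glueEDist d R x y := by
  have hE : ∀ x y, Relation.EqvGen R x y → ψ x = ψ y := by
    intro x y h
    induction h with
    | rel x y h => exact hR x y h
    | refl x => rfl
    | symm x y _ ih => exact ih.symm
    | trans x y z _ _ ih ih' => exact ih.trans ih'
  have key : ∀ c, ChainLength d R x y c → edist (ψ x) (ψ y) ≤ K * c := by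
    intro c h
    induction h with
    | single x y => exact hd x y
    | cons x y z w c hR _ ih =>
      rw [mul_add]
      refine (edist_triangle _ (ψ y) _).trans (add_le_add (hd x y) ?_)
      rwa [hE y z hR]
  have hK' : (K : ℝ≥0∞) ≠ 0 := by simpa using hK
  -- Dividing by `K` puts the infimum over chains alone on the right, so it suffices to bound every
  -- chain.
  have : edist (ψ x) (ψ y) / K ≤ glueEDist d R x y :=
    le_sInf fun c hc => ENNReal.div_le_of_le_mul' (key c hc)
  rwa [ENNReal.div_le_iff_le_mul (Or.inl hK') (Or.inl ENNReal.coe_ne_top), mul_comm] at this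

theorem dist_le_mul_of_coord_le {v w v' w' : EuclideanSpace ℝ (Fin 2)} {K : ℝ} (hK : 0 ≤ K)
    (h0 : |v 0 - w 0| ≤ K * |v' 0 - w' 0|) (h1 : |v 1 - w 1| ≤ K * |v' 1 - w' 1|) :
    dist v w ≤ K * dist v' w' := by
  rw [EuclideanSpace.dist_eq, EuclideanSpace.dist_eq]
  simp only [Fin.sum_univ_two, Real.dist_eq]
  refine Real.sqrt_le_iff.2 ⟨by positivity, ?_⟩
  rw [mul_pow, Real.sq_sqrt (by positivity)]
  have := pow_le_pow_left₀ (abs_nonneg _) h0 2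
  have := pow_le_pow_left₀ (abs_nonneg _) h1 2
  rw [mul_pow] at *
  linarith

theorem dist_le_of_coord_le {v w v' w' : EuclideanSpace ℝ (Fin 2)}
    (h0 : |v 0 - w 0| ≤ |v' 0 - w' 0|) (h1 : |v 1 - w 1| ≤ |v' 1 - w' 1|) :
    dist v w ≤ dist v' w' := by
  simpa using dist_le_mul_of_coord_le zero_le_one (by simpa using h0) (by simpa using h1)

namespace DislocationParams

variable (P : DislocationParams)

/-! ### The shape of the broken line. -/

theorem tan_pos : 0 < Real.tan P.θ := Real.tan_pos_of_pos_of_lt_pi_div_two P.θ_pos P.θ_lt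

theorem sin_pos : 0 < Real.sin P.θ :=
  Real.sin_pos_of_pos_of_lt_pi P.θ_pos (by linarith [P.θ_lt, Real.pi_pos])

theorem cos_pos : 0 < Real.cos P.θ :=
  Real.cos_pos_of_mem_Ioo ⟨by linarith [P.θ_pos, Real.pi_pos], P.θ_lt⟩

theorem lineLength_pos : 0 < P.lineLength :=
  div_pos P.ε_pos (mul_pos two_pos P.sin_pos)

/-- This is the total rise of the broken line, from `ε = 2 d sin θ`; each hexagon contributes half
of the difference between the right and the left side. -/
theorem tan_mul_lineLength_cos : Real.tan P.θ * (P.lineLength * Real.cos P.θ) = P.ε / 2 := by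
  have h1 := P.sin_pos.ne'
  have h2 := P.cos_pos.ne'
  rw [lineLength, Real.tan_eq_sin_div_cos]
  field_simp

theorem height_ge (x : ℝ) : P.a / 2 ≤ P.height x := by
  unfold height
  have := mul_nonneg P.tan_pos.le (le_max_left 0
    (min (x - (P.b - P.lineLength * Real.cos P.θ) / 2) (P.lineLength * Real.cos P.θ)))
  linarith

theorem height_le (x : ℝ) : P.height x ≤ (P.a + P.ε) / 2 := by
  unfold height
  have h0 := mul_pos P.lineLength_pos P.cos_pos
  have := mul_le_mul_of_nonneg_left (max_le h0.le (min_le_right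
    (x - (P.b - P.lineLength * Real.cos P.θ) / 2) (P.lineLength * Real.cos P.θ))) P.tan_pos.le
  rw [P.tan_mul_lineLength_cos] at this
  linarith

theorem height_of_le {x : ℝ} (hx : x ≤ (P.b - P.lineLength * Real.cos P.θ) / 2) :
    P.height x = P.a / 2 := by
  unfold height
  rw [max_eq_left ((min_le_left _ _).trans (by linarith))]
  ring

theorem height_of_ge {x : ℝ} (hx : (P.b + P.lineLength * Real.cos P.θ) / 2 ≤ x) :
    P.height x = (P.a + P.ε) / 2 := by
  unfold height
  have h0 := mul_pos P.lineLength_pos P.cos_pos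
  rw [min_eq_right (by linarith), max_eq_right h0.le, P.tan_mul_lineLength_cos]
  ring

variable {P}

theorem BlockExists.height_zero (h : P.BlockExists) : P.height 0 = P.a / 2 :=
  P.height_of_le (by unfold BlockExists at h; linarith)

theorem BlockExists.height_b (h : P.BlockExists) : P.height P.b = (P.a + P.ε) / 2 :=
  P.height_of_ge (by unfold BlockExists at h; linarith)

variable (P)

/-! ### Bounds for the block distance by Euclidean distances -/

/-- A pair of `K`-Lipschitz maps on the two hexagons that agree on the broken line is
`K`-Lipschitz on the block. -/
theorem edist_le_mul_blockEDist {E : Type*} [PseudoEMetricSpace E] (f : Bool → P.hexagon → E)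
    {K : NNReal} (hK : K ≠ 0) (hf : ∀ s, LipschitzWith K (f s))
    (hg : ∀ v : P.hexagon, v.1 1 = P.height (v.1 0) → f false v = f true v) (p q : P.PreBlock) :
    edist (f p.1 p.2) (f q.1 q.2) ≤ K * P.blockEDist p q := by
  refine edist_le_mul_glueEDist (fun p : P.PreBlock => f p.1 p.2) hK ?_ ?_ p q
  · rintro ⟨s, v⟩ ⟨t, w⟩
    by_cases hst : s = t
    · subst hst
      rw [sigmaEDist_same (fun _ : Bool => pathEDist (Subtype.val : P.hexagon → _))]
      refine (hf s v w).trans (mul_le_mul_right (edist_le_pathEDist Subtype.val v w) _)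
    -- Different hexagons are at distance `∞` before gluing, and `K ≠ 0` keeps the right-hand side
    -- infinite.
    · have hK' : (K : ℝ≥0∞) ≠ 0 := by simpa using hK
      simp [sigmaEDist, hst, ENNReal.mul_top hK']
  · rintro ⟨s, v⟩ ⟨t, w⟩ ⟨h1, h2, h3, h4⟩
    simp only at h1 h2 h3 h4
    subst h1 h2 h3
    exact hg v h4

/-- Points of a hexagon are at most as far apart as in the plane if the segment between them stays
in the hexagon. -/
theorem blockEDist_le_of_segment (s : Bool) (v w : P.hexagon)
    (h : ∀ t ∈ Icc (0 : ℝ) 1, v.1 + t • (w.1 - v.1) ∈ P.hexagon) :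
    P.blockEDist ⟨s, v⟩ ⟨s, w⟩ ≤ edist v.1 w.1 := by
  refine (glueEDist_le _ _ _ _).trans ?_
  rw [sigmaEDist_same (fun _ : Bool => pathEDist (Subtype.val : P.hexagon → _))]
  let γ : Path v w :=
    { toFun := fun t => ⟨v.1 + (t : ℝ) • (w.1 - v.1), h t t.2⟩
      continuous_toFun := by fun_prop
      source' := by simp
      target' := by simp }
  refine (pathEDist_le_of_lipschitz Subtype.val γ (nndist v.1 w.1) ?_).trans_eq
    (edist_nndist _ _).symm
  intro s t
  change dist (v.1 + (s : ℝ) • (w.1 - v.1)) (v.1 + (t : ℝ) • (w.1 - v.1)) ≤ _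
  rw [dist_add_left, dist_eq_norm, ← sub_smul, norm_smul, coe_nndist, dist_comm, dist_eq_norm,
    Real.norm_eq_abs, mul_comm]

/-- Below the height `a / 2` the hexagon is a rectangle. -/
theorem blockEDist_le_of_low (s : Bool) (v w : P.hexagon) (hv : v.1 1 ≤ P.a / 2)
    (hw : w.1 1 ≤ P.a / 2) : P.blockEDist ⟨s, v⟩ ⟨s, w⟩ ≤ edist v.1 w.1 := by
  refine P.blockEDist_le_of_segment s v w fun t ht => ?_
  obtain ⟨t0, t1⟩ := ht
  obtain ⟨⟨a1, a2⟩, a3, -⟩ := v.2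
  obtain ⟨⟨b1, b2⟩, b3, -⟩ := w.2
  refine ⟨⟨?_, ?_⟩, ?_, le_trans ?_ (P.height_ge _)⟩
  · change 0 ≤ v.1 0 + t * (w.1 0 - v.1 0)
    nlinarith
  · change v.1 0 + t * (w.1 0 - v.1 0) ≤ P.b
    nlinarith
  · change 0 ≤ v.1 1 + t * (w.1 1 - v.1 1)
    nlinarith
  · change v.1 1 + t * (w.1 1 - v.1 1) ≤ P.a / 2
    nlinarith

theorem edist_eq_of_fst_eq {v w : EuclideanSpace ℝ (Fin 2)} (h : v 0 = w 0) :
    edist v w = ENNReal.ofReal |v 1 - w 1| := by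
  rw [edist_dist, EuclideanSpace.dist_eq, Fin.sum_univ_two, Real.dist_eq, Real.dist_eq, h]
  simp [Real.sqrt_sq_eq_abs]

/-- A hexagon is the region under a graph, so its vertical segments stay inside even above height `a
/ 2`, where it need not be convex. -/
theorem blockEDist_le_of_vertical (s : Bool) (v w : P.hexagon) (h : v.1 0 = w.1 0) :
    P.blockEDist ⟨s, v⟩ ⟨s, w⟩ ≤ ENNReal.ofReal |v.1 1 - w.1 1| := by
  rw [← edist_eq_of_fst_eq h]
  refine P.blockEDist_le_of_segment s v w fun t ht => ?_
  obtain ⟨t0, t1⟩ := ht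
  obtain ⟨⟨a1, a2⟩, a3, a4⟩ := v.2
  obtain ⟨⟨b1, b2⟩, b3, b4⟩ := w.2
  have e : (v.1 + t • (w.1 - v.1)) 0 = v.1 0 := by
    change v.1 0 + t * (w.1 0 - v.1 0) = v.1 0
    rw [h]
    ring
  refine ⟨?_, ?_⟩
  · rw [e]
    exact ⟨a1, a2⟩
  rw [e]
  rw [← h] at b4
  refine ⟨?_, ?_⟩
  · change 0 ≤ v.1 1 + t * (w.1 1 - v.1 1)
    nlinarith
  · change v.1 1 + t * (w.1 1 - v.1 1) ≤ _
    nlinarith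

theorem blockEDist_eq_zero_of_glue {v : P.hexagon} (h : v.1 1 = P.height (v.1 0)) :
    P.blockEDist ⟨false, v⟩ ⟨true, v⟩ = 0 :=
  glueEDist_eq_zero_of_rel (sigmaEDist_isPseudoEDist fun _ => pathEDist_isPseudoEDist _)
    ⟨rfl, rfl, rfl, h⟩

theorem blockEDist_tri (p q r : P.PreBlock) :
    P.blockEDist p r ≤ P.blockEDist p q + P.blockEDist q r :=
  P.blockEDist_isPseudoEDist.tri p q r

theorem blockEDist_comm (p q : P.PreBlock) : P.blockEDist p q = P.blockEDist q p :=
  P.blockEDist_isPseudoEDist.symm p q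

/-- The point `(x, y)` of the hexagon. -/
def hexPoint {x y : ℝ} (hx : x ∈ Icc 0 P.b) (hy : y ∈ Icc 0 (P.height x)) : P.hexagon :=
  ⟨!₂[x, y], hx, hy⟩

/-- Points of different hexagons on the same vertical line. -/
theorem blockEDist_le_of_vertical_across (v w : P.hexagon) (h : v.1 0 = w.1 0) :
    P.blockEDist ⟨false, v⟩ ⟨true, w⟩ ≤
      ENNReal.ofReal (2 * P.height (v.1 0) - v.1 1 - w.1 1) := by
  let m : P.hexagon := P.hexPoint v.2.1 ⟨(P.height_pos _).le, le_rfl⟩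
  have m1 : m.1 1 = P.height (v.1 0) := rfl
  have a4 := v.2.2.2
  have b4 := w.2.2.2
  rw [← h] at b4
  have h1 := P.blockEDist_le_of_vertical false v m rfl
  have h2 := P.blockEDist_le_of_vertical true m w h
  have h3 : P.blockEDist ⟨false, m⟩ ⟨true, m⟩ = 0 := P.blockEDist_eq_zero_of_glue rfl
  refine (P.blockEDist_tri _ ⟨false, m⟩ _).trans ((add_le_add h1
    ((P.blockEDist_tri _ ⟨true, m⟩ _).trans (add_le_add h3.le h2))).trans_eq ?_)
  rw [m1, abs_of_nonpos (by linarith), abs_of_nonneg (by linarith), zero_add,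
    ← ENNReal.ofReal_add (by linarith) (by linarith)]
  congr 1
  ring

end DislocationParams

end

noncomputable section

theorem abs_le_mul_abs_of_eq_mul {x y t : ℝ} (ht : 0 ≤ t) (h : x = t * y) : |x| ≤ t * |y| := by
  rw [h, abs_mul, abs_of_nonneg ht]

theorem abs_le_mul_abs_of_eq_mul_neg {x y t : ℝ} (ht : 0 ≤ t) (h : x = -(t * y)) :
    |x| ≤ t * |y| := by
  rw [h, abs_neg, abs_mul, abs_of_nonneg ht]

namespace DislocationParams

variable (P : DislocationParams)

/-! ### Rectangular coordinates on a block -/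

/-- The block distance as a real number. -/
def blockDist (p q : P.PreBlock) : ℝ := (P.blockEDist p q).toReal

theorem ofReal_blockDist (p q : P.PreBlock) :
    ENNReal.ofReal (P.blockDist p q) = P.blockEDist p q :=
  ENNReal.ofReal_toReal (P.blockEDist_ne_top p q)

theorem blockDist_nonneg (p q : P.PreBlock) : 0 ≤ P.blockDist p q := ENNReal.toReal_nonneg

theorem blockDist_tri (p q r : P.PreBlock) :
    P.blockDist p r ≤ P.blockDist p q + P.blockDist q r := by
  unfold blockDist
  rw [← ENNReal.toReal_add (P.blockEDist_ne_top _ _) (P.blockEDist_ne_top _ _)]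
  exact ENNReal.toReal_mono (ENNReal.add_ne_top.2 ⟨P.blockEDist_ne_top _ _,
    P.blockEDist_ne_top _ _⟩) (P.blockEDist_tri p q r)

theorem blockDist_comm (p q : P.PreBlock) : P.blockDist p q = P.blockDist q p := by
  unfold blockDist
  rw [P.blockEDist_comm]

theorem blockDist_le_of_low (s : Bool) (v w : P.hexagon) (hv : v.1 1 ≤ P.a / 2)
    (hw : w.1 1 ≤ P.a / 2) : P.blockDist ⟨s, v⟩ ⟨s, w⟩ ≤ dist v.1 w.1 := by
  refine ENNReal.toReal_le_of_le_ofReal dist_nonneg ?_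
  rw [← edist_dist]
  exact P.blockEDist_le_of_low s v w hv hw

theorem blockDist_le_of_vertical (s : Bool) (v w : P.hexagon) (h : v.1 0 = w.1 0) :
    P.blockDist ⟨s, v⟩ ⟨s, w⟩ ≤ |v.1 1 - w.1 1| :=
  ENNReal.toReal_le_of_le_ofReal (abs_nonneg _) (P.blockEDist_le_of_vertical s v w h)

theorem blockDist_le_of_vertical_across (v w : P.hexagon) (h : v.1 0 = w.1 0) :
    P.blockDist ⟨false, v⟩ ⟨true, w⟩ ≤ 2 * P.height (v.1 0) - v.1 1 - w.1 1 := by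
  refine ENNReal.toReal_le_of_le_ofReal ?_ (P.blockEDist_le_of_vertical_across v w h)
  have h1 := v.2.2.2
  have h2 := w.2.2.2
  rw [← h] at h2
  linarith

/-- The relative height of a point of the block in its vertical fibre, scaled to `[0, a]`. -/
def vert (p : P.PreBlock) : ℝ :=
  if p.1 then P.a - P.a * p.2.1 1 / (2 * P.height (p.2.1 0))
  else P.a * p.2.1 1 / (2 * P.height (p.2.1 0))

/-- The fibrewise affine map of the block onto the rectangle `[0, b] × [0, a]`. -/
def flat (p : P.PreBlock) : EuclideanSpace ℝ (Fin 2) := !₂[p.2.1 0, P.vert p]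

/-- The projection of the block to the rectangle `[0, b] × [0, a]` which collapses the region above
height `a / 2` of each hexagon. -/
def clip (p : P.PreBlock) : EuclideanSpace ℝ (Fin 2) :=
  !₂[p.2.1 0, if p.1 then P.a - min (p.2.1 1) (P.a / 2) else min (p.2.1 1) (P.a / 2)]

theorem relHeight_mem (v : P.hexagon) :
    P.a * v.1 1 / (2 * P.height (v.1 0)) ∈ Icc 0 (P.a / 2) := by
  have hh := P.height_pos (v.1 0)
  obtain ⟨-, h0, h1⟩ := v.2
  have ha := P.a_pos
  refine ⟨by positivity, ?_⟩
  rw [div_le_div_iff₀ (by positivity) two_pos]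
  nlinarith

theorem vert_mem (p : P.PreBlock) : P.vert p ∈ Icc 0 P.a := by
  obtain ⟨h0, h1⟩ := P.relHeight_mem p.2
  have ha := P.a_pos
  unfold vert
  split_ifs <;> constructor <;> linarith

theorem vert_false_le (v : P.hexagon) : P.vert ⟨false, v⟩ ≤ P.a / 2 := (P.relHeight_mem v).2

theorem le_vert_true (v : P.hexagon) : P.a / 2 ≤ P.vert ⟨true, v⟩ := by
  have := (P.relHeight_mem v).2
  change _ ≤ P.a - P.a * v.1 1 / (2 * P.height (v.1 0))
  linarith

/-- Changing the fibre costs only the change of `height`, which has slope at most `tan θ`. The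
constants depend on `θ` alone and so are the same for all blocks. -/
theorem relHeight_lipschitz (v w : P.hexagon) :
    |P.a * v.1 1 / (2 * P.height (v.1 0)) - P.a * w.1 1 / (2 * P.height (w.1 0))| ≤
      |v.1 1 - w.1 1| + Real.tan P.θ * |v.1 0 - w.1 0| := by
  have hv := P.height_pos (v.1 0)
  have hw := P.height_pos (w.1 0)
  have gv := P.height_ge (v.1 0)
  obtain ⟨-, w0, w1⟩ := w.2
  have ha := P.a_pos
  -- Splits the difference into a vertical part and a change of fibre length; both prefactors are at
  -- most `1` since `a / 2 ≤ height` and `w` lies below the broken line.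
  have e : P.a * v.1 1 / (2 * P.height (v.1 0)) - P.a * w.1 1 / (2 * P.height (w.1 0)) =
      P.a / (2 * P.height (v.1 0)) * ((v.1 1 - w.1 1) +
        w.1 1 / P.height (w.1 0) * (P.height (w.1 0) - P.height (v.1 0))) := by
    field_simp
    ring
  have f1 : P.a / (2 * P.height (v.1 0)) ≤ 1 := by
    rw [div_le_one (by positivity)]
    linarith
  have f2 : w.1 1 / P.height (w.1 0) ≤ 1 := by
    rw [div_le_one hw]
    exact w1
  rw [e, abs_mul, abs_of_nonneg (by positivity : 0 ≤ P.a / (2 * P.height (v.1 0)))]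
  refine (mul_le_of_le_one_left (abs_nonneg _) f1).trans ((abs_add_le _ _).trans ?_)
  refine add_le_add_right ?_ _
  rw [abs_mul, abs_of_nonneg (by positivity : 0 ≤ w.1 1 / P.height (w.1 0))]
  refine (mul_le_of_le_one_left (abs_nonneg _) f2).trans ?_
  rw [abs_sub_comm]
  exact P.height_lipschitz _ _

/-- The real form of `edist_le_mul_blockEDist`. -/
theorem dist_le_mul_blockDist {E : Type*} [PseudoMetricSpace E] (f : Bool → P.hexagon → E)
    {K : ℝ} (hK : 0 < K) (hf : ∀ s v w, dist (f s v) (f s w) ≤ K * dist v.1 w.1)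
    (hg : ∀ v : P.hexagon, v.1 1 = P.height (v.1 0) → f false v = f true v) (p q : P.PreBlock) :
    dist (f p.1 p.2) (f q.1 q.2) ≤ K * P.blockDist p q := by
  have h := P.edist_le_mul_blockEDist f (K := K.toNNReal) (Real.toNNReal_pos.2 hK).ne'
    (fun s => LipschitzWith.of_dist_le_mul fun v w => by
      rw [Real.coe_toNNReal K hK.le]
      exact hf s v w) hg p q
  rw [edist_dist, ← P.ofReal_blockDist] at h
  change _ ≤ ENNReal.ofReal K * _ at h
  rw [← ENNReal.ofReal_mul hK.le] at h
  exact (ENNReal.ofReal_le_ofReal_iff (mul_nonneg hK.le (P.blockDist_nonneg _ _))).1 h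

/-- A crude bound with a constant uniform in `n`. It shows that points far apart in the rectangle
are far apart in the block, and it covers the finitely many small `n`. -/
theorem dist_flat_le_mul_blockDist (p q : P.PreBlock) :
    dist (P.flat p) (P.flat q) ≤ (2 + Real.tan P.θ) * P.blockDist p q := by
  have hT := P.tan_pos
  refine P.dist_le_mul_blockDist (fun s v => P.flat ⟨s, v⟩) (by positivity) ?_ ?_ p q
  · intro s v w
    refine (euclid_dist_le _ _).trans ?_
    have h := P.relHeight_lipschitz v w
    have c0 := euclid_coord_le v.1 w.1 0
    have c1 := euclid_coord_le v.1 w.1 1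
    have c2 := mul_le_mul_of_nonneg_left c0 hT.le
    have e : |P.flat ⟨s, v⟩ 1 - P.flat ⟨s, w⟩ 1| = |P.a * v.1 1 / (2 * P.height (v.1 0)) -
        P.a * w.1 1 / (2 * P.height (w.1 0))| := by
      cases s
      · rfl
      · rw [abs_sub_comm]
        change |(P.a - _) - (P.a - _)| = _
        congr 1
        ring
    rw [e]
    change |v.1 0 - w.1 0| + _ ≤ _
    linarith
  · intro v hv
    have hh := P.height_pos (v.1 0)
    have e : P.vert ⟨false, v⟩ = P.vert ⟨true, v⟩ := by
      change P.a * v.1 1 / (2 * P.height (v.1 0)) =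
        P.a - P.a * v.1 1 / (2 * P.height (v.1 0))
      rw [hv]
      field_simp
      ring
    unfold flat
    rw [e]

/-- Truncation at height `a / 2` is `1`-Lipschitz, and the broken line never lies below `a / 2`, so
both hexagons send it to the same height. Unlike for `flat`, the constant is exactly `1`. -/
theorem dist_clip_le_blockDist (p q : P.PreBlock) :
    dist (P.clip p) (P.clip q) ≤ P.blockDist p q := by
  rw [← one_mul (P.blockDist p q)]
  refine P.dist_le_mul_blockDist (fun s v => P.clip ⟨s, v⟩) one_pos ?_ ?_ p q
  · intro s v w
    rw [one_mul]
    refine dist_le_of_coord_le le_rfl ?_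
    have h : |min (v.1 1) (P.a / 2) - min (w.1 1) (P.a / 2)| ≤ |v.1 1 - w.1 1| := by
      refine (abs_min_sub_min_le_max _ _ _ _).trans ?_
      simp
    cases s
    · exact h
    · change |(P.a - min (v.1 1) (P.a / 2)) - (P.a - min (w.1 1) (P.a / 2))| ≤ _
      rw [sub_sub_sub_cancel_left, abs_sub_comm]
      exact h
  · intro v hv
    have hh := P.height_ge (v.1 0)
    have e : min (v.1 1) (P.a / 2) = P.a / 2 := min_eq_right (hv ▸ hh)
    simp only [clip, e, Bool.false_eq_true, if_false, if_true]
    rw [sub_half]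

/-- Both maps keep the abscissa, and each fibre of a hexagon exceeds `a / 2` by at most `ε / 2`. -/
theorem dist_flat_clip_le (p : P.PreBlock) : dist (P.flat p) (P.clip p) ≤ P.ε / 2 := by
  obtain ⟨s, v⟩ := p
  have hh := P.height_pos (v.1 0)
  have h1 := P.height_ge (v.1 0)
  have h2 := P.height_le (v.1 0)
  have hε := P.ε_pos
  have ha := P.a_pos
  obtain ⟨-, v0, v1⟩ := v.2
  have key : |P.a * v.1 1 / (2 * P.height (v.1 0)) - min (v.1 1) (P.a / 2)| ≤ P.ε / 2 := by
    set h := P.height (v.1 0)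
    have q0 : v.1 1 / h ≤ 1 := (div_le_one hh).2 v1
    have q1 : 0 ≤ v.1 1 / h := by positivity
    have e : P.a * v.1 1 / (2 * h) = v.1 1 / h * (P.a / 2) := by
      field_simp
    have e' : v.1 1 = v.1 1 / h * h := by field_simp
    rw [e]
    rcases le_total (v.1 1) (P.a / 2) with hc | hc
    · rw [min_eq_left hc, abs_le]
      constructor <;> nlinarith
    · rw [min_eq_right hc, abs_le]
      constructor <;> nlinarith
  refine (euclid_dist_le _ _).trans ?_
  change |v.1 0 - v.1 0| + |P.flat ⟨s, v⟩ 1 - P.clip ⟨s, v⟩ 1| ≤ _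
  rw [sub_self, abs_zero, zero_add]
  cases s
  · exact key
  · change |(P.a - _) - (P.a - _)| ≤ _
    rw [sub_sub_sub_cancel_left, abs_sub_comm]
    exact key

theorem dist_flat_le_blockDist_add (p q : P.PreBlock) :
    dist (P.flat p) (P.flat q) ≤ P.blockDist p q + P.ε := by
  have h1 := P.dist_flat_clip_le p
  have h2 := P.dist_flat_clip_le q
  rw [dist_comm] at h2
  have h3 := P.dist_clip_le_blockDist p q
  have h4 := dist_triangle4 (P.flat p) (P.clip p) (P.clip q) (P.flat q)
  linarith

/-- The point of the hexagon below `v` at height at most `a / 2`. -/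
def lowered (v : P.hexagon) : P.hexagon :=
  P.hexPoint v.2.1 (y := min (v.1 1) (P.a / 2))
    ⟨le_min v.2.2.1 (half_pos P.a_pos).le, (min_le_left _ _).trans v.2.2.2⟩

theorem blockDist_lowered_le (s : Bool) (v : P.hexagon) :
    P.blockDist ⟨s, v⟩ ⟨s, P.lowered v⟩ ≤ P.ε / 2 := by
  refine (P.blockDist_le_of_vertical s v (P.lowered v) rfl).trans ?_
  change |v.1 1 - min (v.1 1) (P.a / 2)| ≤ _
  have h2 := P.height_le (v.1 0)
  have hε := P.ε_pos
  obtain ⟨-, v0, v1⟩ := v.2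
  rcases le_total (v.1 1) (P.a / 2) with hc | hc
  · rw [min_eq_left hc, sub_self, abs_zero]
    positivity
  · rw [min_eq_right hc, abs_of_nonneg (by linarith)]
    linarith

/-- Unfold the two low rectangles to `[0, b] × [0, a]` and follow the straight segment. Where it
meets the middle line, the actual path climbs to the broken line and descends in the other hexagon,
a detour of at most `2 (height - a / 2) ≤ ε`. -/
theorem blockDist_le_across_of_low (v w : P.hexagon) (hv : v.1 1 ≤ P.a / 2)
    (hw : w.1 1 ≤ P.a / 2) : P.blockDist ⟨false, v⟩ ⟨true, w⟩ ≤
      dist (!₂[v.1 0, v.1 1] : EuclideanSpace ℝ (Fin 2)) !₂[w.1 0, P.a - w.1 1] + P.ε := by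
  obtain ⟨⟨vx0, vx1⟩, vy0, vy1⟩ := v.2
  obtain ⟨⟨wx0, wx1⟩, wy0, wy1⟩ := w.2
  have ha := P.a_pos
  -- The parameter at which the unfolded segment crosses height `a / 2`; if both end points already
  -- lie on that line, `t = 0` serves.
  obtain ⟨t, ⟨t0, t1⟩, ht⟩ : ∃ t ∈ Icc (0 : ℝ) 1,
      v.1 1 + t * (P.a - w.1 1 - v.1 1) = P.a / 2 := by
    rcases eq_or_lt_of_le (show 0 ≤ P.a - w.1 1 - v.1 1 by linarith) with h | h
    · exact ⟨0, ⟨le_rfl, zero_le_one⟩, by linarith⟩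
    · refine ⟨(P.a / 2 - v.1 1) / (P.a - w.1 1 - v.1 1),
        ⟨div_nonneg (by linarith) h.le, (div_le_one h).2 (by linarith)⟩, ?_⟩
      field_simp
      ring
  set D := dist (!₂[v.1 0, v.1 1] : EuclideanSpace ℝ (Fin 2)) !₂[w.1 0, P.a - w.1 1] with hD
  have hx : v.1 0 + t * (w.1 0 - v.1 0) ∈ Icc 0 P.b := ⟨by nlinarith, by nlinarith⟩
  have hm : P.a / 2 ∈ Icc 0 (P.height (v.1 0 + t * (w.1 0 - v.1 0))) :=
    ⟨by positivity, P.height_ge _⟩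
  set m := P.hexPoint hx hm with hmd
  have m0 : m.1 0 = v.1 0 + t * (w.1 0 - v.1 0) := rfl
  have m1 : m.1 1 = P.a / 2 := rfl
  have h1 := P.blockDist_le_of_low false v m hv m1.le
  have h2 := P.blockDist_le_of_vertical_across m m rfl
  have h3 := P.blockDist_le_of_low true m w m1.le hw
  have h4 := P.height_le (m.1 0)
  have e1 : dist v.1 m.1 ≤ t * D := by
    refine dist_le_mul_of_coord_le t0 (abs_le_mul_abs_of_eq_mul t0 ?_)
      (abs_le_mul_abs_of_eq_mul t0 ?_)
    · change v.1 0 - m.1 0 = t * (v.1 0 - w.1 0)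
      rw [m0]
      ring
    · change v.1 1 - m.1 1 = t * (v.1 1 - (P.a - w.1 1))
      rw [m1]
      linarith
  have e2 : dist m.1 w.1 ≤ (1 - t) * D := by
    have t1' : 0 ≤ 1 - t := by linarith
    rw [dist_comm]
    refine dist_le_mul_of_coord_le t1' (abs_le_mul_abs_of_eq_mul_neg t1' ?_)
      (abs_le_mul_abs_of_eq_mul t1' ?_)
    · change w.1 0 - m.1 0 = -((1 - t) * (v.1 0 - w.1 0))
      rw [m0]
      ring
    · change w.1 1 - m.1 1 = (1 - t) * (v.1 1 - (P.a - w.1 1))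
      rw [m1]
      linarith
  have h5 := P.blockDist_tri ⟨false, v⟩ ⟨false, m⟩ ⟨true, w⟩
  have h6 := P.blockDist_tri ⟨false, m⟩ ⟨true, m⟩ ⟨true, w⟩
  linarith

theorem blockDist_lowered_lowered_le (s t : Bool) (v w : P.hexagon) :
    P.blockDist ⟨s, P.lowered v⟩ ⟨t, P.lowered w⟩ ≤
      dist (P.clip ⟨s, v⟩) (P.clip ⟨t, w⟩) + P.ε := by
  have hε := P.ε_pos
  have lv : (P.lowered v).1 1 ≤ P.a / 2 := min_le_right _ _
  have lw : (P.lowered w).1 1 ≤ P.a / 2 := min_le_right _ _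
  cases s <;> cases t
  · refine (P.blockDist_le_of_low false _ _ lv lw).trans ?_
    refine le_trans (dist_le_of_coord_le le_rfl le_rfl) (le_add_of_nonneg_right hε.le)
  · exact P.blockDist_le_across_of_low _ _ lv lw
  · rw [P.blockDist_comm, dist_comm]
    exact P.blockDist_le_across_of_low _ _ lw lv
  · refine (P.blockDist_le_of_low true _ _ lv lw).trans ?_
    refine (dist_le_of_coord_le (v := (P.lowered v).1) (w := (P.lowered w).1)
      (v' := P.clip ⟨true, v⟩) (w' := P.clip ⟨true, w⟩) le_rfl ?_).trans (le_add_of_nonneg_right hε.le)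
    change |min (v.1 1) (P.a / 2) - min (w.1 1) (P.a / 2)| ≤
      |(P.a - min (v.1 1) (P.a / 2)) - (P.a - min (w.1 1) (P.a / 2))|
    rw [sub_sub_sub_cancel_left, abs_sub_comm]

/-- Three errors of size `ε` add up: lowering both points, crossing the middle line, and replacing
`clip` by `flat` at both points. -/
theorem blockDist_le_dist_flat_add (p q : P.PreBlock) :
    P.blockDist p q ≤ dist (P.flat p) (P.flat q) + 3 * P.ε := by
  have h1 := P.dist_flat_clip_le p
  have h2 := P.dist_flat_clip_le q
  obtain ⟨s, v⟩ := p
  obtain ⟨t, w⟩ := q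
  have h3 := P.blockDist_lowered_lowered_le s t v w
  have h4 := P.blockDist_lowered_le s v
  have h5 := P.blockDist_lowered_le t w
  rw [P.blockDist_comm] at h5
  rw [dist_comm] at h1
  have h6 := dist_triangle4 (P.clip ⟨s, v⟩) (P.flat ⟨s, v⟩) (P.flat ⟨t, w⟩) (P.clip ⟨t, w⟩)
  have h7 := P.blockDist_tri ⟨s, v⟩ ⟨s, P.lowered v⟩ ⟨t, w⟩
  have h8 := P.blockDist_tri ⟨s, P.lowered v⟩ ⟨t, P.lowered w⟩ ⟨t, w⟩
  linarith

end DislocationParams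

end

noncomputable section

namespace DislocationParams

variable (P : DislocationParams)

/-! ### Sharp comparison of boundary points of a block -/

/-- `p` lies on one of the four sides of the block. -/
def OnBoundary (p : P.PreBlock) : Prop := p.2.1 0 = 0 ∨ p.2.1 0 = P.b ∨ p.2.1 1 = 0

/-- `vert` on the lower hexagon. -/
def relHeight (v : P.hexagon) : ℝ := P.a * v.1 1 / (2 * P.height (v.1 0))

theorem vert_false (v : P.hexagon) : P.vert ⟨false, v⟩ = P.relHeight v := rfl

theorem vert_true (v : P.hexagon) : P.vert ⟨true, v⟩ = P.a - P.relHeight v := rfl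

theorem flat_fst (p : P.PreBlock) : P.flat p 0 = p.2.1 0 := rfl

theorem flat_snd (p : P.PreBlock) : P.flat p 1 = P.vert p := rfl

theorem abs_vert_sub_vert_same (s : Bool) (v w : P.hexagon) :
    |P.vert ⟨s, v⟩ - P.vert ⟨s, w⟩| = |P.relHeight v - P.relHeight w| := by
  cases s
  · rfl
  · rw [vert_true, vert_true, sub_sub_sub_cancel_left, abs_sub_comm]

variable {P}

/-- The fibre of a hexagon over the left side has length exactly `a / 2`, so `relHeight` is the true
height there; over the right side it has length `(a + ε) / 2`, and the two differ by the factor `(a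
+ ε) / a`. All sharp estimates below are case distinctions over these three possibilities. -/
theorem BlockExists.boundary_cases (hB : P.BlockExists) {s : Bool} {v : P.hexagon}
    (hv : P.OnBoundary ⟨s, v⟩) :
    (v.1 0 = 0 ∧ v.1 1 ≤ P.a / 2 ∧ P.relHeight v = v.1 1) ∨
    (v.1 0 = P.b ∧ v.1 1 ≤ (P.a + P.ε) / 2 ∧ P.a * v.1 1 = (P.a + P.ε) * P.relHeight v) ∨
    (v.1 1 = 0 ∧ P.relHeight v = 0) := by
  have ha := P.a_pos
  have hε := P.ε_pos
  obtain ⟨-, -, h⟩ := v.2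
  rcases hv with h0 | h0 | h0
  · left
    simp only at h0
    rw [h0, hB.height_zero] at h
    refine ⟨h0, h, ?_⟩
    rw [relHeight, h0, hB.height_zero]
    field_simp
  · right; left
    simp only at h0
    rw [h0, hB.height_b] at h
    refine ⟨h0, h, ?_⟩
    rw [relHeight, h0, hB.height_b]
    field_simp
  · right; right
    simp only at h0
    refine ⟨h0, ?_⟩
    rw [relHeight, h0]
    simp

/-- Since `c ≤ b`, nearby points are not on opposite vertical sides. Either they share a vertical
side and a vertical segment joins them, or both have height at most `a / 2` and the segment between
them lies in a rectangle. In either case heights are stretched by at most `(a + ε) / a`. -/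
theorem BlockExists.blockDist_le_same (hB : P.BlockExists) {s : Bool} {v w : P.hexagon}
    (hv : P.OnBoundary ⟨s, v⟩) (hw : P.OnBoundary ⟨s, w⟩) {c : ℝ} (hc : c ≤ P.b)
    (hc' : c * (2 * (P.a + P.ε)) ≤ P.a ^ 2)
    (h : dist (P.flat ⟨s, v⟩) (P.flat ⟨s, w⟩) < c) :
    P.blockDist ⟨s, v⟩ ⟨s, w⟩ ≤
      (P.a + P.ε) / P.a * dist (P.flat ⟨s, v⟩) (P.flat ⟨s, w⟩) := by
  have ha := P.a_pos
  have hε := P.ε_pos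
  have hb := P.b_pos
  have hx := (euclid_coord_le _ _ 0).trans_lt h
  have hy := (euclid_coord_le _ _ 1).trans_lt h
  rw [flat_fst, flat_fst] at hx
  rw [flat_snd, flat_snd, abs_vert_sub_vert_same] at hy
  simp only at hx
  have hκ : 1 ≤ (P.a + P.ε) / P.a := by
    rw [le_div_iff₀ ha]
    linarith
  have step1 : |v.1 1 - w.1 1| ≤ (P.a + P.ε) / P.a * |P.relHeight v - P.relHeight w| := by
    have hr : ∀ {y r : ℝ}, P.a * y = (P.a + P.ε) * r → y = (P.a + P.ε) / P.a * r := by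
      intro y r h
      field_simp
      linarith
    rcases hB.boundary_cases hv with ⟨h1, h2, h3⟩ | ⟨h1, h2, h3⟩ | ⟨h1, h3⟩ <;>
    rcases hB.boundary_cases hw with ⟨g1, g2, g3⟩ | ⟨g1, g2, g3⟩ | ⟨g1, g3⟩
    · rw [h3, g3]
      exact le_mul_of_one_le_left (abs_nonneg _) hκ
    · exfalso
      rw [h1, g1, zero_sub, abs_neg, abs_of_pos hb] at hx
      linarith
    · rw [h3, g3, g1]
      exact le_mul_of_one_le_left (abs_nonneg _) hκ
    · exfalso
      rw [h1, g1, sub_zero, abs_of_pos hb] at hx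
      linarith
    · rw [hr h3, hr g3]
      exact abs_le_mul_abs_of_eq_mul (by positivity) (by ring)
    · rw [hr h3, g3, g1]
      exact abs_le_mul_abs_of_eq_mul (by positivity) (by ring)
    · rw [h3, g3, h1]
      exact le_mul_of_one_le_left (abs_nonneg _) hκ
    · rw [hr g3, h3, h1]
      exact abs_le_mul_abs_of_eq_mul (by positivity) (by ring)
    · rw [h1, g1, sub_self, abs_zero]
      positivity
  -- For a point of the right side close to the horizontal side: its true height is below `(a + ε) c
  -- / a`, which the condition on `c` bounds by `a / 2`.
  have big : ∀ {y r : ℝ}, P.a * y = (P.a + P.ε) * r → r < c → y ≤ P.a / 2 := by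
    intro y r h1 h2
    nlinarith
  have step2 : v.1 0 = w.1 0 ∨ (v.1 1 ≤ P.a / 2 ∧ w.1 1 ≤ P.a / 2) := by
    rcases hB.boundary_cases hv with ⟨h1, h2, h3⟩ | ⟨h1, h2, h3⟩ | ⟨h1, h3⟩ <;>
    rcases hB.boundary_cases hw with ⟨g1, g2, g3⟩ | ⟨g1, g2, g3⟩ | ⟨g1, g3⟩
    · exact Or.inr ⟨h2, g2⟩
    · exfalso
      rw [h1, g1, zero_sub, abs_neg, abs_of_pos hb] at hx
      linarith
    · exact Or.inr ⟨h2, by linarith⟩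
    · exfalso
      rw [h1, g1, sub_zero, abs_of_pos hb] at hx
      linarith
    · exact Or.inl (h1.trans g1.symm)
    · refine Or.inr ⟨big h3 ?_, by linarith⟩
      rw [g3, sub_zero] at hy
      exact (le_abs_self _).trans_lt hy
    · exact Or.inr ⟨by linarith, g2⟩
    · refine Or.inr ⟨by linarith, big g3 ?_⟩
      rw [h3, zero_sub, abs_neg] at hy
      exact (le_abs_self _).trans_lt hy
    · exact Or.inr ⟨by linarith, by linarith⟩
  rcases step2 with h1 | ⟨h1, h2⟩
  · refine (P.blockDist_le_of_vertical s v w h1).trans (step1.trans ?_)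
    rw [← abs_vert_sub_vert_same P s]
    exact mul_le_mul_of_nonneg_left (euclid_coord_le (P.flat ⟨s, v⟩) (P.flat ⟨s, w⟩) 1)
      (by positivity)
  · refine (P.blockDist_le_of_low s v w h1 h2).trans ?_
    refine dist_le_mul_of_coord_le (by positivity) (le_mul_of_one_le_left (abs_nonneg _) hκ) ?_
    rw [flat_snd, flat_snd, abs_vert_sub_vert_same]
    exact step1

/-- A point of a horizontal side has rectangle height at distance at least `a / 2 ≥ c` from every
point of the other hexagon. So nearby boundary points of different hexagons lie on the same vertical
side, and that side itself joins them. -/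
theorem BlockExists.blockDist_le_across (hB : P.BlockExists) {v w : P.hexagon}
    (hv : P.OnBoundary ⟨false, v⟩) (hw : P.OnBoundary ⟨true, w⟩) {c : ℝ} (hc : c ≤ P.b)
    (hc' : c ≤ P.a / 2)
    (h : dist (P.flat ⟨false, v⟩) (P.flat ⟨true, w⟩) < c) :
    P.blockDist ⟨false, v⟩ ⟨true, w⟩ ≤
      (P.a + P.ε) / P.a * dist (P.flat ⟨false, v⟩) (P.flat ⟨true, w⟩) := by
  have ha := P.a_pos
  have hε := P.ε_pos
  have hb := P.b_pos
  have hx := (euclid_coord_le _ _ 0).trans_lt h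
  have hy' := euclid_coord_le (P.flat ⟨false, v⟩) (P.flat ⟨true, w⟩) 1
  have hy := hy'.trans_lt h
  rw [flat_fst, flat_fst] at hx
  rw [flat_snd, flat_snd, vert_true, vert_false] at hy hy'
  simp only at hx
  have hκ : 1 ≤ (P.a + P.ε) / P.a := by
    rw [le_div_iff₀ ha]
    linarith
  have rv := (P.relHeight_mem v).2
  have rw' := (P.relHeight_mem w).2
  change P.relHeight v ≤ _ at rv
  change P.relHeight w ≤ _ at rw'
  rw [abs_sub_comm, abs_of_nonneg (by linarith)] at hy hy'
  set E := dist (P.flat ⟨false, v⟩) (P.flat ⟨true, w⟩)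
  have hE : 0 ≤ E := dist_nonneg
  rcases hB.boundary_cases hv with ⟨h1, h2, h3⟩ | ⟨h1, h2, h3⟩ | ⟨h1, h3⟩ <;>
    rcases hB.boundary_cases hw with ⟨g1, g2, g3⟩ | ⟨g1, g2, g3⟩ | ⟨g1, g3⟩
  · have := P.blockDist_le_of_vertical_across v w (h1.trans g1.symm)
    rw [h1, hB.height_zero] at this
    nlinarith
  · exfalso
    rw [h1, g1, zero_sub, abs_neg, abs_of_pos hb] at hx
    linarith
  · exfalso
    linarith
  · exfalso
    rw [h1, g1, sub_zero, abs_of_pos hb] at hx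
    linarith
  · have := P.blockDist_le_of_vertical_across v w (h1.trans g1.symm)
    rw [h1, hB.height_b] at this
    refine this.trans ?_
    rw [div_mul_eq_mul_div, le_div_iff₀ ha]
    nlinarith
  all_goals
    exfalso
    linarith

/-- Nearby boundary points of a block are at most a little farther apart than in the
rectangle. -/
theorem BlockExists.blockDist_le_of_near (hB : P.BlockExists) {p q : P.PreBlock}
    (hp : P.OnBoundary p) (hq : P.OnBoundary q) {c : ℝ} (hc : c ≤ P.b)
    (hc' : c * (2 * (P.a + P.ε)) ≤ P.a ^ 2) (h : dist (P.flat p) (P.flat q) < c) :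
    P.blockDist p q ≤ (P.a + P.ε) / P.a * dist (P.flat p) (P.flat q) := by
  have ha := P.a_pos
  have hε := P.ε_pos
  have hc0 : 0 ≤ c := dist_nonneg.trans h.le
  have hc2 : c ≤ P.a / 2 := by nlinarith [mul_nonneg hc0 hε.le]
  obtain ⟨s, v⟩ := p
  obtain ⟨t, w⟩ := q
  cases s <;> cases t
  · exact hB.blockDist_le_same hp hq hc hc' h
  · exact hB.blockDist_le_across hp hq hc hc2 h
  · rw [P.blockDist_comm, dist_comm]
    rw [dist_comm] at h
    exact hB.blockDist_le_across hq hp hc hc2 h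
  · exact hB.blockDist_le_same hp hq hc hc' h

/-! ### Lower bounds near the upper part of the right side. -/

/-- The distance to the last part of the broken line, cut off away from it. -/
def edgeDepth (v : P.hexagon) : ℝ := max 0 (min ((P.a + P.ε) / 2 - v.1 1) (v.1 0 - 3 * P.b / 4))

/-- `edgeDepth` with opposite signs on the two hexagons. -/
def signedDepth (s : Bool) (v : P.hexagon) : ℝ := if s then edgeDepth v else -edgeDepth v

/-- The map `clip` forgets the part of the right side above height `a / 2`; this function detects
it. `edgeDepth` vanishes on the whole broken line: up to abscissa `3b / 4` by the cut-off, and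
beyond it because `d cos θ ≤ b / 2` makes the line horizontal there. Hence opposite signs glue to a
`1`-Lipschitz function on the block. -/
theorem signedDepth_sub_le (hd : P.lineLength * Real.cos P.θ ≤ P.b / 2) (p q : P.PreBlock) :
    |signedDepth p.1 p.2 - signedDepth q.1 q.2| ≤ P.blockDist p q := by
  rw [← Real.dist_eq, ← one_mul (P.blockDist p q)]
  refine P.dist_le_mul_blockDist signedDepth one_pos ?_ ?_ p q
  · intro s v w
    have h : |edgeDepth v - edgeDepth w| ≤ dist v.1 w.1 := by
      unfold edgeDepth
      refine (abs_max_sub_max_le_max _ _ _ _).trans (max_le (by simp) ?_)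
      refine (abs_min_sub_min_le_max _ _ _ _).trans (max_le ?_ ?_)
      · rw [sub_sub_sub_cancel_left, abs_sub_comm]
        exact euclid_coord_le _ _ 1
      · rw [sub_sub_sub_cancel_right]
        exact euclid_coord_le _ _ 0
    rw [one_mul, Real.dist_eq]
    cases s
    · change |-edgeDepth v - -edgeDepth w| ≤ _
      rwa [neg_sub_neg, abs_sub_comm]
    · exact h
  · intro v hv
    have : edgeDepth v = 0 := by
      refine max_eq_left ?_
      rcases le_total (v.1 0) (3 * P.b / 4) with h | h
      · exact (min_le_right _ _).trans (by linarith)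
      · refine (min_le_left _ _).trans ?_
        rw [hv, P.height_of_ge (by linarith), sub_self]
    simp [signedDepth, this]

theorem edgeDepth_eq {v : P.hexagon} (h0 : v.1 0 = P.b) (h1 : (P.a + P.ε) / 2 - v.1 1 ≤ P.b / 4)
    (h2 : v.1 1 ≤ (P.a + P.ε) / 2) : edgeDepth v = (P.a + P.ε) / 2 - v.1 1 := by
  unfold edgeDepth
  rw [h0, min_eq_left (by linarith), max_eq_right (by linarith)]

theorem dist_flat_of_fst_eq {p q : P.PreBlock} (h : p.2.1 0 = q.2.1 0) :
    dist (P.flat p) (P.flat q) ≤ |P.vert p - P.vert q| := by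
  refine (euclid_dist_le _ _).trans ?_
  rw [flat_fst, flat_fst, h, sub_self, abs_zero, zero_add]
  rfl

/-- The `1`-Lipschitz map `clip` suffices unless both points are on the right side with one above
height `a / 2`. In that case both are close to the end `F` of the broken line, where `edgeDepth`
measures height exactly. -/
theorem BlockExists.dist_flat_le_same (hB : P.BlockExists) {s : Bool} {v w : P.hexagon}
    (hv : P.OnBoundary ⟨s, v⟩) (hw : P.OnBoundary ⟨s, w⟩) {c : ℝ} (hc : c ≤ P.b)
    (hc' : c * (8 * (P.a + P.ε)) ≤ P.a * P.b)
    (hd : P.lineLength * Real.cos P.θ ≤ P.b / 2) (hε4 : P.ε ≤ P.b / 4)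
    (h : dist (P.flat ⟨s, v⟩) (P.flat ⟨s, w⟩) < c) :
    dist (P.flat ⟨s, v⟩) (P.flat ⟨s, w⟩) ≤ P.blockDist ⟨s, v⟩ ⟨s, w⟩ := by
  have ha := P.a_pos
  have hε := P.ε_pos
  have hb := P.b_pos
  have hx := (euclid_coord_le _ _ 0).trans_lt h
  have hy := (euclid_coord_le _ _ 1).trans_lt h
  rw [flat_fst, flat_fst] at hx
  rw [flat_snd, flat_snd, abs_vert_sub_vert_same] at hy
  simp only at hx
  -- `flat` and `clip` have the same abscissa, so only heights need to be compared.
  have viaClip : |P.relHeight v - P.relHeight w| ≤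
      |min (v.1 1) (P.a / 2) - min (w.1 1) (P.a / 2)| →
      dist (P.flat ⟨s, v⟩) (P.flat ⟨s, w⟩) ≤ P.blockDist ⟨s, v⟩ ⟨s, w⟩ := by
    intro h1
    refine le_trans (dist_le_of_coord_le (v' := P.clip ⟨s, v⟩) (w' := P.clip ⟨s, w⟩) le_rfl ?_)
      (P.dist_clip_le_blockDist _ _)
    rw [flat_snd, flat_snd, abs_vert_sub_vert_same]
    cases s
    · exact h1
    · change _ ≤ |(P.a - min (v.1 1) (P.a / 2)) - (P.a - min (w.1 1) (P.a / 2))|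
      rwa [sub_sub_sub_cancel_left, abs_sub_comm (min (w.1 1) _)]
  have rv := P.relHeight_mem v
  have rw' := P.relHeight_mem w
  change P.relHeight v ∈ _ at rv
  change P.relHeight w ∈ _ at rw'
  have sub : ∀ {y r : ℝ}, P.a * y = (P.a + P.ε) * r → r ∈ Icc 0 (P.a / 2) →
      r ≤ min y (P.a / 2) := by
    intro y r h1 h2
    refine le_min ?_ h2.2
    nlinarith [mul_nonneg hε.le h2.1]
  rcases hB.boundary_cases hv with ⟨h1, h2, h3⟩ | ⟨h1, h2, h3⟩ | ⟨h1, h3⟩ <;>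
    rcases hB.boundary_cases hw with ⟨g1, g2, g3⟩ | ⟨g1, g2, g3⟩ | ⟨g1, g3⟩
  · apply viaClip
    rw [h3, g3, min_eq_left h2, min_eq_left g2]
  · exfalso
    rw [h1, g1, zero_sub, abs_neg, abs_of_pos hb] at hx
    linarith
  · apply viaClip
    rw [h3, g3, g1, min_eq_left h2, min_eq_left (by positivity)]
  · exfalso
    rw [h1, g1, sub_zero, abs_of_pos hb] at hx
    linarith
  · have e : P.a * (v.1 1 - w.1 1) = (P.a + P.ε) * (P.relHeight v - P.relHeight w) := by
      linarith
    have e' : P.a * |v.1 1 - w.1 1| = (P.a + P.ε) * |P.relHeight v - P.relHeight w| := by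
      rw [← abs_of_pos ha, ← abs_mul, abs_of_pos ha, e, abs_mul,
        abs_of_pos (by positivity : 0 < P.a + P.ε)]
    have hz := abs_nonneg (P.relHeight v - P.relHeight w)
    have le1 : |P.relHeight v - P.relHeight w| ≤ |v.1 1 - w.1 1| := by
      nlinarith [mul_nonneg hε.le hz]
    have le2 : |v.1 1 - w.1 1| ≤ P.b / 8 := by
      nlinarith
    by_cases low : v.1 1 ≤ P.a / 2 ∧ w.1 1 ≤ P.a / 2
    · apply viaClip
      rwa [min_eq_left low.1, min_eq_left low.2]
    · have := abs_le.1 le2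
      -- The higher point is within `ε / 2 ≤ b / 8` of `F`, and the other at most `b / 8` farther,
      -- so the cut-off in `edgeDepth` is inactive at both.
      have near : (P.a + P.ε) / 2 - v.1 1 ≤ P.b / 4 ∧ (P.a + P.ε) / 2 - w.1 1 ≤ P.b / 4 := by
        rw [not_and_or, not_le, not_le] at low
        rcases low with low | low <;> constructor <;> linarith
      have key := signedDepth_sub_le hd ⟨s, v⟩ ⟨s, w⟩
      refine (dist_flat_of_fst_eq (h1.trans g1.symm)).trans ?_
      rw [abs_vert_sub_vert_same]
      refine le1.trans (le_trans (le_of_eq ?_) key)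
      cases s
      · change _ = |-edgeDepth v - -edgeDepth w|
        rw [edgeDepth_eq h1 near.1 h2, edgeDepth_eq g1 near.2 g2]
        congr 1
        ring
      · change _ = |edgeDepth v - edgeDepth w|
        rw [edgeDepth_eq h1 near.1 h2, edgeDepth_eq g1 near.2 g2, abs_sub_comm]
        congr 1
        ring
  · apply viaClip
    rw [g3, g1, min_eq_left (by positivity : (0 : ℝ) ≤ P.a / 2), sub_zero, sub_zero,
      abs_of_nonneg rv.1]
    exact (sub h3 rv).trans (le_abs_self _)
  · apply viaClip
    rw [h3, g3, h1, min_eq_left g2, min_eq_left (by positivity)]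
  · apply viaClip
    rw [h3, h1, min_eq_left (by positivity : (0 : ℝ) ≤ P.a / 2), zero_sub, zero_sub, abs_neg,
      abs_neg, abs_of_nonneg rw'.1]
    exact (sub g3 rw').trans (le_abs_self _)
  · apply viaClip
    rw [h1, g1, h3, g3]
    simp

/-- Again only pairs on a common vertical side survive. On the left side `clip` is exact; on the
right side the two depths below `F` have opposite signs in `signedDepth` and therefore add up. -/
theorem BlockExists.dist_flat_le_across (hB : P.BlockExists) {v w : P.hexagon}
    (hv : P.OnBoundary ⟨false, v⟩) (hw : P.OnBoundary ⟨true, w⟩) {c : ℝ} (hc : c ≤ P.b)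
    (hc2 : c ≤ P.a / 2) (hc' : c * (8 * (P.a + P.ε)) ≤ P.a * P.b)
    (hd : P.lineLength * Real.cos P.θ ≤ P.b / 2)
    (h : dist (P.flat ⟨false, v⟩) (P.flat ⟨true, w⟩) < c) :
    dist (P.flat ⟨false, v⟩) (P.flat ⟨true, w⟩) ≤ P.blockDist ⟨false, v⟩ ⟨true, w⟩ := by
  have ha := P.a_pos
  have hε := P.ε_pos
  have hb := P.b_pos
  have hx := (euclid_coord_le _ _ 0).trans_lt h
  have hy := (euclid_coord_le _ _ 1).trans_lt h
  rw [flat_fst, flat_fst] at hx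
  rw [flat_snd, flat_snd, vert_true, vert_false] at hy
  simp only at hx
  have rv := (P.relHeight_mem v).2
  have rw' := (P.relHeight_mem w).2
  change P.relHeight v ≤ _ at rv
  change P.relHeight w ≤ _ at rw'
  rw [abs_sub_comm, abs_of_nonneg (by linarith)] at hy
  rcases hB.boundary_cases hv with ⟨h1, h2, h3⟩ | ⟨h1, h2, h3⟩ | ⟨h1, h3⟩ <;>
    rcases hB.boundary_cases hw with ⟨g1, g2, g3⟩ | ⟨g1, g2, g3⟩ | ⟨g1, g3⟩
  · refine le_trans (dist_le_of_coord_le (v' := P.clip ⟨false, v⟩) (w' := P.clip ⟨true, w⟩)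
      le_rfl ?_) (P.dist_clip_le_blockDist _ _)
    change |P.relHeight v - (P.a - P.relHeight w)| ≤
      |min (v.1 1) (P.a / 2) - (P.a - min (w.1 1) (P.a / 2))|
    rw [min_eq_left h2, min_eq_left g2, h3, g3]
  · exfalso
    rw [h1, g1, zero_sub, abs_neg, abs_of_pos hb] at hx
    linarith
  · exfalso
    linarith
  · exfalso
    rw [h1, g1, sub_zero, abs_of_pos hb] at hx
    linarith
  · have e : P.a * ((P.a + P.ε) - v.1 1 - w.1 1) =
        (P.a + P.ε) * (P.a - P.relHeight v - P.relHeight w) := by linarith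
    have hz : 0 ≤ P.a - P.relHeight v - P.relHeight w := by linarith
    have le1 : P.a - P.relHeight v - P.relHeight w ≤ (P.a + P.ε) - v.1 1 - w.1 1 := by
      nlinarith [mul_nonneg hε.le hz]
    have le2 : (P.a + P.ε) - v.1 1 - w.1 1 ≤ P.b / 8 := by
      nlinarith
    have key := signedDepth_sub_le hd ⟨false, v⟩ ⟨true, w⟩
    refine (dist_flat_of_fst_eq (h1.trans g1.symm)).trans ?_
    rw [vert_true, vert_false, abs_sub_comm, abs_of_nonneg (by linarith)]
    change |-edgeDepth v - edgeDepth w| ≤ _ at key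
    rw [edgeDepth_eq h1 (by linarith) h2, edgeDepth_eq g1 (by linarith) g2, ← neg_add',
      abs_neg] at key
    have := (le_abs_self _).trans key
    linarith
  all_goals
    exfalso
    linarith

/-- Nearby boundary points of a block are at least as far apart as in the rectangle. -/
theorem BlockExists.dist_flat_le_of_near (hB : P.BlockExists) {p q : P.PreBlock}
    (hp : P.OnBoundary p) (hq : P.OnBoundary q) {c : ℝ} (hc : c ≤ P.b) (hc2 : c ≤ P.a / 2)
    (hc' : c * (8 * (P.a + P.ε)) ≤ P.a * P.b)
    (hd : P.lineLength * Real.cos P.θ ≤ P.b / 2) (hε4 : P.ε ≤ P.b / 4)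
    (h : dist (P.flat p) (P.flat q) < c) :
    dist (P.flat p) (P.flat q) ≤ P.blockDist p q := by
  obtain ⟨s, v⟩ := p
  obtain ⟨t, w⟩ := q
  cases s <;> cases t
  · exact hB.dist_flat_le_same hp hq hc hc' hd hε4 h
  · exact hB.dist_flat_le_across hp hq hc hc2 hc' hd h
  · rw [P.blockDist_comm, dist_comm]
    rw [dist_comm] at h
    exact hB.dist_flat_le_across hq hp hc hc2 hc' hd h
  · exact hB.dist_flat_le_same hp hq hc hc' hd hε4 h

end DislocationParams

end

noncomputable section

/-! ### Polar coordinates -/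

namespace DislocationParams

/-- The law of cosines in half-angle form, which separates the radial from the angular contribution.
-/
theorem dist_polar_sq (p q : ℝ × ℝ) :
    dist (polar p) (polar q) ^ 2 =
      (p.1 - q.1) ^ 2 + 4 * p.1 * q.1 * Real.sin ((p.2 - q.2) / 2) ^ 2 := by
  rw [EuclideanSpace.dist_eq, Real.sq_sqrt (by positivity), Fin.sum_univ_two, Real.dist_eq,
    Real.dist_eq, sq_abs, sq_abs]
  change (p.1 * Real.cos p.2 - q.1 * Real.cos q.2) ^ 2 +
    (p.1 * Real.sin p.2 - q.1 * Real.sin q.2) ^ 2 = _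
  have h1 : Real.cos (p.2 - q.2) = 1 - 2 * Real.sin ((p.2 - q.2) / 2) ^ 2 := by
    have := Real.cos_sq' ((p.2 - q.2) / 2)
    have h2 := Real.cos_two_mul ((p.2 - q.2) / 2)
    rw [mul_div_cancel₀ _ (two_ne_zero)] at h2
    linarith
  rw [Real.cos_sub] at h1
  linear_combination p.1 ^ 2 * Real.sin_sq_add_cos_sq p.2 +
    q.1 ^ 2 * Real.sin_sq_add_cos_sq q.2 - 2 * p.1 * q.1 * h1

theorem dist_polar_le {p q : ℝ × ℝ} {R : ℝ} (hp : 0 ≤ p.1) (hq : 0 ≤ q.1) (hpR : p.1 ≤ R)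
    (hqR : q.1 ≤ R) :
    dist (polar p) (polar q) ≤ √((p.1 - q.1) ^ 2 + (R * (p.2 - q.2)) ^ 2) := by
  refine Real.le_sqrt_of_sq_le ?_
  rw [dist_polar_sq]
  have h1 : Real.sin ((p.2 - q.2) / 2) ^ 2 ≤ ((p.2 - q.2) / 2) ^ 2 :=
    sq_le_sq.2 Real.abs_sin_le_abs
  have h2 : p.1 * q.1 ≤ R * R := mul_le_mul hpR hqR hq (hp.trans hpR)
  have h3 := mul_le_mul h2 h1 (sq_nonneg _) (by nlinarith)
  nlinarith

theorem le_mul_dist_polar {p q : ℝ × ℝ} {r : ℝ} (hr : 0 ≤ r) (hp : r ≤ p.1) (hq : r ≤ q.1)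
    (hφ : |p.2 - q.2| ≤ 1) :
    √((p.1 - q.1) ^ 2 + (r * (p.2 - q.2)) ^ 2) ≤
      (1 + |p.2 - q.2|) * dist (polar p) (polar q) := by
  refine Real.sqrt_le_iff.2 ⟨by positivity, ?_⟩
  rw [mul_pow, mul_pow, dist_polar_sq]
  have key : |p.2 - q.2| ≤ (1 + |p.2 - q.2|) * (2 * |Real.sin ((p.2 - q.2) / 2)|) := by
    have e : |Real.sin ((p.2 - q.2) / 2)| = |Real.sin (|p.2 - q.2| / 2)| := by
      rcases abs_choice (p.2 - q.2) with h | h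
      · rw [h]
      · rw [h, neg_div, Real.sin_neg, abs_neg]
    rw [e]
    have h0 := abs_nonneg (p.2 - q.2)
    set u := |p.2 - q.2|
    rcases h0.eq_or_lt with h | h
    · rw [← h]
      simp
    -- From `sin x > x - x³/4` one gets `2 sin (u/2) ≥ u - u³/16`, and `(1 + u)(u - u³/16) ≥ u` for
    -- `0 ≤ u ≤ 1`.
    · have h1 := Real.sin_gt_sub_cube (x := u / 2) (by positivity)
      have h2 : u / 2 - u ^ 3 / 32 ≤ |Real.sin (u / 2)| := by
        refine le_trans ?_ (le_abs_self _)
        nlinarith [pow_pos h 3]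
      have h3 : u ^ 3 ≤ u ^ 2 := pow_le_pow_of_le_one h.le hφ (by norm_num)
      have h4 : u ^ 4 ≤ u ^ 2 := pow_le_pow_of_le_one h.le hφ (by norm_num)
      nlinarith [mul_le_mul_of_nonneg_left h2 (by positivity : 0 ≤ 2 * (1 + u))]
  have k2 := pow_le_pow_left₀ (abs_nonneg _) key 2
  rw [mul_pow, mul_pow, sq_abs, sq_abs] at k2
  have h1 : 1 ≤ (1 + |p.2 - q.2|) ^ 2 := one_le_pow₀ (by linarith [abs_nonneg (p.2 - q.2)])
  have h2 : r * r ≤ p.1 * q.1 := mul_le_mul hp hq hr (hr.trans hp)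
  have h3 := mul_le_mul_of_nonneg_left k2 (mul_nonneg hr hr)
  have h4 := mul_le_mul_of_nonneg_right h2
    (by positivity : 0 ≤ (1 + |p.2 - q.2|) ^ 2 * (2 ^ 2 * Real.sin ((p.2 - q.2) / 2) ^ 2))
  have h5 := mul_le_mul_of_nonneg_right h1 (sq_nonneg (p.1 - q.1))
  linarith

variable (P : DislocationParams)

/-- The curve that is affine in `(r, φ)` stays in the sector, and at radii at most `R` its speed is
bounded by the square root on the right. No bound on the angle is needed. -/
theorem dist_sector_le {y z : P.Sector} {R : ℝ} (hy : y.1.1 ≤ R) (hz : z.1.1 ≤ R) :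
    dist y z ≤ √((y.1.1 - z.1.1) ^ 2 + (R * (y.1.2 - z.1.2)) ^ 2) := by
  have e : ENNReal.ofReal (dist y z) = P.sectorEDist y z := (edist_dist y z).symm
  obtain ⟨p, hp⟩ := y
  obtain ⟨q, hq⟩ := z
  have hR := P.innerRadius_pos
  have hconv : Convex ℝ P.sectorSet := (convex_Icc _ _).prod (convex_Icc _ _)
  have hmem : ∀ t : unitInterval, p + (t : ℝ) • (q - p) ∈ P.sectorSet := fun t =>
    hconv.add_smul_sub_mem hp hq t.2
  let γ : Path (⟨p, hp⟩ : P.sectorSet) ⟨q, hq⟩ :=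
    { toFun := fun t => ⟨p + (t : ℝ) • (q - p), hmem t⟩
      continuous_toFun := by fun_prop
      source' := by simp
      target' := by simp }
  set D := √((p.1 - q.1) ^ 2 + (R * (p.2 - q.2)) ^ 2) with hD
  have main := pathEDist_le_of_lipschitz (fun p : P.sectorSet => polar p.1) γ D.toNNReal ?_
  · have main' := e.trans_le main
    change _ ≤ ENNReal.ofReal D at main'
    exact (ENNReal.ofReal_le_ofReal_iff (Real.sqrt_nonneg _)).1 main'
  · intro s t
    rw [Real.coe_toNNReal _ (Real.sqrt_nonneg _)]
    have c1 : ∀ s : unitInterval, (γ s).1.1 ≤ R := by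
      intro s
      have s0 := s.2.1
      have s1 := s.2.2
      change p.1 + s * (q.1 - p.1) ≤ R
      simp only at hy hz
      nlinarith
    refine (dist_polar_le (hR.le.trans (γ s).2.1.1) (hR.le.trans (γ t).2.1.1) (c1 s)
      (c1 t)).trans_eq ?_
    change √((p.1 + s * (q.1 - p.1) - (p.1 + t * (q.1 - p.1))) ^ 2 +
      (R * (p.2 + s * (q.2 - p.2) - (p.2 + t * (q.2 - p.2)))) ^ 2) = D * |(s : ℝ) - t|
    rw [← Real.sqrt_sq_eq_abs, hD, ← Real.sqrt_mul (by positivity)]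
    congr 1
    ring

/-! ### The fibrewise affine maps from the blocks to the sub-sectors -/

variable {P}
variable {n : ℕ}

theorem cell_a (i : Fin n) : (P.cell n i).a = (P.a + i * P.ε / n) / n := rfl

theorem cell_b (i : Fin n) : (P.cell n i).b = P.b / n := rfl

theorem cell_ε (i : Fin n) : (P.cell n i).ε = P.ε / n ^ 2 := rfl

theorem natCast_pos_of_fin (i : Fin n) : (0 : ℝ) < n := Nat.cast_pos.2 i.pos

theorem cell_a_add_ε_le (i : Fin n) : (P.cell n i).a + (P.cell n i).ε ≤ (P.a + P.ε) / n := by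
  have hn := natCast_pos_of_fin i
  have h1 : ((i : ℕ) : ℝ) + 1 ≤ n := by exact_mod_cast i.2
  have h2 : (P.cell n i).a + (P.cell n i).ε = (P.a + P.ε * ((i + 1) / n)) / n := by
    rw [cell_a, cell_ε]
    field_simp
    ring
  rw [h2]
  refine div_le_div_of_nonneg_right (add_le_add_right ?_ _) hn.le
  exact mul_le_of_le_one_right P.ε_pos.le ((div_le_one hn).2 h1)

theorem gridRadius_pos (k : ℕ) : 0 < P.gridRadius n k := by
  have := P.innerRadius_pos
  have := P.b_pos
  unfold gridRadius
  positivity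

theorem gridRadius_succ (k : ℕ) : P.gridRadius n (k + 1) = P.gridRadius n k + P.b / n := by
  unfold gridRadius
  push_cast
  ring

theorem gridAngle_succ (k : ℕ) :
    P.gridAngle n (k + 1) = P.gridAngle n k + P.ε / P.b / n := by
  unfold gridAngle
  push_cast
  ring

/-- This is where `R₀ = ab / ε` enters: the arc of radius `rᵢ` over one angular step has the length
of the left side of the block. -/
theorem gridRadius_mul (i : Fin n) : P.gridRadius n i * (P.ε / P.b / n) = (P.cell n i).a := by
  have h1 := P.b_pos
  have h2 := P.ε_pos
  have h3 := natCast_pos_of_fin i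
  rw [cell_a, gridRadius, innerRadius]
  field_simp

theorem gridRadius_succ_mul (i : Fin n) :
    P.gridRadius n (i + 1) * (P.ε / P.b / n) = (P.cell n i).a + (P.cell n i).ε := by
  have h1 := P.b_pos
  have h3 := natCast_pos_of_fin i
  rw [gridRadius_succ, add_mul, gridRadius_mul, cell_ε]
  congr 1
  field_simp

theorem angleStep_pos (i : Fin n) : 0 < P.ε / P.b / n :=
  div_pos (div_pos P.ε_pos P.b_pos) (natCast_pos_of_fin i)

theorem cell_a_div (i : Fin n) : (P.cell n i).a / P.gridRadius n i = P.ε / P.b / n := by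
  rw [← gridRadius_mul, mul_div_cancel_left₀ _ (gridRadius_pos _).ne']

theorem le_gridRadius (k : ℕ) : P.innerRadius ≤ P.gridRadius n k := by
  have := P.b_pos
  unfold gridRadius
  have : 0 ≤ (k : ℝ) * (P.b / n) := by positivity
  linarith

theorem gridRadius_le {k : ℕ} (hk : k ≤ n) : P.gridRadius n k ≤ P.innerRadius + P.b := by
  have hb := P.b_pos
  have h : (k : ℝ) ≤ n := Nat.cast_le.2 hk
  unfold gridRadius
  have : (k : ℝ) * (P.b / n) ≤ P.b := by
    rw [mul_div_left_comm]
    exact mul_le_of_le_one_right hb.le (div_le_one_of_le₀ h (Nat.cast_nonneg n))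
  linarith

theorem gridAngle_nonneg (k : ℕ) : 0 ≤ P.gridAngle n k := by
  have := P.b_pos
  have := P.ε_pos
  unfold gridAngle
  positivity

theorem gridAngle_le {k : ℕ} (hk : k ≤ n) : P.gridAngle n k ≤ P.ε / P.b := by
  have hb := div_pos P.ε_pos P.b_pos
  have h : (k : ℝ) ≤ n := Nat.cast_le.2 hk
  unfold gridAngle
  rw [mul_div_left_comm]
  exact mul_le_of_le_one_right hb.le (div_le_one_of_le₀ h (Nat.cast_nonneg n))

theorem vert_div_mem (i : Fin n) (p : (P.cell n i).PreBlock) :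
    (P.cell n i).vert p / P.gridRadius n i ∈ Icc 0 (P.ε / P.b / n) := by
  have h := (P.cell n i).vert_mem p
  have hr := gridRadius_pos (P := P) (n := n) i
  refine ⟨div_nonneg h.1 hr.le, ?_⟩
  rw [← cell_a_div i]
  exact div_le_div_of_nonneg_right h.2 hr.le

/-- The map of a block to the sector which maps the block fibrewise affinely onto the corresponding
sub-sector. -/
def cellProj (ij : Fin n × Fin n) (p : (P.cell n ij.1).PreBlock) : P.Sector :=
  ⟨(P.gridRadius n ij.1 + p.2.1 0,
    P.gridAngle n ij.2 + (P.cell n ij.1).vert p / P.gridRadius n ij.1), by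
    obtain ⟨i, j⟩ := ij
    have h1 := p.2.2.1
    have h2 := vert_div_mem i p
    have h3 := gridRadius_le (P := P) (n := n) (k := i + 1) i.2
    have h4 := gridAngle_le (P := P) (n := n) (k := j + 1) j.2
    rw [gridRadius_succ] at h3
    rw [gridAngle_succ] at h4
    exact ⟨⟨(le_gridRadius _).trans (le_add_of_nonneg_right h1.1),
        (add_le_add_right h1.2 _).trans h3⟩,
      add_nonneg (gridAngle_nonneg _) h2.1, (add_le_add_right h2.2 _).trans h4⟩⟩

theorem cellProj_fst (ij : Fin n × Fin n) (p : (P.cell n ij.1).PreBlock) :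
    (cellProj ij p).1.1 = P.gridRadius n ij.1 + p.2.1 0 := rfl

theorem cellProj_snd (ij : Fin n × Fin n) (p : (P.cell n ij.1).PreBlock) :
    (cellProj ij p).1.2 =
      P.gridAngle n ij.2 + (P.cell n ij.1).vert p / P.gridRadius n ij.1 := rfl

/-- The rectangle is the sub-sector with the metric `dr² + r² dφ²` frozen at its inner radius. -/
theorem dist_flat_eq (ij : Fin n × Fin n) (p q : (P.cell n ij.1).PreBlock) :
    dist ((P.cell n ij.1).flat p) ((P.cell n ij.1).flat q) =
      √(((cellProj ij p).1.1 - (cellProj ij q).1.1) ^ 2 +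
        (P.gridRadius n ij.1 * ((cellProj ij p).1.2 - (cellProj ij q).1.2)) ^ 2) := by
  have hr := (gridRadius_pos (P := P) (n := n) ij.1).ne'
  rw [EuclideanSpace.dist_eq, Fin.sum_univ_two, Real.dist_eq, Real.dist_eq, sq_abs, sq_abs,
    cellProj_fst, cellProj_fst, cellProj_snd, cellProj_snd]
  simp only [flat_fst, flat_snd]
  congr 2
  · congr 1
    ring
  · congr 1
    field_simp
    ring

theorem dist_cellProj_le (ij : Fin n × Fin n) (p q : (P.cell n ij.1).PreBlock) :
    dist (cellProj ij p) (cellProj ij q) ≤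
      (1 + P.ε / P.a / n) * dist ((P.cell n ij.1).flat p) ((P.cell n ij.1).flat q) := by
  have hn := natCast_pos_of_fin ij.1
  have hr := gridRadius_pos (P := P) (n := n) ij.1
  have ha := P.a_pos
  have hb := P.b_pos
  have hε := P.ε_pos
  have hR : ∀ p : (P.cell n ij.1).PreBlock,
      (cellProj ij p).1.1 ≤ P.gridRadius n (ij.1 + 1) := by
    intro p
    rw [cellProj_fst, gridRadius_succ]
    exact add_le_add_right p.2.2.1.2 _
  refine (P.dist_sector_le (hR p) (hR q)).trans ?_
  -- The ratio of outer to inner radius is largest for the innermost column, where it is `1 + b / (n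
  -- R₀) = 1 + ε / (a n)`.
  have hκ : P.gridRadius n (ij.1 + 1) ≤ (1 + P.ε / P.a / n) * P.gridRadius n ij.1 := by
    have e : P.b / n = P.ε / P.a / n * P.innerRadius := by
      unfold innerRadius
      field_simp
    rw [gridRadius_succ, add_mul, one_mul, e]
    exact add_le_add_right (mul_le_mul_of_nonneg_left (le_gridRadius _) (by positivity)) _
  have hκ1 : 1 ≤ 1 + P.ε / P.a / n := le_add_of_nonneg_right (by positivity)
  rw [dist_flat_eq]
  refine Real.sqrt_le_iff.2 ⟨by positivity, ?_⟩
  rw [mul_pow (1 + P.ε / P.a / n), Real.sq_sqrt (by positivity), mul_add]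
  refine add_le_add ?_ ?_
  · exact le_mul_of_one_le_left (sq_nonneg _) (one_le_pow₀ hκ1)
  · rw [← mul_pow, ← mul_assoc, mul_pow, mul_pow (_ * _)]
    exact mul_le_mul_of_nonneg_right (pow_le_pow_left₀ (gridRadius_pos _).le hκ 2) (sq_nonneg _)

/-- All radii are at least the frozen one and the angular width is at most `1`. The bound is by the
chord and not by the sector distance, since a chord bounds the length of any piece of curve between
its end points, even one that leaves the sub-sector. -/
theorem dist_flat_le_mul_dist_polar (hn : P.ε / P.b ≤ n) (ij : Fin n × Fin n)
    (p q : (P.cell n ij.1).PreBlock) :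
    dist ((P.cell n ij.1).flat p) ((P.cell n ij.1).flat q) ≤
      (1 + P.ε / P.b / n) * dist (polar (cellProj ij p).1) (polar (cellProj ij q).1) := by
  have hp := vert_div_mem ij.1 p
  have hq := vert_div_mem ij.1 q
  have hφ : |(cellProj ij p).1.2 - (cellProj ij q).1.2| ≤ P.ε / P.b / n := by
    rw [cellProj_snd, cellProj_snd, add_sub_add_left_eq_sub, abs_le]
    constructor <;> linarith [hp.1, hp.2, hq.1, hq.2]
  have h1 : P.ε / P.b / n ≤ 1 := div_le_one_of_le₀ hn (Nat.cast_nonneg n)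
  have hR : ∀ p : (P.cell n ij.1).PreBlock, P.gridRadius n ij.1 ≤ (cellProj ij p).1.1 :=
    fun p => le_add_of_nonneg_right p.2.2.1.1
  rw [dist_flat_eq]
  refine (le_mul_dist_polar (gridRadius_pos _).le (hR p) (hR q) (hφ.trans h1)).trans ?_
  exact mul_le_mul_of_nonneg_right (by linarith) dist_nonneg

/-! ### Uniform comparison of the boundaries of the blocks and of the rectangles -/

/-- Two regimes, separated at rectangle distance `c / n`. Below it the sharp near comparison
applies, with factor `1 + Q.ε / Q.a` in one direction (`C1`) and `1` in the other. Above it the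
additive error of order `ε / n²` is relatively `O(1/n)` (`C2`, `C3`). The constant `C4` absorbs the
small `n` at which the near comparison is unavailable. -/
theorem BlockExists.blockDist_bounds {Q : DislocationParams} (hB : Q.BlockExists)
    {n a b ε L T c C : ℝ} (hn : 0 < n) (ha : 0 < a) (hb : 0 < b) (hε : 0 < ε) (hT : 0 < T)
    (hL : 0 < L) (hQε : Q.ε = ε / n ^ 2) (hQb : Q.b = b / n) (hQa : a / n ≤ Q.a)
    (hQaε : Q.a + Q.ε ≤ (a + ε) / n) (hQT : Real.tan Q.θ = T)
    (hQL : Q.lineLength * Real.cos Q.θ = L / n ^ 2) (hc : 0 < c)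
    (hca : c * (8 * (a + ε)) ≤ a * a) (hcb : c * (8 * (a + ε)) ≤ a * b)
    (C1 : ε / a ≤ C) (C2 : 3 * ε / c ≤ C) (C3 : ε * (2 + T) / c ≤ C)
    (C4 : (1 + T) * (2 * L / b + 4 * ε / b) ≤ C) {p q : Q.PreBlock} (hp : Q.OnBoundary p)
    (hq : Q.OnBoundary q) :
    Q.blockDist p q ≤ (1 + C / n) * dist (Q.flat p) (Q.flat q) ∧
      dist (Q.flat p) (Q.flat q) ≤ (1 + C / n) * Q.blockDist p q := by
  have crude := Q.dist_flat_le_mul_blockDist p q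
  rw [hQT] at crude
  have he : 0 ≤ dist (Q.flat p) (Q.flat q) := dist_nonneg
  have hd : 0 ≤ Q.blockDist p q := Q.blockDist_nonneg p q
  have hQa0 := Q.a_pos
  have hQε0 := Q.ε_pos
  have hC : 0 ≤ C := (by positivity : 0 ≤ ε / a).trans C1
  -- the scale below which the comparison is exact
  have c1 : c / n ≤ Q.b := by
    rw [hQb]
    refine div_le_div_of_nonneg_right ?_ hn.le
    have : 0 ≤ c * ε := by positivity
    nlinarith
  have c2 : c / n ≤ Q.a / 2 := by
    refine le_trans ?_ (div_le_div_of_nonneg_right hQa two_pos.le)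
    rw [div_right_comm]
    refine div_le_div_of_nonneg_right ?_ hn.le
    have : 0 ≤ c * ε := by positivity
    nlinarith
  have c3 : c / n * (8 * (Q.a + Q.ε)) ≤ c * (8 * (a + ε)) / n / n := by
    calc c / n * (8 * (Q.a + Q.ε)) ≤ c / n * (8 * ((a + ε) / n)) := by gcongr
      _ = c * (8 * (a + ε)) / n / n := by ring
  have c4 : c / n * (2 * (Q.a + Q.ε)) ≤ Q.a ^ 2 := by
    have h1 : c / n * (2 * (Q.a + Q.ε)) ≤ c / n * (8 * (Q.a + Q.ε)) := by gcongr; norm_num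
    refine h1.trans (c3.trans ?_)
    calc c * (8 * (a + ε)) / n / n ≤ a * a / n / n := by gcongr
      _ = (a / n) ^ 2 := by ring
      _ ≤ Q.a ^ 2 := by gcongr
  have c5 : c / n * (8 * (Q.a + Q.ε)) ≤ Q.a * Q.b := by
    refine c3.trans ?_
    calc c * (8 * (a + ε)) / n / n ≤ a * b / n / n := by gcongr
      _ = a / n * (b / n) := by ring
      _ ≤ Q.a * Q.b := by
        rw [hQb]
        gcongr
  constructor
  · rcases lt_or_ge (dist (Q.flat p) (Q.flat q)) (c / n) with h | h
    · refine (hB.blockDist_le_of_near hp hq c1 c4 h).trans ?_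
      refine mul_le_mul_of_nonneg_right ?_ he
      rw [add_div, div_self hQa0.ne']
      refine add_le_add_right ?_ _
      rw [hQε, div_le_iff₀ hQa0]
      calc ε / n ^ 2 = ε / a / n * (a / n) := by field_simp
        _ ≤ C / n * Q.a := by gcongr
    · refine (Q.blockDist_le_dist_flat_add p q).trans ?_
      rw [add_mul, one_mul]
      refine add_le_add_right ?_ _
      calc 3 * Q.ε = 3 * ε / c / n * (c / n) := by
            rw [hQε]
            field_simp
        _ ≤ C / n * dist (Q.flat p) (Q.flat q) := by gcongr
  · rcases lt_or_ge (dist (Q.flat p) (Q.flat q)) (c / n) with h | h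
    -- These conditions compare quantities of order `1/n²` with one of order `1/n`, so they can fail
    -- only for `n ≤ 2L/b + 4ε/b`. There the crude factor `2 + T` is at most `1 + C / n`.
    · by_cases hs : Q.lineLength * Real.cos Q.θ ≤ Q.b / 2 ∧ Q.ε ≤ Q.b / 4
      · refine (hB.dist_flat_le_of_near hp hq c1 c2 c5 hs.1 hs.2 h).trans ?_
        exact le_mul_of_one_le_left hd (le_add_of_nonneg_right (by positivity))
      · have hNn : n ≤ 2 * L / b + 4 * ε / b := by
          rw [← add_div, le_div_iff₀ hb]
          rw [hQL, hQε, hQb, not_and_or, not_le, not_le, div_div, div_div,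
            div_lt_div_iff₀ (by positivity) (by positivity),
            div_lt_div_iff₀ (by positivity) (by positivity)] at hs
          refine le_of_mul_le_mul_left ?_ hn
          rcases hs with hs | hs
          · nlinarith [mul_pos hn hε]
          · nlinarith [mul_pos hn hL]
        refine crude.trans (mul_le_mul_of_nonneg_right ?_ hd)
        have h1 : 1 + T ≤ C / n := by
          rw [le_div_iff₀ hn]
          exact (mul_le_mul_of_nonneg_left hNn (by positivity)).trans C4
        linarith
    · refine (Q.dist_flat_le_blockDist_add p q).trans ?_
      rw [add_mul, one_mul]
      refine add_le_add_right ?_ _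
      -- The crude bound turns a lower bound for the rectangle distance into one for the block
      -- distance, against which the additive error is measured.
      have h1 : c / n ≤ (2 + T) * Q.blockDist p q := h.trans crude
      calc Q.ε = ε / c / n * (c / n) := by
            rw [hQε]
            field_simp
        _ ≤ ε / c / n * ((2 + T) * Q.blockDist p q) := by gcongr
        _ = ε * (2 + T) / c / n * Q.blockDist p q := by ring
        _ ≤ C / n * Q.blockDist p q := by gcongr

variable (P) in
/-- On the boundary of a block, the block distance and the distance in the rectangle differ at most
by factors `1 + O(1 / n)`, uniformly for all blocks. -/
theorem exists_blockDist_bounds : ∃ C : ℝ, 0 ≤ C ∧ ∀ (n : ℕ) (i : Fin n),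
    (P.cell n i).BlockExists → ∀ p q, (P.cell n i).OnBoundary p → (P.cell n i).OnBoundary q →
      (P.cell n i).blockDist p q ≤
        (1 + C / n) * dist ((P.cell n i).flat p) ((P.cell n i).flat q) ∧
      dist ((P.cell n i).flat p) ((P.cell n i).flat q) ≤
        (1 + C / n) * (P.cell n i).blockDist p q := by
  have ha := P.a_pos
  have hb := P.b_pos
  have hε := P.ε_pos
  have hT := P.tan_pos
  have hL := mul_pos P.lineLength_pos P.cos_pos
  obtain ⟨c, hc, hca, hcb⟩ : ∃ c : ℝ, 0 < c ∧ c * (8 * (P.a + P.ε)) ≤ P.a * P.a ∧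
      c * (8 * (P.a + P.ε)) ≤ P.a * P.b := by
    refine ⟨P.a * min P.a P.b / (8 * (P.a + P.ε)), ?_, ?_, ?_⟩
    · have := lt_min ha hb
      positivity
    · rw [div_mul_cancel₀ _ (by positivity)]
      exact mul_le_mul_of_nonneg_left (min_le_left _ _) ha.le
    · rw [div_mul_cancel₀ _ (by positivity)]
      exact mul_le_mul_of_nonneg_left (min_le_right _ _) ha.le
  have n1 : 0 ≤ P.ε / P.a := by positivity
  have n2 : 0 ≤ 3 * P.ε / c := by positivity
  have n3 : 0 ≤ P.ε * (2 + Real.tan P.θ) / c := by positivity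
  have n4 : 0 ≤ (1 + Real.tan P.θ) *
      (2 * (P.lineLength * Real.cos P.θ) / P.b + 4 * P.ε / P.b) := by positivity
  refine ⟨P.ε / P.a + 3 * P.ε / c + P.ε * (2 + Real.tan P.θ) / c + (1 + Real.tan P.θ) *
    (2 * (P.lineLength * Real.cos P.θ) / P.b + 4 * P.ε / P.b), by linarith, ?_⟩
  intro n i hB p q hp hq
  have hn := natCast_pos_of_fin i
  refine hB.blockDist_bounds hn ha hb hε hT hL (cell_ε i) (cell_b i) ?_ ?_ rfl ?_ hc hca hcb
    (by linarith) (by linarith) (by linarith) (by linarith) hp hq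
  · rw [cell_a]
    refine div_le_div_of_nonneg_right ?_ hn.le
    exact le_add_of_nonneg_right (by positivity)
  · exact cell_a_add_ε_le i
  · change P.ε / n ^ 2 / (2 * Real.sin P.θ) * Real.cos P.θ =
      P.ε / (2 * Real.sin P.θ) * Real.cos P.θ / n ^ 2
    ring

end DislocationParams

end

noncomputable section

namespace DislocationParams

variable {P : DislocationParams}

/-! ### The sides of a block in rectangular coordinates -/

theorem BlockExists.vert_of_left (hB : P.BlockExists) {p : P.PreBlock} (h : p.2.1 0 = 0) :
    P.vert p = if p.1 then P.a - p.2.1 1 else p.2.1 1 := by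
  have ha := P.a_pos
  have e : P.a * p.2.1 1 / (2 * P.height (p.2.1 0)) = p.2.1 1 := by
    rw [h, hB.height_zero]
    field_simp
  unfold vert
  rw [e]

theorem BlockExists.vert_of_right (hB : P.BlockExists) {p : P.PreBlock} (h : p.2.1 0 = P.b) :
    (P.a + P.ε) / P.a * P.vert p = if p.1 then P.a + P.ε - p.2.1 1 else p.2.1 1 := by
  have ha := P.a_pos
  have hε := P.ε_pos
  have e : P.a * p.2.1 1 / (2 * P.height (p.2.1 0)) = P.a / (P.a + P.ε) * p.2.1 1 := by
    rw [h, hB.height_b]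
    field_simp
  unfold vert
  rw [e]
  split_ifs <;> field_simp

theorem BlockExists.isLeft_iff (hB : P.BlockExists) {p : P.PreBlock} {s : ℝ} :
    P.IsLeft p s ↔ p.2.1 0 = 0 ∧ s = P.vert p := by
  refine and_congr_right fun h => ?_
  rw [hB.vert_of_left h]

theorem BlockExists.isRight_iff (hB : P.BlockExists) {p : P.PreBlock} {s : ℝ} :
    P.IsRight p s ↔ p.2.1 0 = P.b ∧ s = (P.a + P.ε) / P.a * P.vert p := by
  refine and_congr_right fun h => ?_
  rw [hB.vert_of_right h]

theorem relHeight_eq_zero_iff {v : P.hexagon} : P.relHeight v = 0 ↔ v.1 1 = 0 := by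
  have ha := P.a_pos.ne'
  have hh := (P.height_pos (v.1 0)).ne'
  simp [relHeight, ha, hh]

/-- On the upper hexagon `vert ≥ a / 2 > 0`, so the value `0` already forces the lower hexagon;
`isTop_iff` is the mirror image. -/
theorem isBottom_iff {p : P.PreBlock} {t : ℝ} : P.IsBottom p t ↔ P.vert p = 0 ∧ p.2.1 0 = t := by
  obtain ⟨s, v⟩ := p
  have ha := P.a_pos
  cases s
  · rw [vert_false, relHeight_eq_zero_iff]
    simp [IsBottom]
  · have := P.le_vert_true v
    refine ⟨fun h => absurd h.1 (by simp), fun h => ?_⟩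
    exfalso
    linarith [h.1]

theorem isTop_iff {p : P.PreBlock} {t : ℝ} : P.IsTop p t ↔ P.vert p = P.a ∧ p.2.1 0 = t := by
  obtain ⟨s, v⟩ := p
  have ha := P.a_pos
  cases s
  · have := P.vert_false_le v
    refine ⟨fun h => absurd h.1 (by simp), fun h => ?_⟩
    exfalso
    linarith [h.1]
  · rw [vert_true, sub_eq_self, relHeight_eq_zero_iff]
    simp [IsTop]

theorem vert_eq_zero_or_iff {p : P.PreBlock} : P.vert p = 0 ∨ P.vert p = P.a ↔ p.2.1 1 = 0 := by
  obtain ⟨s, v⟩ := p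
  have ha := P.a_pos
  cases s
  · have h := P.vert_false_le v
    rw [vert_false] at *
    rw [relHeight_eq_zero_iff]
    refine ⟨fun h' => h'.elim id fun h' => ?_, Or.inl⟩
    linarith
  · have h := P.le_vert_true v
    rw [vert_true] at *
    rw [sub_eq_self, relHeight_eq_zero_iff]
    refine ⟨fun h' => h'.elim (fun h' => ?_) id, Or.inr⟩
    linarith

theorem onVerticalSide_iff {p : P.PreBlock} : P.OnVerticalSide p ↔ p.2.1 0 = 0 ∨ p.2.1 0 = P.b := by
  simp [OnVerticalSide, IsLeft, IsRight]

theorem onHorizontalSide_iff {p : P.PreBlock} :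
    P.OnHorizontalSide p ↔ P.vert p = 0 ∨ P.vert p = P.a := by
  simp [OnHorizontalSide, isBottom_iff, isTop_iff]

theorem onBoundary_iff {p : P.PreBlock} :
    P.OnBoundary p ↔ P.OnVerticalSide p ∨ P.OnHorizontalSide p := by
  rw [onVerticalSide_iff, onHorizontalSide_iff, vert_eq_zero_or_iff, or_assoc]
  rfl

/-- Every point of the rectangle is the image of a point of the block. -/
theorem exists_vert_eq {x v : ℝ} (hx : x ∈ Icc 0 P.b) (hv : v ∈ Icc 0 P.a) :
    ∃ p : P.PreBlock, p.2.1 0 = x ∧ P.vert p = v := by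
  have ha := P.a_pos
  have hh := P.height_pos x
  have mem : ∀ u ∈ Icc 0 (P.a / 2), 2 * P.height x * u / P.a ∈ Icc 0 (P.height x) := by
    intro u hu
    have := hu.1
    refine ⟨by positivity, ?_⟩
    rw [div_le_iff₀ ha]
    nlinarith [hu.2]
  have rel : ∀ u (hu : u ∈ Icc 0 (P.a / 2)), P.relHeight (P.hexPoint hx (mem u hu)) = u := by
    intro u hu
    change P.a * (2 * P.height x * u / P.a) / (2 * P.height x) = u
    field_simp
  rcases le_total v (P.a / 2) with h | h
  · exact ⟨⟨false, P.hexPoint hx (mem v ⟨hv.1, h⟩)⟩, rfl, rel v ⟨hv.1, h⟩⟩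
  · refine ⟨⟨true, P.hexPoint hx (mem (P.a - v) ⟨by linarith [hv.2], by linarith⟩)⟩, rfl, ?_⟩
    rw [vert_true, rel (P.a - v) ⟨by linarith [hv.2], by linarith⟩]
    ring

/-- Points of the block with the same rectangular coordinates are identified. -/
theorem blockEDist_eq_zero_of_vert_eq {p q : P.PreBlock} (hx : p.2.1 0 = q.2.1 0)
    (hv : P.vert p = P.vert q) : P.blockEDist p q = 0 := by
  have ha := P.a_pos
  have eq_of : ∀ v w : P.hexagon, v.1 0 = w.1 0 → P.relHeight v = P.relHeight w → v = w := by
    intro v w h0 h1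
    have hh := (P.height_pos (w.1 0)).ne'
    have h2 : v.1 1 = w.1 1 := by
      unfold relHeight at h1
      rw [h0] at h1
      field_simp at h1
      exact h1
    refine Subtype.ext (PiLp.ext fun i => ?_)
    fin_cases i
    · exact h0
    · exact h2
  have top : ∀ v : P.hexagon, P.relHeight v = P.a / 2 → v.1 1 = P.height (v.1 0) := by
    intro v h
    have hh := (P.height_pos (v.1 0)).ne'
    unfold relHeight at h
    field_simp at h
    linarith
  have across : ∀ v w : P.hexagon, v.1 0 = w.1 0 → P.vert ⟨false, v⟩ = P.vert ⟨true, w⟩ →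
      P.blockEDist ⟨false, v⟩ ⟨true, w⟩ = 0 := by
    intro v w h0 h1
    have h2 := P.vert_false_le v
    have h3 := P.le_vert_true w
    -- The ranges of `vert` on the two hexagons meet only in `a / 2`, the value on the broken line,
    -- where the hexagons are glued.
    have h4 : P.relHeight v = P.a / 2 := le_antisymm h2 (h3.trans h1.symm.le)
    have h5 : P.relHeight w = P.a / 2 := by
      rw [vert_true, vert_false] at h1
      linarith
    obtain rfl := eq_of v w h0 (h4.trans h5.symm)
    exact P.blockEDist_eq_zero_of_glue (top v h4)
  obtain ⟨s, v⟩ := p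
  obtain ⟨t, w⟩ := q
  cases s <;> cases t
  · obtain rfl := eq_of v w hx hv
    exact P.blockEDist_isPseudoEDist.self _
  · exact across v w hx hv
  · rw [P.blockEDist_comm]
    exact across w v hx.symm hv.symm
  · rw [vert_true, vert_true, sub_right_inj] at hv
    obtain rfl := eq_of v w hx hv
    exact P.blockEDist_isPseudoEDist.self _

/-! ### The projection of the glued surface to the sector -/

variable {n : ℕ}

/-- The point `p` of the block `ij` as a point of the disjoint union. -/
def inCell (ij : Fin n × Fin n) (p : (P.cell n ij.1).PreBlock) : P.PreGlued n := ⟨ij, p⟩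

/-- The map of the disjoint union of the blocks to the sector. -/
def proj (p : P.PreGlued n) : P.Sector := cellProj p.1 p.2

/-- `p` lies on the boundary of its block. -/
def InGrid (p : P.PreGlued n) : Prop := (P.cell n p.1.1).OnBoundary p.2

theorem sector_ext {y z : P.Sector} (h1 : y.1.1 = z.1.1) (h2 : y.1.2 = z.1.2) : y = z :=
  Subtype.ext (Prod.ext h1 h2)

theorem cellProj_eq_iff {ij : Fin n × Fin n} {p : (P.cell n ij.1).PreBlock} {y : P.Sector} :
    cellProj ij p = y ↔ p.2.1 0 = y.1.1 - P.gridRadius n ij.1 ∧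
      (P.cell n ij.1).vert p = P.gridRadius n ij.1 * (y.1.2 - P.gridAngle n ij.2) := by
  have hr := (gridRadius_pos (P := P) (n := n) ij.1).ne'
  constructor
  · rintro rfl
    rw [cellProj_fst, cellProj_snd]
    constructor
    · ring
    · field_simp
      ring
  · rintro ⟨h1, h2⟩
    refine sector_ext ?_ ?_
    · rw [cellProj_fst, h1]
      ring
    · rw [cellProj_snd, h2]
      field_simp
      ring

/-! ### Sub-sectors and their boundaries. -/

variable (P n) in
/-- The closed sub-sectors. -/
def subSector (ij : Fin n × Fin n) : Set P.Sector :=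
  {y | y.1.1 ∈ Icc (P.gridRadius n ij.1) (P.gridRadius n (ij.1 + 1)) ∧
    y.1.2 ∈ Icc (P.gridAngle n ij.2) (P.gridAngle n (ij.2 + 1))}

theorem cellProj_mem (ij : Fin n × Fin n) (p : (P.cell n ij.1).PreBlock) :
    cellProj ij p ∈ P.subSector n ij := by
  have h1 := p.2.2.1
  have h2 := vert_div_mem ij.1 p
  refine ⟨?_, ?_⟩
  · rw [cellProj_fst, gridRadius_succ]
    exact ⟨le_add_of_nonneg_right h1.1, add_le_add_right h1.2 _⟩
  · rw [cellProj_snd, gridAngle_succ]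
    exact ⟨le_add_of_nonneg_right h2.1, add_le_add_right h2.2 _⟩

theorem exists_cellProj_eq {ij : Fin n × Fin n} {y : P.Sector} (hy : y ∈ P.subSector n ij) :
    ∃ p, cellProj ij p = y := by
  obtain ⟨⟨h1, h2⟩, h3, h4⟩ := hy
  have hr := gridRadius_pos (P := P) (n := n) ij.1
  rw [gridRadius_succ] at h2
  rw [gridAngle_succ] at h4
  obtain ⟨p, hp1, hp2⟩ := exists_vert_eq (P := P.cell n ij.1)
    (x := y.1.1 - P.gridRadius n ij.1)
    (v := P.gridRadius n ij.1 * (y.1.2 - P.gridAngle n ij.2))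
    ⟨by linarith, by rw [cell_b]; linarith⟩
    ⟨mul_nonneg hr.le (by linarith), by
      rw [← gridRadius_mul]
      exact mul_le_mul_of_nonneg_left (by linarith) hr.le⟩
  exact ⟨p, cellProj_eq_iff.2 ⟨hp1, hp2⟩⟩

theorem exists_step {w x : ℝ} {n : ℕ} (hn : 0 < n) (h0 : 0 ≤ x) (h1 : x ≤ n * w) :
    ∃ i < n, i * w ≤ x ∧ x ≤ (i + 1 : ℕ) * w := by
  induction n with
  | zero => exact absurd hn (lt_irrefl 0)
  | succ m ih =>
    rcases le_total (m * w) x with h | h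
    · exact ⟨m, Nat.lt_succ_self m, h, h1⟩
    · rcases Nat.eq_zero_or_pos m with rfl | hm
      · refine ⟨0, Nat.lt_succ_self 0, ?_, h1⟩
        simpa using h0
      · obtain ⟨i, hi, h2⟩ := ih hm h
        exact ⟨i, hi.trans (Nat.lt_succ_self m), h2⟩

theorem exists_mem_subSector (hn : 0 < n) (y : P.Sector) : ∃ ij, y ∈ P.subSector n ij := by
  obtain ⟨⟨h1, h2⟩, h3, h4⟩ := y.2
  have hn' : (n : ℝ) ≠ 0 := Nat.cast_ne_zero.2 hn.ne'
  obtain ⟨i, hi, i1, i2⟩ := exists_step (w := P.b / n) (x := y.1.1 - P.innerRadius) hn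
    (by linarith) (by rw [mul_div_cancel₀ _ hn']; linarith)
  obtain ⟨j, hj, j1, j2⟩ := exists_step (w := P.ε / P.b / n) (x := y.1.2) hn h3
    (by rw [mul_div_cancel₀ _ hn']; exact h4)
  refine ⟨(⟨i, hi⟩, ⟨j, hj⟩), ⟨?_, ?_⟩, j1, j2⟩
  · change P.innerRadius + i * (P.b / n) ≤ _
    linarith
  · change _ ≤ P.innerRadius + (i + 1 : ℕ) * (P.b / n)
    linarith

theorem natCast_eq_or_of_mem {w : ℝ} (hw : 0 < w) {i k : ℕ} (h1 : i * w ≤ k * w)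
    (h2 : k * w ≤ (i + 1 : ℕ) * w) : k = i ∨ k = i + 1 := by
  have h1' := Nat.cast_le.1 (le_of_mul_le_mul_right h1 hw)
  have h2' := Nat.cast_le.1 (le_of_mul_le_mul_right h2 hw)
  omega

theorem gridRadius_eq_or {i k : ℕ} (hn : 0 < n) (h : P.gridRadius n k ∈
    Icc (P.gridRadius n i) (P.gridRadius n (i + 1))) : k = i ∨ k = i + 1 := by
  refine natCast_eq_or_of_mem (w := P.b / n) (div_pos P.b_pos (Nat.cast_pos.2 hn)) ?_ ?_
  · have := h.1
    unfold gridRadius at this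
    linarith
  · have := h.2
    unfold gridRadius at this
    linarith

theorem gridAngle_eq_or {j k : ℕ} (hn : 0 < n) (h : P.gridAngle n k ∈
    Icc (P.gridAngle n j) (P.gridAngle n (j + 1))) : k = j ∨ k = j + 1 :=
  natCast_eq_or_of_mem (w := P.ε / P.b / n)
    (div_pos (div_pos P.ε_pos P.b_pos) (Nat.cast_pos.2 hn)) h.1 h.2

/-- A grid radius attained in a closed sub-sector is one of its two end radii. Hence the sides of a
block are the full preimage of the grid circles, including those that belong to other columns by
index. -/
theorem onVerticalSide_iff_cellProj {ij : Fin n × Fin n} {p : (P.cell n ij.1).PreBlock} :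
    (P.cell n ij.1).OnVerticalSide p ↔ ∃ k ≤ n, (cellProj ij p).1.1 = P.gridRadius n k := by
  rw [onVerticalSide_iff]
  constructor
  · rintro (h | h)
    · exact ⟨ij.1, ij.1.2.le, by rw [cellProj_fst, h, add_zero]⟩
    · exact ⟨ij.1 + 1, ij.1.2, by rw [cellProj_fst, h, gridRadius_succ]; rfl⟩
  · rintro ⟨k, -, h⟩
    have hm := (cellProj_mem ij p).1
    rw [h] at hm
    rw [cellProj_fst] at h
    rcases gridRadius_eq_or ij.1.pos hm with rfl | rfl
    · left
      linarith
    · right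
      rw [gridRadius_succ] at h
      rw [cell_b]
      linarith

theorem onHorizontalSide_iff_cellProj {ij : Fin n × Fin n} {p : (P.cell n ij.1).PreBlock} :
    (P.cell n ij.1).OnHorizontalSide p ↔ ∃ k ≤ n, (cellProj ij p).1.2 = P.gridAngle n k := by
  have hr := gridRadius_pos (P := P) (n := n) ij.1
  rw [onHorizontalSide_iff]
  constructor
  · rintro (h | h)
    · exact ⟨ij.2, ij.2.2.le, by rw [cellProj_snd, h, zero_div, add_zero]⟩
    · exact ⟨ij.2 + 1, ij.2.2, by rw [cellProj_snd, h, gridAngle_succ, cell_a_div]⟩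
  · rintro ⟨k, -, h⟩
    have hm := (cellProj_mem ij p).2
    rw [h] at hm
    rw [cellProj_snd] at h
    rcases gridAngle_eq_or ij.1.pos hm with rfl | rfl
    · left
      have : (P.cell n ij.1).vert p / P.gridRadius n ij.1 = 0 := by linarith
      exact (div_eq_zero_iff.1 this).resolve_right hr.ne'
    · right
      rw [gridAngle_succ] at h
      have : (P.cell n ij.1).vert p / P.gridRadius n ij.1 = P.ε / P.b / n := by linarith
      rw [← cell_a_div ij.1] at this
      exact (div_left_inj' hr.ne').1 this

theorem onBoundary_iff_cellProj {ij : Fin n × Fin n} {p : (P.cell n ij.1).PreBlock} :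
    (P.cell n ij.1).OnBoundary p ↔ cellProj ij p ∈ P.sectorGrid n := by
  rw [onBoundary_iff, onVerticalSide_iff_cellProj, onHorizontalSide_iff_cellProj]
  rfl

theorem inGrid_iff {p : P.PreGlued n} : InGrid p ↔ proj p ∈ P.sectorGrid n :=
  onBoundary_iff_cellProj

/-! ### The fibres of the projection. -/

theorem gluedEDist_comm (p q : P.PreGlued n) : P.gluedEDist n p q = P.gluedEDist n q p :=
  (P.gluedEDist_isPseudoEDist n).symm p q

theorem gluedEDist_tri (p q r : P.PreGlued n) :
    P.gluedEDist n p r ≤ P.gluedEDist n p q + P.gluedEDist n q r :=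
  (P.gluedEDist_isPseudoEDist n).tri p q r

theorem gluedEDist_trans_zero {p q r : P.PreGlued n} (h1 : P.gluedEDist n p q = 0)
    (h2 : P.gluedEDist n q r = 0) : P.gluedEDist n p r = 0 :=
  le_antisymm ((gluedEDist_tri p q r).trans (by rw [h1, h2, add_zero])) bot_le

theorem gluedEDist_eq_zero_of_cellGlue {p q : P.PreGlued n} (h : P.CellGlue n p q) :
    P.gluedEDist n p q = 0 :=
  glueEDist_eq_zero_of_rel (P.preGluedEDist_isPseudoEDist n) h

theorem scaled_a (i : Fin n) : ((P.cell n i).a + (P.cell n i).ε) / (P.cell n i).a =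
    P.gridRadius n (i + 1) / P.gridRadius n i := by
  have h1 := (angleStep_pos (P := P) i).ne'
  rw [← gridRadius_succ_mul, ← gridRadius_mul, mul_div_mul_right _ _ h1]

/-- Glued points of adjacent blocks have the same image in the sector and lie on the grid. -/
theorem proj_eq_of_cellGlue (hB : ∀ i, (P.cell n i).BlockExists) {p q : P.PreGlued n}
    (h : P.CellGlue n p q) : proj p = proj q ∧ InGrid p ∧ InGrid q := by
  obtain ⟨⟨i, j⟩, p⟩ := p
  obtain ⟨⟨i', j'⟩, q⟩ := q
  have hr := gridRadius_pos (P := P) (n := n) i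
  have hr' := gridRadius_pos (P := P) (n := n) i'
  rcases h with ⟨h1, h2, s, h3, h4⟩ | ⟨h1, h2, t, h3, h4⟩
  · simp only at h1 h2 h3 h4
    subst h2
    refine ⟨?_, onBoundary_iff.2 (Or.inl (Or.inr ⟨s, h3⟩)),
      onBoundary_iff.2 (Or.inl (Or.inl ⟨s, h4⟩))⟩
    rw [(hB i).isRight_iff, scaled_a, ← h1] at h3
    rw [(hB i').isLeft_iff] at h4
    refine sector_ext ?_ ?_
    · change (cellProj (i, j') p).1.1 = (cellProj (i', j') q).1.1
      rw [cellProj_fst, cellProj_fst, h3.1, h4.1, cell_b, add_zero, h1, gridRadius_succ]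
    · change (cellProj (i, j') p).1.2 = (cellProj (i', j') q).1.2
      rw [cellProj_snd, cellProj_snd, ← h4.2, h3.2]
      field_simp
  · simp only at h1 h2 h3 h4
    subst h1
    refine ⟨?_, onBoundary_iff.2 (Or.inr (Or.inr ⟨t, h3⟩)),
      onBoundary_iff.2 (Or.inr (Or.inl ⟨t, h4⟩))⟩
    rw [isTop_iff] at h3
    rw [isBottom_iff] at h4
    refine sector_ext ?_ ?_
    · change (cellProj (i', j) p).1.1 = (cellProj (i', j') q).1.1
      rw [cellProj_fst, cellProj_fst, h3.2, h4.2]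
    · change (cellProj (i', j) p).1.2 = (cellProj (i', j') q).1.2
      rw [cellProj_snd, cellProj_snd, h3.1, h4.1, zero_div, add_zero, cell_a_div, h2,
        gridAngle_succ]

/-- The generated equivalence relation is reflexive at interior points too, so the grid statement
needs the alternative `p = q`. -/
theorem eq_or_proj_eq_of_eqvGen (hB : ∀ i, (P.cell n i).BlockExists) {p q : P.PreGlued n}
    (h : Relation.EqvGen (P.CellGlue n) p q) :
    p = q ∨ (proj p = proj q ∧ InGrid p ∧ InGrid q) := by
  induction h with
  | rel p q h => exact Or.inr (proj_eq_of_cellGlue hB h)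
  | refl p => exact Or.inl rfl
  | symm p q _ ih => exact ih.imp Eq.symm fun h => ⟨h.1.symm, h.2.2, h.2.1⟩
  | trans p q r _ _ ih ih' =>
    rcases ih with rfl | h
    · exact ih'
    · rcases ih' with rfl | h'
      · exact Or.inr h
      · exact Or.inr ⟨h.1.trans h'.1, h.2.1, h'.2.2⟩

theorem gluedEDist_eq_zero_same {ij : Fin n × Fin n} {p q : (P.cell n ij.1).PreBlock}
    (h : cellProj ij p = cellProj ij q) : P.gluedEDist n (inCell ij p) (inCell ij q) = 0 := by
  refine le_antisymm ((P.gluedEDist_same_le n ij p q).trans_eq ?_) bot_le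
  obtain ⟨h1, h2⟩ := cellProj_eq_iff.1 h
  obtain ⟨h3, h4⟩ := cellProj_eq_iff.1 (rfl : cellProj ij q = cellProj ij q)
  exact blockEDist_eq_zero_of_vert_eq (h1.trans h3.symm) (h2.trans h4.symm)

/-- The two columns share only the radius `rᵢ₊₁`, so `p` is on the right side and `q` on the left
side. Equal angles at this common radius mean equal arclengths, which is the gluing condition. -/
theorem gluedEDist_eq_zero_right (hB : ∀ i, (P.cell n i).BlockExists) {i i' j : Fin n}
    (hi : (i' : ℕ) = i + 1) {p : (P.cell n i).PreBlock} {q : (P.cell n i').PreBlock}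
    (h : cellProj (i, j) p = cellProj (i', j) q) :
    P.gluedEDist n (inCell (i, j) p) (inCell (i', j) q) = 0 := by
  have hr := gridRadius_pos (P := P) (n := n) i
  have hr' := gridRadius_pos (P := P) (n := n) i'
  have h1 : (cellProj (i, j) p).1.1 = (cellProj (i', j) q).1.1 := by rw [h]
  have h2 : (cellProj (i, j) p).1.2 = (cellProj (i', j) q).1.2 := by rw [h]
  have hx := p.2.2.1.2
  have hx' := q.2.2.1.1
  rw [cellProj_fst, cellProj_fst] at h1
  rw [cellProj_snd, cellProj_snd] at h2
  simp only [hi] at h1 h2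
  rw [gridRadius_succ] at h1
  rw [cell_b] at hx
  refine gluedEDist_eq_zero_of_cellGlue (Or.inl ⟨hi, rfl, (P.cell n i').vert q, ?_, ?_⟩)
  · refine (hB i).isRight_iff.2 ⟨?_, ?_⟩
    · rw [cell_b]
      change p.2.1 0 = _
      linarith
    · rw [scaled_a]
      change _ = _ * (P.cell n i).vert p
      rw [← hi] at h2 ⊢
      have : (P.cell n i).vert p / P.gridRadius n i = (P.cell n i').vert q / P.gridRadius n i' := by
        linarith
      rw [div_mul_eq_mul_div, mul_div_assoc, this]
      field_simp
  · refine (hB i').isLeft_iff.2 ⟨?_, rfl⟩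
    change q.2.1 0 = 0
    linarith

theorem gluedEDist_eq_zero_up {i j j' : Fin n} (hj : (j' : ℕ) = j + 1)
    {p q : (P.cell n i).PreBlock} (h : cellProj (i, j) p = cellProj (i, j') q) :
    P.gluedEDist n (inCell (i, j) p) (inCell (i, j') q) = 0 := by
  have hr := gridRadius_pos (P := P) (n := n) i
  have h1 : (cellProj (i, j) p).1.1 = (cellProj (i, j') q).1.1 := by rw [h]
  have h2 : (cellProj (i, j) p).1.2 = (cellProj (i, j') q).1.2 := by rw [h]
  have hv := (vert_div_mem i p).2
  have hv' := (vert_div_mem i q).1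
  rw [cellProj_fst, cellProj_fst] at h1
  rw [cellProj_snd, cellProj_snd] at h2
  simp only [hj] at h1 h2
  rw [gridAngle_succ] at h2
  refine gluedEDist_eq_zero_of_cellGlue (Or.inr ⟨rfl, hj, p.2.1 0, ?_, ?_⟩)
  · refine isTop_iff.2 ⟨?_, rfl⟩
    change (P.cell n i).vert p = _
    have : (P.cell n i).vert p / P.gridRadius n i = (P.cell n i).a / P.gridRadius n i := by
      rw [cell_a_div]
      linarith
    exact (div_left_inj' hr.ne').1 this
  · refine isBottom_iff.2 ⟨?_, ?_⟩
    · change (P.cell n i).vert q = 0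
      have : (P.cell n i).vert q / P.gridRadius n i = 0 := by linarith
      exact (div_eq_zero_iff.1 this).resolve_right hr.ne'
    · change q.2.1 0 = _
      linarith

theorem gridRadius_le_iff (hn : 0 < n) {k l : ℕ} :
    P.gridRadius n k ≤ P.gridRadius n l ↔ k ≤ l := by
  have hb := div_pos P.b_pos (Nat.cast_pos.2 hn : (0 : ℝ) < n)
  unfold gridRadius
  rw [add_le_add_iff_left, mul_le_mul_iff_left₀ hb, Nat.cast_le]

theorem gridAngle_le_iff (hn : 0 < n) {k l : ℕ} :
    P.gridAngle n k ≤ P.gridAngle n l ↔ k ≤ l := by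
  have hb := div_pos (div_pos P.ε_pos P.b_pos) (Nat.cast_pos.2 hn : (0 : ℝ) < n)
  unfold gridAngle
  rw [mul_le_mul_iff_left₀ hb, Nat.cast_le]

/-- Sub-sectors of one column that meet are equal or adjacent, because their angular intervals are
ordered. -/
theorem gluedEDist_eq_zero_column {i j j' : Fin n} {p q : (P.cell n i).PreBlock}
    (h : cellProj (i, j) p = cellProj (i, j') q) :
    P.gluedEDist n (inCell (i, j) p) (inCell (i, j') q) = 0 := by
  have m1 := (cellProj_mem (i, j) p).2
  have m2 := (cellProj_mem (i, j') q).2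
  rw [h] at m1
  have l1 := (gridAngle_le_iff i.pos).1 (m1.1.trans m2.2)
  have l2 := (gridAngle_le_iff i.pos).1 (m2.1.trans m1.2)
  simp only at l1 l2
  rcases lt_trichotomy (j : ℕ) j' with hj | hj | hj
  · exact gluedEDist_eq_zero_up (by omega) h
  · obtain rfl := Fin.ext hj
    exact gluedEDist_eq_zero_same h
  · rw [gluedEDist_comm]
    exact gluedEDist_eq_zero_up (by omega) h.symm

/-- Points of the disjoint union with the same image in the sector are identified. -/
theorem gluedEDist_eq_zero_of_proj_eq (hB : ∀ i, (P.cell n i).BlockExists) {p q : P.PreGlued n}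
    (h : proj p = proj q) : P.gluedEDist n p q = 0 := by
  have key : ∀ {i i' j j' : Fin n} {p : (P.cell n i).PreBlock} {q : (P.cell n i').PreBlock},
      (i : ℕ) ≤ i' → cellProj (i, j) p = cellProj (i', j') q →
      P.gluedEDist n (inCell (i, j) p) (inCell (i', j') q) = 0 := by
    intro i i' j j' p q hi h
    have m1 := cellProj_mem (i, j) p
    have m2 := cellProj_mem (i', j') q
    rw [h] at m1
    have l2 := (gridRadius_le_iff i.pos).1 (m2.1.1.trans m1.1.2)
    simp only at l2
    rcases hi.eq_or_lt with hi | hi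
    · obtain rfl := Fin.ext hi
      exact gluedEDist_eq_zero_column h
    -- The blocks may be only diagonally adjacent. The common image also lies in sub-sector `(i',
    -- j)`, so the identification goes through that block: first across columns, then within a
    -- column.
    · obtain ⟨m, hm⟩ := exists_cellProj_eq (ij := (i', j)) ⟨m2.1, m1.2⟩
      refine gluedEDist_trans_zero (q := inCell (i', j) m)
        (gluedEDist_eq_zero_right hB (by omega) (h.trans hm.symm)) (gluedEDist_eq_zero_column hm)
  obtain ⟨⟨i, j⟩, p⟩ := p
  obtain ⟨⟨i', j'⟩, q⟩ := q
  rcases le_total (i : ℕ) i' with hi | hi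
  · exact key hi h
  · exact (gluedEDist_comm _ _).trans (key hi h.symm)

/-- Corresponding sides of sub-sectors and blocks correspond under the projection. -/
theorem proj_eq_of_sideCorr (hB : ∀ i, (P.cell n i).BlockExists) {i j : Fin n} {y : P.Sector}
    {p : (P.cell n i).PreBlock} (h : P.SideCorr n i j y p) : cellProj (i, j) p = y := by
  have hr := gridRadius_pos (P := P) (n := n) i
  have hr' := gridRadius_pos (P := P) (n := n) (i + 1)
  rw [cellProj_eq_iff]
  rcases h with ⟨h1, h2⟩ | ⟨h1, h2⟩ | ⟨h1, h2⟩ | ⟨h1, h2⟩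
  · rw [(hB i).isLeft_iff] at h2
    exact ⟨by rw [h2.1, h1, sub_self], h2.2.symm⟩
  · rw [(hB i).isRight_iff, scaled_a] at h2
    refine ⟨by rw [h2.1, h1, gridRadius_succ, cell_b]; ring, ?_⟩
    have := h2.2
    field_simp at this
    linarith
  · rw [isBottom_iff] at h2
    exact ⟨h2.2, by rw [h2.1, h1, sub_self, mul_zero]⟩
  · rw [isTop_iff] at h2
    refine ⟨h2.2, ?_⟩
    rw [h2.1, h1, gridAngle_succ, add_sub_cancel_left, gridRadius_mul]

end DislocationParams

end

noncomputable section

namespace DislocationParams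

variable {P : DislocationParams} {n : ℕ}

/-! ### Comparison of the glued surface and the sector -/

theorem preGluedEDist_inCell {ij : Fin n × Fin n} (p q : (P.cell n ij.1).PreBlock) :
    P.preGluedEDist n (inCell ij p) (inCell ij q) = (P.cell n ij.1).blockEDist p q :=
  sigmaEDist_same (X := fun ij : Fin n × Fin n => (P.cell n ij.1).PreBlock)
    (fun ij => (P.cell n ij.1).blockEDist) ij p q

/-- If the projection of every block to the sector is `K`-Lipschitz on the boundary, then so is the
projection of the glued surface on the grid. -/
theorem edist_proj_le_mul_gluedEDist (hB : ∀ i, (P.cell n i).BlockExists) {K : ℝ} (hK : 0 < K)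
    (hcell : ∀ (ij : Fin n × Fin n) (p q : (P.cell n ij.1).PreBlock),
      (P.cell n ij.1).OnBoundary p → (P.cell n ij.1).OnBoundary q →
      dist (cellProj ij p) (cellProj ij q) ≤ K * (P.cell n ij.1).blockDist p q)
    {p q : P.PreGlued n} (hp : InGrid p) (hq : InGrid q) :
    edist (proj p) (proj q) ≤ ENNReal.ofReal K * P.gluedEDist n p q := by
  have hK0 : ENNReal.ofReal K ≠ 0 := (ENNReal.ofReal_pos.2 hK).ne'
  have hpre : ∀ u w : P.PreGlued n, InGrid u → InGrid w →
      edist (proj u) (proj w) ≤ ENNReal.ofReal K * P.preGluedEDist n u w := by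
    rintro ⟨ij, u⟩ ⟨kl, w⟩ hu hw
    by_cases h : ij = kl
    · subst h
      change edist (cellProj ij u) (cellProj ij w) ≤
        _ * P.preGluedEDist n (inCell ij u) (inCell ij w)
      rw [preGluedEDist_inCell, edist_dist, ← ofReal_blockDist, ← ENNReal.ofReal_mul hK.le]
      exact ENNReal.ofReal_le_ofReal (hcell ij u w hu hw)
    · have e : P.preGluedEDist n (inCell ij u) (inCell kl w) = ⊤ := dif_neg h
      change _ ≤ _ * P.preGluedEDist n (inCell ij u) (inCell kl w)
      rw [e, ENNReal.mul_top hK0]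
      exact le_top
  -- The induction carries the last grid point `u` and the distance already travelled from `u` to
  -- the start `x` of the remaining chain, since `x` may be interior to a block, where the
  -- hypothesis gives nothing.
  have key : ∀ x w c, ChainLength (P.preGluedEDist n) (P.CellGlue n) x w c → InGrid w →
      ∀ u, InGrid u → edist (proj u) (proj w) ≤
        ENNReal.ofReal K * (P.preGluedEDist n u x + c) := by
    intro x w c h
    induction h with
    | single x w =>
      intro hw u hu
      refine (hpre u w hu hw).trans (mul_le_mul_right ?_ _)
      exact (P.preGluedEDist_isPseudoEDist n).tri u x w
    | cons x y z w c hR _ ih =>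
      intro hw u hu
      have tri := (P.preGluedEDist_isPseudoEDist n).tri u x y
      rcases eq_or_proj_eq_of_eqvGen hB hR with rfl | ⟨h1, h2, h3⟩
      -- A trivial identification: the step is absorbed into the distance from `u`. In the other
      -- case both `y` and `z` are grid points with the same image, so the count restarts at `z`.
      · refine (ih hw u hu).trans (mul_le_mul_right ?_ _)
        rw [← add_assoc]
        exact add_le_add_left tri _
      · have h4 := ih hw z h3
        rw [(P.preGluedEDist_isPseudoEDist n).self, zero_add, ← h1] at h4
        refine (edist_triangle _ (proj y) _).trans ((add_le_add (hpre u y hu h2) h4).trans ?_)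
        rw [← mul_add, ← add_assoc]
        exact mul_le_mul_right (add_le_add_left tri _) _
  have : edist (proj p) (proj q) / ENNReal.ofReal K ≤ P.gluedEDist n p q := by
    refine le_sInf fun c hc => ENNReal.div_le_of_le_mul' ?_
    have := key p q c hc hq p hp
    rwa [(P.preGluedEDist_isPseudoEDist n).self, zero_add] at this
  rwa [ENNReal.div_le_iff_le_mul (Or.inl hK0) (Or.inl ENNReal.ofReal_ne_top), mul_comm] at this

/-! ### From curves in the sector to chains of grid points. -/

theorem mem_sectorGrid_of_mem_subSector {ij kl : Fin n × Fin n} (h : ij ≠ kl) {y : P.Sector}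
    (h1 : y ∈ P.subSector n ij) (h2 : y ∈ P.subSector n kl) : y ∈ P.sectorGrid n := by
  have hn := ij.1.pos
  have vert : ∀ {ij kl : Fin n × Fin n}, (ij.1 : ℕ) < kl.1 → y ∈ P.subSector n ij →
      y ∈ P.subSector n kl → y ∈ P.sectorGrid n := fun {ij kl} h h1 h2 =>
    Or.inl ⟨kl.1, kl.1.2.le,
      le_antisymm (h1.1.2.trans ((gridRadius_le_iff hn).2 h)) h2.1.1⟩
  have horiz : ∀ {ij kl : Fin n × Fin n}, (ij.2 : ℕ) < kl.2 → y ∈ P.subSector n ij →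
      y ∈ P.subSector n kl → y ∈ P.sectorGrid n := fun {ij kl} h h1 h2 =>
    Or.inr ⟨kl.2, kl.2.2.le,
      le_antisymm (h1.2.2.trans ((gridAngle_le_iff hn).2 h)) h2.2.1⟩
  rcases lt_trichotomy (ij.1 : ℕ) kl.1 with hi | hi | hi
  · exact vert hi h1 h2
  · rcases lt_trichotomy (ij.2 : ℕ) kl.2 with hj | hj | hj
    · exact horiz hj h1 h2
    · exact absurd (Prod.ext (Fin.ext hi) (Fin.ext hj)) h
    · exact horiz hj h2 h1
  · exact vert hi h2 h1

theorem exists_onBoundary_cellProj_eq {ij : Fin n × Fin n} {y : P.Sector}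
    (h1 : y ∈ P.subSector n ij) (h2 : y ∈ P.sectorGrid n) :
    ∃ p, (P.cell n ij.1).OnBoundary p ∧ cellProj ij p = y := by
  obtain ⟨p, rfl⟩ := exists_cellProj_eq h1
  exact ⟨p, onBoundary_iff_cellProj.2 h2, rfl⟩

/-- A curve in the sector between grid points is replaced by a chain of grid points, leaving each
of the sub-sectors at most once. -/
theorem gluedEDist_le_mul_eVariationOn (hB : ∀ i, (P.cell n i).BlockExists) {K : ℝ≥0∞}
    (hcell : ∀ (ij : Fin n × Fin n) (p q : (P.cell n ij.1).PreBlock),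
      (P.cell n ij.1).OnBoundary p → (P.cell n ij.1).OnBoundary q →
      (P.cell n ij.1).blockEDist p q ≤
        K * edist (polar (cellProj ij p).1) (polar (cellProj ij q).1))
    (f : unitInterval → P.Sector) (hf1 : Continuous fun t => (f t).1.1)
    (hf2 : Continuous fun t => (f t).1.2) {q : P.PreGlued n} (hq : InGrid q) (hq1 : proj q = f 1)
    (S : Finset (Fin n × Fin n)) (t : unitInterval) (p : P.PreGlued n) (hp : InGrid p)
    (hpt : proj p = f t) (hS : ∀ s, t ≤ s → ∃ c ∈ S, f s ∈ P.subSector n c) :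
    P.gluedEDist n p q ≤ K * eVariationOn (fun s => polar (f s).1) (Icc t 1) := by
  induction S using Finset.strongInduction generalizing t p with
  | H S ih =>
    have closed : ∀ c, IsClosed {s | f s ∈ P.subSector n c} := fun c =>
      (isClosed_Icc.preimage hf1).inter (isClosed_Icc.preimage hf2)
    obtain ⟨c, hc, htc⟩ := hS t le_rfl
    have hpg := inGrid_iff.1 hp
    rw [hpt] at hpg
    -- The point `p` may represent `f t` in another block; it is replaced by a representative in
    -- block `c` at distance `0`.
    obtain ⟨p', hp', hp't⟩ := exists_onBoundary_cellProj_eq htc hpg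
    have z1 : P.gluedEDist n p (inCell c p') = 0 :=
      gluedEDist_eq_zero_of_proj_eq hB (hpt.trans hp't.symm)
    have step : ∀ s, t ≤ s → ∀ w, (P.cell n c.1).OnBoundary w → cellProj c w = f s →
        P.gluedEDist n p (inCell c w) ≤
          K * eVariationOn (fun s => polar (f s).1) (Icc t s) := by
      intro s hs w hw hws
      refine (gluedEDist_tri _ (inCell c p') _).trans ?_
      rw [z1, zero_add]
      refine (P.gluedEDist_same_le n c p' w).trans ((hcell c p' w hp' hw).trans ?_)
      rw [hp't, hws]
      exact mul_le_mul_right (eVariationOn.edist_le (fun s => polar (f s).1)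
        (left_mem_Icc.2 hs) (right_mem_Icc.2 hs)) _
    -- The last time at which the curve is in `c`. Excursions from `c` before `s` are ignored, and
    -- afterwards `c` can be dropped from the list, which makes the induction finite.
    obtain ⟨s, ⟨hsc, hts⟩, hmax⟩ := ((closed c).inter isClosed_Ici).isCompact.exists_isGreatest
      ⟨t, htc, (le_rfl : t ≤ t)⟩
    have hts : t ≤ s := hts
    rcases eq_or_ne s 1 with rfl | hs1
    · have hqg := inGrid_iff.1 hq
      rw [hq1] at hqg
      obtain ⟨q', hq', hq't⟩ := exists_onBoundary_cellProj_eq hsc hqg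
      have z2 : P.gluedEDist n (inCell c q') q = 0 :=
        gluedEDist_eq_zero_of_proj_eq hB (hq't.trans hq1.symm)
      refine (gluedEDist_tri _ (inCell c q') _).trans ?_
      rw [z2, add_zero]
      exact step 1 hts q' hq' hq't
    · have hs1' : s < 1 := lt_of_le_of_ne (show s ≤ 1 from s.2.2) hs1
      have hcl : IsClosed (⋃ c' ∈ S.erase c, {s | f s ∈ P.subSector n c'}) :=
        (S.erase c).finite_toSet.isClosed_biUnion fun c' _ => closed c'
      have hIoi : Ioi s ⊆ ⋃ c' ∈ S.erase c, {s | f s ∈ P.subSector n c'} := by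
        intro r hr
        obtain ⟨c', hc', hrc'⟩ := hS r (hts.trans (le_of_lt hr))
        refine mem_iUnion₂.2 ⟨c', Finset.mem_erase.2 ⟨?_, hc'⟩, hrc'⟩
        rintro rfl
        exact absurd (hmax ⟨hrc', hts.trans (le_of_lt hr)⟩) (not_le.2 hr)
      -- The remaining sub-sectors are closed and finite in number, so they also cover time `s`.
      -- Thus `f s` lies in two different sub-sectors and is a grid point.
      have hIci : Ici s ⊆ ⋃ c' ∈ S.erase c, {s | f s ∈ P.subSector n c'} := by
        rw [← closure_Ioi' (⟨1, hs1'⟩ : (Ioi s).Nonempty)]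
        exact closure_minimal hIoi hcl
      have hS' : ∀ r, s ≤ r → ∃ c' ∈ S.erase c, f r ∈ P.subSector n c' := by
        intro r hr
        obtain ⟨c', hc', h⟩ := mem_iUnion₂.1 (hIci hr)
        exact ⟨c', hc', h⟩
      obtain ⟨c', hc', hsc'⟩ := hS' s le_rfl
      have hsg : f s ∈ P.sectorGrid n :=
        mem_sectorGrid_of_mem_subSector (Finset.ne_of_mem_erase hc').symm hsc hsc'
      obtain ⟨w, hw, hws⟩ := exists_onBoundary_cellProj_eq hsc hsg
      refine (gluedEDist_tri _ (inCell c w) _).trans ((add_le_add (step s hts w hw hws)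
        (ih _ (Finset.erase_ssubset hc) s (inCell c w) hw hws hS')).trans_eq ?_)
      rw [← mul_add]
      congr 1
      have := eVariationOn.Icc_add_Icc (fun s => polar (f s).1) hts (show s ≤ 1 from s.2.2)
        (mem_univ s)
      simpa only [univ_inter] using this

/-- If the chords in the sub-sectors control the block distances on the boundary, then the distance
in the sector controls the gluing distance on the grid. -/
theorem gluedEDist_le_mul_edist_proj (hB : ∀ i, (P.cell n i).BlockExists) {K : ℝ} (hK : 0 < K)
    (hcell : ∀ (ij : Fin n × Fin n) (p q : (P.cell n ij.1).PreBlock),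
      (P.cell n ij.1).OnBoundary p → (P.cell n ij.1).OnBoundary q →
      (P.cell n ij.1).blockDist p q ≤
        K * dist (polar (cellProj ij p).1) (polar (cellProj ij q).1))
    {p q : P.PreGlued n} (hp : InGrid p) (hq : InGrid q) :
    P.gluedEDist n p q ≤ ENNReal.ofReal K * edist (proj p) (proj q) := by
  have hK0 : ENNReal.ofReal K ≠ 0 := (ENNReal.ofReal_pos.2 hK).ne'
  have hcell' : ∀ (ij : Fin n × Fin n) (p q : (P.cell n ij.1).PreBlock),
      (P.cell n ij.1).OnBoundary p → (P.cell n ij.1).OnBoundary q →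
      (P.cell n ij.1).blockEDist p q ≤
        ENNReal.ofReal K * edist (polar (cellProj ij p).1) (polar (cellProj ij q).1) := by
    intro ij p q hp hq
    rw [edist_dist, ← ENNReal.ofReal_mul hK.le, ← ofReal_blockDist]
    exact ENNReal.ofReal_le_ofReal (hcell ij p q hp hq)
  have main : ∀ x y : P.sectorSet, proj p = x → proj q = y →
      P.gluedEDist n p q / ENNReal.ofReal K ≤
        pathEDist (fun z : P.sectorSet => polar z.1) x y := by
    intro x y hx hy
    refine le_iInf fun γ => ENNReal.div_le_of_le_mul' ?_
    have h := gluedEDist_le_mul_eVariationOn hB hcell' (fun t => γ t)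
      (continuous_fst.comp (continuous_subtype_val.comp γ.continuous))
      (continuous_snd.comp (continuous_subtype_val.comp γ.continuous)) hq
      (hy.trans γ.target.symm) Finset.univ 0 p hp (hx.trans γ.source.symm)
      fun s _ => by
        obtain ⟨c, hc⟩ := exists_mem_subSector (P := P) p.1.1.pos (γ s)
        exact ⟨c, Finset.mem_univ c, hc⟩
    have e : (Icc 0 1 : Set unitInterval) = univ := eq_univ_of_forall fun s => ⟨s.2.1, s.2.2⟩
    rwa [e] at h
  have : P.gluedEDist n p q / ENNReal.ofReal K ≤ edist (proj p) (proj q) := main _ _ rfl rfl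
  rwa [ENNReal.div_le_iff_le_mul (Or.inl hK0) (Or.inl ENNReal.ofReal_ne_top), mul_comm] at this

/-- The point of the glued surface represented by a point of the disjoint union. -/
def mkGlued (p : P.PreGlued n) : P.Glued n := SeparationQuotient.mk p

theorem edist_mkGlued (p q : P.PreGlued n) :
    edist (mkGlued p) (mkGlued q) = P.gluedEDist n p q :=
  SeparationQuotient.edist_mk p q

theorem mkGlued_surjective (x : P.Glued n) : ∃ p, mkGlued p = x :=
  SeparationQuotient.surjective_mk x

theorem one_add_div_mul_le {x y m : ℝ} (hx : 0 ≤ x) (hy : 0 ≤ y) (hm : 1 ≤ m) :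
    (1 + x / m) * (1 + y / m) ≤ 1 + (x + y + x * y) / m := by
  have hm0 : 0 < m := one_pos.trans_le hm
  have h : x / m * (y / m) ≤ x * y / m := by
    rw [div_mul_div_comm]
    exact div_le_div_of_nonneg_left (mul_nonneg hx hy) hm0 (le_mul_of_one_le_left hm0.le hm)
  rw [add_div, add_div]
  linarith

variable (P) in
/-- On the grids, the distances of the glued surface and of the sector differ at most by factors
`1 + O(1 / n)`. -/
theorem exists_dist_bounds : ∃ C : ℝ, 0 ≤ C ∧ ∀ n : ℕ, (∀ i, (P.cell n i).BlockExists) →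
    ∀ p q : P.PreGlued n, InGrid p → InGrid q →
      dist (proj p) (proj q) ≤ (1 + C / n) * dist (mkGlued p) (mkGlued q) ∧
      (P.ε / P.b ≤ n →
        dist (mkGlued p) (mkGlued q) ≤ (1 + C / n) * dist (proj p) (proj q)) := by
  obtain ⟨C, hC, h⟩ := P.exists_blockDist_bounds
  have ha := P.a_pos
  have hb := P.b_pos
  have hε := P.ε_pos
  have n1 : 0 ≤ P.ε / P.a := by positivity
  have n2 : 0 ≤ P.ε / P.b := by positivity
  -- `A` and `B` come from multiplying the block estimate by the radial distortion `1 + ε / (a n)`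
  -- and by the chord distortion `1 + ε / (b n)`, respectively.
  set A := P.ε / P.a + C + P.ε / P.a * C with hA
  set B := C + P.ε / P.b + C * (P.ε / P.b) with hBd
  have hA0 : 0 ≤ A := by positivity
  have hB0 : 0 ≤ B := by positivity
  refine ⟨A + B, by positivity, ?_⟩
  intro n hB p q hp hq
  have hn := p.1.1.pos
  have hn' : (0 : ℝ) < n := Nat.cast_pos.2 hn
  have hn1 : (1 : ℝ) ≤ n := Nat.one_le_cast.2 hn
  have hK : 0 < 1 + (A + B) / n := by positivity
  have KA : 1 + A / n ≤ 1 + (A + B) / n := by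
    gcongr
    linarith
  have KB : 1 + B / n ≤ 1 + (A + B) / n := by
    gcongr
    linarith
  constructor
  · have := edist_proj_le_mul_gluedEDist hB hK ?_ hp hq
    · rw [← edist_mkGlued, edist_dist, edist_dist, ← ENNReal.ofReal_mul hK.le] at this
      exact (ENNReal.ofReal_le_ofReal_iff (by positivity)).1 this
    · intro ij p q hp hq
      refine (dist_cellProj_le ij p q).trans ?_
      refine (mul_le_mul_of_nonneg_left (h n ij.1 (hB _) p q hp hq).2 (by positivity)).trans ?_
      rw [← mul_assoc]
      exact mul_le_mul_of_nonneg_right ((one_add_div_mul_le n1 hC hn1).trans KA)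
        (blockDist_nonneg _ _ _)
  · intro hnb
    have := gluedEDist_le_mul_edist_proj hB hK ?_ hp hq
    · rw [← edist_mkGlued, edist_dist, edist_dist, ← ENNReal.ofReal_mul hK.le] at this
      exact (ENNReal.ofReal_le_ofReal_iff (by positivity)).1 this
    · intro ij p q hp hq
      refine (h n ij.1 (hB _) p q hp hq).1.trans ?_
      refine (mul_le_mul_of_nonneg_left (dist_flat_le_mul_dist_polar hnb ij p q)
        (by positivity)).trans ?_
      rw [← mul_assoc]
      exact mul_le_mul_of_nonneg_right ((one_add_div_mul_le hC n2 hn1).trans KB) dist_nonneg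

variable (P) in
/-- On the grids, the distances of the glued surface and of the sector differ by `O(1 / n)`. -/
theorem exists_distortion_bound : ∃ C : ℝ, 0 ≤ C ∧ ∀ n : ℕ, (∀ i, (P.cell n i).BlockExists) →
    ∀ p q : P.PreGlued n, InGrid p → InGrid q →
      |dist (proj p) (proj q) - dist (mkGlued p) (mkGlued q)| ≤ C / n := by
  obtain ⟨C, hC, h⟩ := P.exists_dist_bounds
  set D := Metric.diam (univ : Set P.Sector)
  have hD0 : 0 ≤ D := Metric.diam_nonneg
  have hD : ∀ y z : P.Sector, dist y z ≤ D := fun y z =>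
    Metric.dist_le_diam_of_mem isCompact_univ.isBounded (mem_univ y) (mem_univ z)
  -- For the finitely many `n < ε / b` only one of the two estimates is known; there the difference
  -- is bounded by the two diameters, and the factor `n` cancels the division by `n`.
  let G : ℕ → ℝ := fun n => n * (D + Metric.diam (univ : Set (P.Glued n)))
  have hG : ∀ n, 0 ≤ G n := fun n =>
    mul_nonneg (Nat.cast_nonneg n) (add_nonneg hD0 Metric.diam_nonneg)
  obtain ⟨N, hN⟩ := exists_nat_gt (P.ε / P.b)
  have hsum : 0 ≤ ∑ k ∈ Finset.range N, G k := Finset.sum_nonneg fun k _ => hG k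
  -- Sector distances are at most `D`, hence glued distances at most `D + C D`; each is multiplied
  -- by its relative error `C / n`.
  set C' := C * D + C * (D + C * D) with hC'
  have hC'0 : 0 ≤ C' := by positivity
  refine ⟨C' + ∑ k ∈ Finset.range N, G k, by positivity, ?_⟩
  intro n hB p q hp hq
  have hn := p.1.1.pos
  have hn' : (0 : ℝ) < n := Nat.cast_pos.2 hn
  have hn1 : (1 : ℝ) ≤ n := Nat.one_le_cast.2 hn
  obtain ⟨h1, h2⟩ := h n hB p q hp hq
  have hd := hD (proj p) (proj q)
  have hd0 : 0 ≤ dist (proj p) (proj q) := dist_nonneg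
  have he0 : 0 ≤ dist (mkGlued p) (mkGlued q) := dist_nonneg
  rcases le_or_gt (P.ε / P.b) n with hnb | hnb
  · have h2 := h2 hnb
    refine le_trans ?_ (div_le_div_of_nonneg_right (le_add_of_nonneg_right hsum) hn'.le)
    have hCn : 0 ≤ C / n := by positivity
    have hCn1 : C / n ≤ C := div_le_self hC hn1
    have h3 : C / n * dist (proj p) (proj q) ≤ C / n * D := mul_le_mul_of_nonneg_left hd hCn
    have h4 : C / n * D ≤ C * D := mul_le_mul_of_nonneg_right hCn1 hD0
    have h5 : dist (mkGlued p) (mkGlued q) ≤ D + C * D := by linarith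
    have h6 : C / n * dist (mkGlued p) (mkGlued q) ≤ C / n * (D + C * D) :=
      mul_le_mul_of_nonneg_left h5 hCn
    have h7 : C' / n = C / n * D + C / n * (D + C * D) := by
      rw [hC']
      ring
    have h8 : 0 ≤ C / n * D := by positivity
    have h9 : 0 ≤ C / n * (D + C * D) := by positivity
    rw [h7, abs_le]
    constructor <;> linarith
  · have hnN : n ∈ Finset.range N := Finset.mem_range.2 (by exact_mod_cast hnb.trans hN)
    have h3 : G n ≤ ∑ k ∈ Finset.range N, G k :=
      Finset.single_le_sum (fun k _ => hG k) hnN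
    have h4 : dist (mkGlued p) (mkGlued q) ≤ Metric.diam (univ : Set (P.Glued n)) :=
      Metric.dist_le_diam_of_mem isCompact_univ.isBounded (mem_univ _) (mem_univ _)
    rw [le_div_iff₀ hn']
    have h5 : |dist (proj p) (proj q) - dist (mkGlued p) (mkGlued q)| ≤
        D + Metric.diam (univ : Set (P.Glued n)) := by
      rw [abs_le]
      constructor <;> linarith
    have h6 := mul_le_mul_of_nonneg_right h5 hn'.le
    have h7 : G n = (D + Metric.diam (univ : Set (P.Glued n))) * n := mul_comm _ _
    linarith

/-! ### Nets -/

theorem exists_sectorVertices_dist_le (hn : 0 < n) (y : P.Sector) :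
    ∃ v ∈ P.sectorVertices n,
      dist y v ≤ (P.b + (P.innerRadius + P.b) * (P.ε / P.b)) / n := by
  obtain ⟨⟨i, j⟩, ⟨i1, i2⟩, j1, j2⟩ := exists_mem_subSector hn y
  have hR := P.innerRadius_pos
  have hb := P.b_pos
  rw [gridRadius_succ] at i2
  rw [gridAngle_succ] at j2
  let v : P.Sector := ⟨(P.gridRadius n i, P.gridAngle n j),
    ⟨le_gridRadius _, gridRadius_le i.2.le⟩, gridAngle_nonneg _, gridAngle_le j.2.le⟩
  have v1 : v.1.1 = P.gridRadius n i := rfl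
  have v2 : v.1.2 = P.gridAngle n j := rfl
  refine ⟨v, ⟨⟨i, i.2.le, rfl⟩, ⟨j, j.2.le, rfl⟩⟩, ?_⟩
  refine (P.dist_sector_le y.2.1.2 v.2.1.2).trans ?_
  have hd1 : |y.1.1 - v.1.1| ≤ P.b / n := by
    rw [v1, abs_of_nonneg (sub_nonneg.2 i1)]
    linarith
  have hd2 : |(P.innerRadius + P.b) * (y.1.2 - v.1.2)| ≤
      (P.innerRadius + P.b) * (P.ε / P.b / n) := by
    rw [v2, abs_mul, abs_of_nonneg (sub_nonneg.2 j1), abs_of_pos (by positivity)]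
    exact mul_le_mul_of_nonneg_left (by linarith) (by positivity)
  have hs : √((y.1.1 - v.1.1) ^ 2 + ((P.innerRadius + P.b) * (y.1.2 - v.1.2)) ^ 2) ≤
      |y.1.1 - v.1.1| + |(P.innerRadius + P.b) * (y.1.2 - v.1.2)| := by
    refine Real.sqrt_le_iff.2 ⟨by positivity, ?_⟩
    rw [← sq_abs (y.1.1 - v.1.1), ← sq_abs ((P.innerRadius + P.b) * (y.1.2 - v.1.2))]
    nlinarith [abs_nonneg (y.1.1 - v.1.1), abs_nonneg ((P.innerRadius + P.b) * (y.1.2 - v.1.2))]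
  refine hs.trans ((add_le_add hd1 hd2).trans_eq ?_)
  ring

theorem exists_gluedVertices_dist_le (x : P.Glued n) :
    ∃ v ∈ P.gluedVertices n,
      dist x v ≤ (2 + Real.tan P.θ) * (P.b + (P.a + P.ε)) / n := by
  obtain ⟨⟨⟨i, j⟩, s, v⟩, rfl⟩ := mkGlued_surjective x
  have hT := P.tan_pos
  have hn := natCast_pos_of_fin i
  have hb := (P.cell n i).b_pos
  have ha := (P.cell n i).a_pos
  have hε := (P.cell n i).ε_pos
  -- The origin of a hexagon is a corner of the block: `B` for the lower and `A` for the upper one.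
  -- Staying in the hexagon of the point makes the crude Lipschitz bound applicable.
  let w : (P.cell n i).hexagon := (P.cell n i).hexPoint (x := 0) (y := 0) ⟨le_rfl, hb.le⟩
    ⟨le_rfl, ((P.cell n i).height_pos 0).le⟩
  refine ⟨P.toGlued n i j ⟨s, w⟩, ⟨i, j, ⟨s, w⟩, rfl, onVerticalSide_iff.2 (Or.inl rfl),
    onHorizontalSide_iff.2 (vert_eq_zero_or_iff.2 rfl)⟩, ?_⟩
  have h1 : edist (mkGlued (inCell (i, j) ⟨s, v⟩)) (mkGlued (inCell (i, j) ⟨s, w⟩)) ≤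
      ENNReal.ofReal (2 + Real.tan P.θ) * edist v w := by
    rw [edist_mkGlued]
    exact (P.gluedEDist_same_le n (i, j) ⟨s, v⟩ ⟨s, w⟩).trans ((P.cell n i).blockEDist_le s v w)
  rw [edist_dist, edist_dist, ← ENNReal.ofReal_mul (by positivity)] at h1
  refine ((ENNReal.ofReal_le_ofReal_iff (by positivity)).1 h1).trans ?_
  rw [mul_div_assoc]
  refine mul_le_mul_of_nonneg_left ?_ (by positivity)
  refine (euclid_dist_le v.1 w.1).trans ?_
  obtain ⟨⟨x0, x1⟩, y0, y1⟩ := v.2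
  have h2 := (P.cell n i).height_le (v.1 0)
  have h3 := cell_a_add_ε_le (P := P) i
  change |v.1 0 - 0| + |v.1 1 - 0| ≤ _
  rw [sub_zero, sub_zero, abs_of_nonneg x0, abs_of_nonneg y0, add_div]
  rw [cell_b] at x1
  linarith

/-! ### The natural map between the grids -/

theorem finite_sectorVertices (n : ℕ) : (P.sectorVertices n).Finite := by
  have h1 : ((P.gridRadius n '' Iic n) ×ˢ (P.gridAngle n '' Iic n)).Finite :=
    ((finite_Iic n).image _).prod ((finite_Iic n).image _)
  refine (h1.preimage (f := fun y : P.Sector => y.1) Subtype.val_injective.injOn).subset ?_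
  rintro y ⟨⟨i, hi, h⟩, j, hj, h'⟩
  exact ⟨⟨i, hi, h.symm⟩, ⟨j, hj, h'.symm⟩⟩

theorem exists_inGrid_proj_eq (hn : 0 < n) {y : P.Sector} (hy : y ∈ P.sectorGrid n) :
    ∃ p : P.PreGlued n, InGrid p ∧ proj p = y := by
  obtain ⟨ij, hij⟩ := exists_mem_subSector hn y
  obtain ⟨p, hp, h⟩ := exists_onBoundary_cellProj_eq hij hy
  exact ⟨inCell ij p, hp, h⟩

variable (P) in
/-- The natural map from the grid of the sector to the grid of the glued surface. -/
def gridMap (n : ℕ+) (y : P.Sector) : P.Glued n :=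
  open Classical in
  if h : ∃ p : P.PreGlued n, InGrid p ∧ proj p = y then mkGlued h.choose
  else Classical.arbitrary _

/-- The chosen representative does not matter, since points with the same image are at gluing
distance `0`; this is the well-definedness of `Tₙ`. -/
theorem gridMap_proj {n : ℕ+} (hB : ∀ i, (P.cell n i).BlockExists) {p : P.PreGlued n}
    (hp : InGrid p) : P.gridMap n (proj p) = mkGlued p := by
  have h : ∃ q : P.PreGlued n, InGrid q ∧ proj q = proj p := ⟨p, hp, rfl⟩
  rw [gridMap, dif_pos h]
  refine eq_of_edist_eq_zero ?_
  rw [edist_mkGlued]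
  exact gluedEDist_eq_zero_of_proj_eq hB h.choose_spec.2

/-- Injectivity is metric: the bound of sector distances by glued distances shows that grid points
at gluing distance `0` have the same image in the sector. Only this half of the comparison, valid
for every `n`, is used. -/
theorem bijOn_gridMap {n : ℕ+} (hB : ∀ i, (P.cell n i).BlockExists) :
    BijOn (P.gridMap n) (P.sectorGrid n) (P.gluedGrid n) := by
  obtain ⟨C, -, hC⟩ := P.exists_dist_bounds
  refine ⟨?_, ?_, ?_⟩
  · intro y hy
    obtain ⟨⟨⟨i, j⟩, p⟩, hp, rfl⟩ := exists_inGrid_proj_eq n.pos hy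
    exact ⟨i, j, p, gridMap_proj hB hp, onBoundary_iff.1 hp⟩
  · intro y hy z hz h
    obtain ⟨p, hp, rfl⟩ := exists_inGrid_proj_eq n.pos hy
    obtain ⟨q, hq, rfl⟩ := exists_inGrid_proj_eq n.pos hz
    rw [gridMap_proj hB hp, gridMap_proj hB hq] at h
    have h1 := (hC n hB p q hp hq).1
    rw [h, dist_self, mul_zero] at h1
    exact dist_le_zero.1 h1
  · rintro x ⟨i, j, p, rfl, hp⟩
    have hp' : InGrid (inCell (i, j) p) := onBoundary_iff.2 hp
    exact ⟨proj (inCell (i, j) p), inGrid_iff.1 hp', gridMap_proj hB hp'⟩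

theorem sectorVertices_subset (n : ℕ) : P.sectorVertices n ⊆ P.sectorGrid n :=
  fun _ hy => Or.inl hy.1

theorem bijOn_gridMap_vertices {n : ℕ+} (hB : ∀ i, (P.cell n i).BlockExists) :
    BijOn (P.gridMap n) (P.sectorVertices n) (P.gluedVertices n) := by
  refine ⟨?_, (bijOn_gridMap hB).injOn.mono (sectorVertices_subset n), ?_⟩
  · intro y hy
    obtain ⟨⟨⟨i, j⟩, p⟩, hp, rfl⟩ := exists_inGrid_proj_eq n.pos (sectorVertices_subset n hy)
    exact ⟨i, j, p, gridMap_proj hB hp, onVerticalSide_iff_cellProj.2 hy.1,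
      onHorizontalSide_iff_cellProj.2 hy.2⟩
  · rintro x ⟨i, j, p, rfl, hp⟩
    have hp' : InGrid (inCell (i, j) p) := onBoundary_iff.2 (Or.inl hp.1)
    exact ⟨proj (inCell (i, j) p), ⟨onVerticalSide_iff_cellProj.1 hp.1,
      onHorizontalSide_iff_cellProj.1 hp.2⟩, gridMap_proj hB hp'⟩

theorem gridMap_eq_of_sideCorr {n : ℕ+} (hB : ∀ i, (P.cell n i).BlockExists) {i j : Fin n}
    {y : P.Sector} {p : (P.cell n i).PreBlock} (h : P.SideCorr n i j y p) :
    P.gridMap n y = P.toGlued n i j p := by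
  have hp : InGrid (inCell (i, j) p) := by
    rcases h with h | h | h | h
    · exact onBoundary_iff.2 (Or.inl (Or.inl ⟨_, h.2⟩))
    · exact onBoundary_iff.2 (Or.inl (Or.inr ⟨_, h.2⟩))
    · exact onBoundary_iff.2 (Or.inr (Or.inl ⟨_, h.2⟩))
    · exact onBoundary_iff.2 (Or.inr (Or.inr ⟨_, h.2⟩))
  obtain rfl := proj_eq_of_sideCorr hB h
  exact gridMap_proj hB hp

variable (P) in
/-- The blocks exist for all large `n`. -/
theorem eventually_blockExists :
    ∀ᶠ n : ℕ+ in atTop, ∀ i : Fin n, (P.cell n i).BlockExists := by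
  have hb := P.b_pos
  have h := tendsto_natCast_atTop_atTop (R := ℝ).comp tendsto_PNat_val_atTop_atTop
  filter_upwards [h.eventually_gt_atTop (P.lineLength * Real.cos P.θ / P.b)] with n hn i
  have hn' : (0 : ℝ) < n := natCast_pos_of_fin i
  have hn : P.lineLength * Real.cos P.θ / P.b < n := hn
  rw [div_lt_iff₀ hb] at hn
  have e : (P.cell n i).lineLength * Real.cos (P.cell n i).θ =
      P.lineLength * Real.cos P.θ / n ^ 2 := by
    change P.ε / (n : ℕ) ^ 2 / (2 * Real.sin P.θ) * Real.cos P.θ =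
      P.ε / (2 * Real.sin P.θ) * Real.cos P.θ / n ^ 2
    ring
  change (P.cell n i).lineLength * Real.cos (P.cell n i).θ < P.b / n
  rw [e, div_lt_div_iff₀ (by positivity) hn']
  nlinarith

end DislocationParams

end

/-! ### The theorem, from nets and distortion. -/

open DislocationParams in
theorem theorem3p1 (P : DislocationParams) :
    -- Gromov–Hausdorff convergence of the compact metric spaces
    Tendsto (fun n : ℕ+ => GromovHausdorff.toGHSpace (P.Glued n)) atTop
      (𝓝 (GromovHausdorff.toGHSpace P.Sector)) ∧
    -- quantitative form, for all `n` for which the blocks exist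
    ∃ C : ℝ, ∀ n : ℕ+, (∀ i, (P.cell n i).BlockExists) →
      GromovHausdorff.ghDist (P.Glued n) P.Sector ≤ C / n ∧
      ∃ T : P.Sector → P.Glued n,
        -- `T` is the natural arclength-preserving map between the grids
        (∀ i j y p, P.SideCorr n i j y p → T y = P.toGlued n i j p) ∧
        BijOn T (P.sectorGrid n) (P.gluedGrid n) ∧
        BijOn T (P.sectorVertices n) (P.gluedVertices n) ∧
        -- the vertices are finite `C / n`-nets
        (P.sectorVertices n).Finite ∧ (P.gluedVertices n).Finite ∧
        (∀ y : P.Sector, ∃ v ∈ P.sectorVertices n, dist y v ≤ C / n) ∧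
        (∀ x : P.Glued n, ∃ v ∈ P.gluedVertices n, dist x v ≤ C / n) ∧
        -- the distortion of `T` is at most `C / n`
        ∀ y ∈ P.sectorGrid n, ∀ y' ∈ P.sectorGrid n,
          |dist y y' - dist (T y) (T y')| ≤ C / n := by
  obtain ⟨A, hA, hdist⟩ := P.exists_distortion_bound
  set N₁ := P.b + (P.innerRadius + P.b) * (P.ε / P.b) with hN₁
  set N₂ := (2 + Real.tan P.θ) * (P.b + (P.a + P.ε)) with hN₂
  have ha := P.a_pos
  have hb := P.b_pos
  have hε := P.ε_pos
  have hR := P.innerRadius_pos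
  have hT := P.tan_pos
  have h1 : 0 ≤ N₁ := by positivity
  have h2 : 0 ≤ N₂ := by positivity
  have main : ∀ n : ℕ+, (∀ i, (P.cell n i).BlockExists) →
      ∀ y ∈ P.sectorGrid n, ∀ y' ∈ P.sectorGrid n,
        |dist y y' - dist (P.gridMap n y) (P.gridMap n y')| ≤ A / n := by
    intro n hB y hy y' hy'
    obtain ⟨p, hp, rfl⟩ := exists_inGrid_proj_eq n.pos hy
    obtain ⟨q, hq, rfl⟩ := exists_inGrid_proj_eq n.pos hy'
    rw [gridMap_proj hB hp, gridMap_proj hB hq]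
    exact hdist n hB p q hp hq
  have hGH : ∀ n : ℕ+, (∀ i, (P.cell n i).BlockExists) →
      GromovHausdorff.ghDist (P.Glued n) P.Sector ≤ (N₁ + A + N₂) / n := by
    intro n hB
    have hn : (0 : ℝ) < n := Nat.cast_pos.2 n.pos
    -- The approximating subset consists of the vertices; net sizes and distortion add up, and the
    -- distortion, which would count only half, is taken in full.
    have := GromovHausdorff.ghDist_le_of_approx_subsets (X := P.Sector) (Y := P.Glued n)
      (s := P.sectorVertices n) (fun v => P.gridMap n v)
      (ε₁ := N₁ / n) (ε₂ := A / n) (ε₃ := N₂ / n) (exists_sectorVertices_dist_le n.pos) ?_ ?_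
    · rw [GromovHausdorff.ghDist, dist_comm]
      refine (this : dist _ _ ≤ _).trans ?_
      have : 0 ≤ A / n := by positivity
      rw [add_div (N₁ + A), add_div N₁]
      linarith
    · intro x
      obtain ⟨v, hv, hxv⟩ := exists_gluedVertices_dist_le x
      obtain ⟨y, hy, rfl⟩ := (bijOn_gridMap_vertices hB).surjOn hv
      exact ⟨⟨y, hy⟩, hxv⟩
    · exact fun y y' => main n hB y (sectorVertices_subset n y.2) y' (sectorVertices_subset n y'.2)
  refine ⟨?_, N₁ + A + N₂, fun n hB => ⟨hGH n hB, P.gridMap n,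
    fun i j y p h => gridMap_eq_of_sideCorr hB h, bijOn_gridMap hB, bijOn_gridMap_vertices hB,
    finite_sectorVertices n, ?_, ?_, ?_, ?_⟩⟩
  -- The quantitative bound holds only where the blocks exist, which is the case for all large `n`.
  · refine tendsto_iff_dist_tendsto_zero.2 (squeeze_zero' (Eventually.of_forall fun _ => dist_nonneg)
      (P.eventually_blockExists.mono hGH) ?_)
    exact (tendsto_const_div_atTop_nhds_zero_nat (N₁ + A + N₂)).comp tendsto_PNat_val_atTop_atTop
  · rw [← (bijOn_gridMap_vertices hB).image_eq]
    exact (finite_sectorVertices n).image _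
  · intro y
    obtain ⟨v, hv, h⟩ := exists_sectorVertices_dist_le n.pos y
    exact ⟨v, hv, h.trans (div_le_div_of_nonneg_right (by linarith) (Nat.cast_nonneg _))⟩
  · intro x
    obtain ⟨v, hv, h⟩ := exists_gluedVertices_dist_le x
    exact ⟨v, hv, h.trans (div_le_div_of_nonneg_right (by linarith) (Nat.cast_nonneg _))⟩
  · intro y hy y' hy'
    exact (main n hB y hy y' hy').trans
      (div_le_div_of_nonneg_right (by linarith) (Nat.cast_nonneg _))
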